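/- **Setting.** All spaces are over $\mathbb C$. For a Lipschitz map $\varphi:[0,\infty)\to\mathbb C$ with $\varphi(0)=0$ let, for a finitely supported sequence $x\in c_{00}$, $$\Omega_\varphi(x)=\sum_n x_n\,\varphi\!\left(-\log\frac{|x_n|}{\|x\|_2}\right)e_n ,\qquad \Omega_\varphi(0)=0,$$ and let $Z(\varphi)$ be the completion of $\ell_2\times c_{00}$ with respect to the quasi-norm $\|(y,x)\|_\varphi=\|y-\Omega_\varphi(x)\|_2+\|x\|_2$. Let $i:\ell_2\to Z(\varphi)$, $i(y)=(y,0)$, and let $q:Z(\varphi)\to\ell_2$ be the continuous extension of $(y,x)\mapsto x$. We say that $Z(\varphi)$ is a *singular twisted Hilbert space* if $Z(\varphi)$ is (up to an equivalent norm) a Banach space, $0\to\ell_2\xrightarrow{\,i\,}Z(\varphi)\xrightarrow{\,q\,}\ell_2\to0$ is exact ($i$ is an isomorphism onto $\ker q$, and $q$ is a quotient map), and $q$ is strictly singular, i.e. its restriction to an infinite-dimensional subspace is never an isomorphism onto its image. The conjugate dual $\overline{X^*}$ of $X$ is the dual $X^*$ with scalar multiplication $\lambda\cdot f=\overline\lambda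 f$. Two spaces are *incomparable* if neither of them is isomorphic to a subspace of the other. **Interpolation.** A Banach sequence space is a vector space $X$ of complex sequences containing all the unit vectors $e_n$, with a complete norm such that $|x_n|\le|y_n|$ for all $n$ and $y\in X$ imply $x\in X$ and $\|x\|_X\le\|y\|_X$. Given four such spaces $X_0,\dots,X_3$, with $X_j$ placed on the arc $\{e^{i\theta}: j\pi/2<\theta<(j+1)\pi/2\}$, let $\mathcal F$ be the space of coordinatewise bounded analytic functions $F:\mathbb D\to\mathbb C^{\mathbb N}$ whose radial boundary values satisfy $F(e^{i\theta})\in X_j$ for almost every $\theta$ in the $j$-th arc, $j=0,1,2,3$, with $\|F\|_{\mathcal F}=\max_j\operatorname{ess\,sup}_{\theta}\|F(e^{i\theta})\|_{X_j}<\infty$. We say that $Z(\varphi)$ *arises by complex interpolation* of $X_0,\dots,X_3$ if $\{F(0):F\in\mathcal F\}$ with the quotient norm is $\ell_2$ up to an equivalent norm, and there is $a\in\mathbb C\setminus\{0\}$ such that, for every homogeneous map $B:\ell_2\to\mathcal F$ with $B(x)(0)=x$ and $\|B(x)\|_{\mathcal F}\le K\|x\|_2$ for some constant $K$, there is $D$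 with $\|B(x)'(0)-a\,\Omega_\varphi(x)\|_2\le D\|x\|_2$ for all $x\in c_{00}$ (the induced centralizer is projectively equivalent to $\Omega_\varphi$). **Theorem.** There is an infinite-dimensional cone $\mathcal C$ of bi-Lipschitz maps $\zeta:[0,\infty)\to\mathbb C$ with $\zeta(0)=0$, that is, the convex cone (all nonempty finite linear combinations with strictly positive coefficients) generated by an infinite linearly independent set of functions, such that: 1. for every $\zeta\in\mathcal C$, $Z(\zeta)$ is a singular twisted Hilbert space which is isomorphic to its dual $Z(\zeta)^*$ but not isomorphic to its conjugate dual $\overline{Z(\zeta)^*}$; 2. for every $\zeta\in\mathcal C$, $Z(\zeta)$ arises by complex interpolation of a family of four Banach sequence spaces placed on four arcs of the unit circle; 3. if $\zeta_1,\zeta_2\in\mathcal C$ and $\zeta_1$ is not a (complex) scalar multiple of $\zeta_2$, then $Z(\zeta_1)$ and $Z(\zeta_2)$ are incomparable. -/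

import Mathlib

open Topology Filter
open scoped NNReal ENNReal

noncomputable section

namespace TwistedHilbert

/-! ### Lipschitz maps and the maps they induce on finitely supported sequences -/

/-- The complex Hilbert space `ℓ₂`. -/
abbrev L2 : Type := lp (fun _ : ℕ => ℂ) 2

/-- The vector space of Lipschitz maps `φ : [0, ∞) → ℂ` with `φ 0 = 0`. -/
def LipZero : Submodule ℂ (ℝ≥0 → ℂ) where
  carrier := {φ | φ 0 = 0 ∧ ∃ K : ℝ≥0, LipschitzWith K φ}
  zero_mem' := ⟨rfl, 0, LipschitzWith.const 0⟩
  add_mem' := by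
    rintro f g ⟨hf, K, hK⟩ ⟨hg, K', hK'⟩
    exact ⟨by simp [hf, hg], K + K', hK.add hK'⟩
  smul_mem' := by
    rintro c f ⟨hf, K, hK⟩
    refine ⟨by simp [hf], ‖c‖₊ * K, LipschitzWith.of_dist_le_mul fun x y => ?_⟩
    have h := hK.dist_le_mul x y
    simp only [Pi.smul_apply, dist_eq_norm, ← smul_sub, norm_smul, NNReal.coe_mul, coe_nnnorm,
      mul_assoc] at h ⊢
    exact mul_le_mul_of_nonneg_left h (norm_nonneg _)

/-- A map is bi-Lipschitz if `b * d(x, y) ≤ d(f x, f y) ≤ a * d(x, y)` for some `a ≥ 0`, `b > 0`. -/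
def IsBiLipschitz {X Y : Type*} [PseudoMetricSpace X] [PseudoMetricSpace Y] (f : X → Y) : Prop :=
  ∃ a b : ℝ, 0 ≤ a ∧ 0 < b ∧ ∀ x y, b * dist x y ≤ dist (f x) (f y) ∧ dist (f x) (f y) ≤ a * dist x y

/-- The inclusion of the finitely supported sequences `c₀₀` in `ℓ₂`. -/
def toL2 : (ℕ →₀ ℂ) →ₗ[ℂ] L2 where
  toFun x := ⟨fun n => x n, (memℓp_zero x.hasFiniteSupport).of_exponent_ge (by simp)⟩
  map_add' _ _ := rfl
  map_smul' _ _ := rfl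

@[simp] lemma toL2_apply (x : ℕ →₀ ℂ) (n : ℕ) : toL2 x n = x n := rfl

lemma toL2_eq_zero {x : ℕ →₀ ℂ} : toL2 x = 0 ↔ x = 0 := by
  constructor
  · intro h
    ext n
    have := congrArg (fun f : L2 => f n) h
    simpa using this
  · rintro rfl
    simp

/-- `Ω_φ (x) = ∑ₙ xₙ φ (- log (|xₙ| / ‖x‖₂)) eₙ` for `x ∈ c₀₀`. The argument of `φ` is
nonnegative for `xₙ ≠ 0`, so that `Real.toNNReal` does not change it. -/
def Omega (φ : ℝ≥0 → ℂ) (x : ℕ →₀ ℂ) : ℕ →₀ ℂ :=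
  x.mapRange (fun a => a * φ (Real.toNNReal (-Real.log (‖a‖ / ‖toL2 x‖)))) (by simp)

lemma Omega_apply (φ : ℝ≥0 → ℂ) (x : ℕ →₀ ℂ) (n : ℕ) :
    Omega φ x n = x n * φ (Real.toNNReal (-Real.log (‖x n‖ / ‖toL2 x‖))) := rfl

@[simp] lemma Omega_zero (φ : ℝ≥0 → ℂ) : Omega φ 0 = 0 := by
  ext n
  simp [Omega_apply]

lemma Omega_smul (φ : ℝ≥0 → ℂ) (c : ℂ) (x : ℕ →₀ ℂ) : Omega φ (c • x) = c • Omega φ x := by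
  rcases eq_or_ne c 0 with rfl | hc
  · simp
  ext n
  have hc' : ‖c‖ ≠ 0 := by simpa using hc
  simp only [Omega_apply, Finsupp.smul_apply, smul_eq_mul, map_smul, norm_mul, norm_smul]
  rw [mul_div_mul_left _ _ hc', mul_assoc]

/-! ### Quasi-linearity of `Ω_φ` -/

lemma norm_toL2_le {x y : ℕ →₀ ℂ} (h : ∀ n, ‖x n‖ ≤ ‖y n‖) : ‖toL2 x‖ ≤ ‖toL2 y‖ :=
  lp.norm_mono (by simp) h

lemma norm_toL2_le_mul {x y : ℕ →₀ ℂ} {c : ℝ} (hc : 0 ≤ c) (h : ∀ n, ‖x n‖ ≤ c * ‖y n‖) :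
    ‖toL2 x‖ ≤ c * ‖toL2 y‖ := by
  have : ‖toL2 x‖ ≤ ‖toL2 ((c : ℂ) • y)‖ := norm_toL2_le fun n => by simpa [abs_of_nonneg hc] using h n
  simpa [norm_smul, abs_of_nonneg hc] using this

/-- The summand of `Ω_φ` at the scale `s`. -/
def scaled (φ : ℝ≥0 → ℂ) (s : ℝ) (a : ℂ) : ℂ := a * φ (Real.toNNReal (-Real.log (‖a‖ / s)))

lemma dist_phi {φ : ℝ≥0 → ℂ} {K : ℝ≥0} (hK : LipschitzWith K φ) (s t : ℝ) :
    ‖φ (Real.toNNReal s) - φ (Real.toNNReal t)‖ ≤ K * |s - t| := by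
  have h1 := hK.dist_le_mul (Real.toNNReal s) (Real.toNNReal t)
  have h2 : dist (Real.toNNReal s) (Real.toNNReal t) ≤ |s - t| := by
    simpa [Real.dist_eq] using Real.lipschitzWith_toNNReal.dist_le_mul s t
  rw [dist_eq_norm] at h1
  exact h1.trans (mul_le_mul_of_nonneg_left h2 K.2)

lemma scaled_sub {φ : ℝ≥0 → ℂ} {K : ℝ≥0} (hK : LipschitzWith K φ) {s t : ℝ} (hs : 0 < s)
    (hst : s ≤ t) (a : ℂ) : ‖scaled φ s a - scaled φ t a‖ ≤ K * (t / s) * ‖a‖ := by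
  rcases eq_or_ne a 0 with rfl | ha
  · simp [scaled]
  have ha' : 0 < ‖a‖ := norm_pos_iff.2 ha
  have ht : 0 < t := hs.trans_le hst
  have h := dist_phi hK (-Real.log (‖a‖ / s)) (-Real.log (‖a‖ / t))
  have e : -Real.log (‖a‖ / s) - -Real.log (‖a‖ / t) = -Real.log (t / s) := by
    rw [Real.log_div ha'.ne' hs.ne', Real.log_div ha'.ne' ht.ne', Real.log_div ht.ne' hs.ne']
    ring
  have h0 : 0 ≤ Real.log (t / s) := Real.log_nonneg ((one_le_div hs).2 hst)
  have h1 : Real.log (t / s) ≤ t / s := (Real.log_le_sub_one_of_pos (by positivity)).trans (by linarith)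
  rw [e, abs_neg, abs_of_nonneg h0] at h
  have h2 := h.trans (mul_le_mul_of_nonneg_left h1 K.2)
  rw [scaled, scaled, ← mul_sub, norm_mul, mul_comm]
  exact mul_le_mul_of_nonneg_right h2 (norm_nonneg _)

lemma scaled_add {φ : ℝ≥0 → ℂ} {K : ℝ≥0} (hK : LipschitzWith K φ) {s : ℝ} (hs : 0 < s) (a b : ℂ) :
    ‖scaled φ s (a + b) - scaled φ s a - scaled φ s b‖ ≤ 3 * K * (‖a‖ + ‖b‖) := by
  set m := ‖a‖ + ‖b‖ with hm
  have hm0 : 0 ≤ m := by positivity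
  set p := φ (Real.toNNReal (-Real.log (m / s))) with hp
  have key : ∀ c : ℂ, ‖c‖ ≤ m → ‖scaled φ s c - c * p‖ ≤ K * m := by
    intro c hc
    rcases eq_or_ne c 0 with rfl | hc0
    · simpa [scaled] using mul_nonneg K.2 hm0
    have hc' : 0 < ‖c‖ := norm_pos_iff.2 hc0
    have hmp : 0 < m := hc'.trans_le hc
    have h := dist_phi hK (-Real.log (‖c‖ / s)) (-Real.log (m / s))
    have e : -Real.log (‖c‖ / s) - -Real.log (m / s) = Real.log (m / ‖c‖) := by
      rw [Real.log_div hc'.ne' hs.ne', Real.log_div hmp.ne' hs.ne', Real.log_div hmp.ne' hc'.ne']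
      ring
    have h0 : 0 ≤ Real.log (m / ‖c‖) := Real.log_nonneg ((one_le_div hc').2 hc)
    have h1 : Real.log (m / ‖c‖) ≤ m / ‖c‖ :=
      (Real.log_le_sub_one_of_pos (by positivity)).trans (by linarith)
    rw [e, abs_of_nonneg h0] at h
    have h2 := h.trans (mul_le_mul_of_nonneg_left h1 K.2)
    rw [scaled, hp, ← mul_sub, norm_mul]
    calc _ ≤ ‖c‖ * (K * (m / ‖c‖)) := mul_le_mul_of_nonneg_left h2 (norm_nonneg _)
      _ = K * m := by field_simp
  have k1 := key (a + b) (norm_add_le a b)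
  have k2 := key a (by rw [hm]; linarith [norm_nonneg b])
  have k3 := key b (by rw [hm]; linarith [norm_nonneg a])
  have e : scaled φ s (a + b) - scaled φ s a - scaled φ s b =
      (scaled φ s (a + b) - (a + b) * p) - (scaled φ s a - a * p) - (scaled φ s b - b * p) := by ring
  rw [e]
  refine (norm_sub_le _ _).trans ?_
  have := norm_sub_le (scaled φ s (a + b) - (a + b) * p) (scaled φ s a - a * p)
  linarith

/-- `Ω_φ` with the norm of `x` replaced by the scale `s`. -/
def OmegaAt (φ : ℝ≥0 → ℂ) (s : ℝ) (x : ℕ →₀ ℂ) : ℕ →₀ ℂ :=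
  x.mapRange (scaled φ s) (by simp [scaled])

lemma Omega_sub_OmegaAt {φ : ℝ≥0 → ℂ} {K : ℝ≥0} (hK : LipschitzWith K φ) {t : ℝ} (x : ℕ →₀ ℂ)
    (hx : ‖toL2 x‖ ≤ t) : ‖toL2 (Omega φ x - OmegaAt φ t x)‖ ≤ K * t := by
  have ht : 0 ≤ t := (norm_nonneg _).trans hx
  rcases eq_or_ne x 0 with rfl | h0
  · have : OmegaAt φ t 0 = 0 := by ext n; simp [OmegaAt]
    simpa [this] using mul_nonneg K.2 ht
  have hpos : 0 < ‖toL2 x‖ := norm_pos_iff.2 (by rwa [Ne, toL2_eq_zero])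
  have h := norm_toL2_le_mul (x := Omega φ x - OmegaAt φ t x) (y := x)
    (c := K * (t / ‖toL2 x‖)) (by positivity) (fun n => scaled_sub hK hpos hx (x n))
  refine h.trans_eq ?_
  field_simp

/-- The quasi-linearity of `Ω_φ`. -/
lemma Omega_quasilinear {φ : ℝ≥0 → ℂ} {K : ℝ≥0} (hK : LipschitzWith K φ) (x y : ℕ →₀ ℂ) :
    ‖toL2 (Omega φ (x + y) - Omega φ x - Omega φ y)‖ ≤ 6 * K * (‖toL2 x‖ + ‖toL2 y‖) := by
  set S := ‖toL2 x‖ + ‖toL2 y‖ with hS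
  have hS0 : 0 ≤ S := by positivity
  rcases hS0.eq_or_lt with h0 | hpos
  · have hx : x = 0 := by
      rw [← toL2_eq_zero, ← norm_eq_zero]
      linarith [norm_nonneg (toL2 x), norm_nonneg (toL2 y)]
    have hy : y = 0 := by
      rw [← toL2_eq_zero, ← norm_eq_zero]
      linarith [norm_nonneg (toL2 x), norm_nonneg (toL2 y)]
    have : 0 ≤ 6 * (K : ℝ) * S := by positivity
    simpa [hx, hy] using this
  have a1 := Omega_sub_OmegaAt hK (t := S) (x + y) (by rw [map_add]; exact norm_add_le _ _)
  have a2 := Omega_sub_OmegaAt hK (t := S) x (by rw [hS]; linarith [norm_nonneg (toL2 y)])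
  have a3 := Omega_sub_OmegaAt hK (t := S) y (by rw [hS]; linarith [norm_nonneg (toL2 x)])
  have a4 : ‖toL2 (OmegaAt φ S (x + y) - OmegaAt φ S x - OmegaAt φ S y)‖ ≤ 3 * K * S := by
    set x' : ℕ →₀ ℂ := x.mapRange (fun a => (‖a‖ : ℂ)) (by simp) with hx'
    set y' : ℕ →₀ ℂ := y.mapRange (fun a => (‖a‖ : ℂ)) (by simp) with hy'
    have b := norm_toL2_le_mul (x := OmegaAt φ S (x + y) - OmegaAt φ S x - OmegaAt φ S y)
      (y := x' + y') (c := 3 * K) (by positivity) (fun n => by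
        have e : ‖(x' + y') n‖ = ‖x n‖ + ‖y n‖ := by
          simp only [hx', hy', Finsupp.add_apply, Finsupp.mapRange_apply, ← Complex.ofReal_add]
          rw [Complex.norm_real, Real.norm_of_nonneg (by positivity)]
        rw [e]
        exact scaled_add hK hpos (x n) (y n))
    refine b.trans (mul_le_mul_of_nonneg_left ?_ (by positivity))
    rw [map_add]
    refine (norm_add_le _ _).trans (add_le_add ?_ ?_)
    · exact norm_toL2_le fun n => by simp [hx']
    · exact norm_toL2_le fun n => by simp [hy']
  have e : toL2 (Omega φ (x + y) - Omega φ x - Omega φ y) =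
      toL2 (Omega φ (x + y) - OmegaAt φ S (x + y)) - toL2 (Omega φ x - OmegaAt φ S x)
        - toL2 (Omega φ y - OmegaAt φ S y)
        + toL2 (OmegaAt φ S (x + y) - OmegaAt φ S x - OmegaAt φ S y) := by
    simp only [map_sub]
    abel
  rw [e]
  refine (norm_add_le _ _).trans ?_
  have c1 := norm_sub_le (toL2 (Omega φ (x + y) - OmegaAt φ S (x + y)) -
    toL2 (Omega φ x - OmegaAt φ S x)) (toL2 (Omega φ y - OmegaAt φ S y))
  have c2 := norm_sub_le (toL2 (Omega φ (x + y) - OmegaAt φ S (x + y)))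
    (toL2 (Omega φ x - OmegaAt φ S x))
  linarith

/-! ### The space `Z(φ)` -/

/-- The vector space `ℓ₂ × c₀₀`, to be endowed with the quasi-norm `‖·‖_φ`. -/
def PreZ (_φ : LipZero) : Type := L2 × (ℕ →₀ ℂ)

instance (φ : LipZero) : AddCommGroup (PreZ φ) := inferInstanceAs (AddCommGroup (L2 × (ℕ →₀ ℂ)))

instance (φ : LipZero) : Module ℂ (PreZ φ) := inferInstanceAs (Module ℂ (L2 × (ℕ →₀ ℂ)))

/-- The quasi-norm `‖(y, x)‖_φ = ‖y - Ω_φ x‖₂ + ‖x‖₂`. -/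
def qnorm (φ : LipZero) (u : PreZ φ) : ℝ := ‖u.1 - toL2 (Omega φ u.2)‖ + ‖toL2 u.2‖

lemma qnorm_nonneg (φ : LipZero) (u : PreZ φ) : 0 ≤ qnorm φ u := by
  unfold qnorm; positivity

lemma qnorm_zero (φ : LipZero) : qnorm φ 0 = 0 := by
  have h1 : (0 : PreZ φ).1 = 0 := rfl
  have h2 : (0 : PreZ φ).2 = 0 := rfl
  simp [qnorm, h1, h2]

lemma qnorm_smul (φ : LipZero) (c : ℂ) (u : PreZ φ) : qnorm φ (c • u) = ‖c‖ * qnorm φ u := by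
  have h1 : (c • u).1 = c • u.1 := rfl
  have h2 : (c • u).2 = c • u.2 := rfl
  rw [qnorm, qnorm, h1, h2, Omega_smul, map_smul, map_smul, ← smul_sub, norm_smul, norm_smul, mul_add]

lemma qnorm_add (φ : LipZero) :
    ∃ C : ℝ, 1 ≤ C ∧ ∀ u v : PreZ φ, qnorm φ (u + v) ≤ C * (qnorm φ u + qnorm φ v) := by
  obtain ⟨K, hK⟩ := φ.2.2
  refine ⟨1 + 6 * K, by linarith [K.2, show (0 : ℝ) ≤ K from K.2], fun u v => ?_⟩
  have h1 : (u + v).1 = u.1 + v.1 := rfl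
  have h2 : (u + v).2 = u.2 + v.2 := rfl
  have h := Omega_quasilinear hK u.2 v.2
  have e : u.1 + v.1 - toL2 (Omega φ (u.2 + v.2)) =
      (u.1 - toL2 (Omega φ u.2)) + (v.1 - toL2 (Omega φ v.2))
        - toL2 (Omega φ (u.2 + v.2) - Omega φ u.2 - Omega φ v.2) := by
    simp only [map_sub]
    abel
  have n1 := norm_sub_le ((u.1 - toL2 (Omega φ u.2)) + (v.1 - toL2 (Omega φ v.2)))
    (toL2 (Omega φ (u.2 + v.2) - Omega φ u.2 - Omega φ v.2))
  have n2 := norm_add_le (u.1 - toL2 (Omega φ u.2)) (v.1 - toL2 (Omega φ v.2))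
  have n3 := norm_add_le (toL2 u.2) (toL2 v.2)
  have p1 : 0 ≤ (K : ℝ) * ‖u.1 - toL2 (Omega φ u.2)‖ := by positivity
  have p2 : 0 ≤ (K : ℝ) * ‖v.1 - toL2 (Omega φ v.2)‖ := by positivity
  rw [qnorm, qnorm, qnorm, h1, h2, e, map_add]
  nlinarith

/-- The balls `{u | ‖u‖_φ < ε}`, `ε > 0`, as a basis of neighbourhoods of `0`. -/
def ballBasis (φ : LipZero) : ModuleFilterBasis ℂ (PreZ φ) where
  sets := {U | ∃ ε : ℝ, 0 < ε ∧ U = {u | qnorm φ u < ε}}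
  nonempty := ⟨_, 1, one_pos, rfl⟩
  inter_sets := by
    rintro _ _ ⟨ε, hε, rfl⟩ ⟨δ, hδ, rfl⟩
    exact ⟨_, ⟨min ε δ, lt_min hε hδ, rfl⟩, fun u hu =>
      have hu' : qnorm φ u < min ε δ := hu
      ⟨hu'.trans_le (min_le_left _ _), hu'.trans_le (min_le_right _ _)⟩⟩
  zero' := by
    rintro _ ⟨ε, hε, rfl⟩
    simpa [qnorm_zero] using hε
  add' := by
    rintro _ ⟨ε, hε, rfl⟩
    obtain ⟨C, hC, h⟩ := qnorm_add φ
    have hC0 : 0 < C := by linarith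
    refine ⟨_, ⟨ε / (2 * C), by positivity, rfl⟩, ?_⟩
    rintro _ ⟨u, hu, v, hv, rfl⟩
    have hu' : qnorm φ u < ε / (2 * C) := hu
    have hv' : qnorm φ v < ε / (2 * C) := hv
    calc qnorm φ (u + v) ≤ C * (qnorm φ u + qnorm φ v) := h u v
      _ < C * (ε / (2 * C) + ε / (2 * C)) := by gcongr
      _ = ε := by field_simp; ring
  neg' := by
    rintro _ ⟨ε, hε, rfl⟩
    refine ⟨_, ⟨ε, hε, rfl⟩, fun u hu => ?_⟩
    have : qnorm φ (-u) = qnorm φ u := by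
      simpa using qnorm_smul φ (-1) u
    simpa [this] using hu
  conj' := by
    rintro u _ ⟨ε, hε, rfl⟩
    exact ⟨_, ⟨ε, hε, rfl⟩, fun v hv => by simpa using hv⟩
  smul' := by
    rintro _ ⟨ε, hε, rfl⟩
    refine ⟨Metric.ball 0 1, Metric.ball_mem_nhds _ one_pos, _, ⟨ε, hε, rfl⟩, ?_⟩
    rintro _ ⟨c, hc, u, hu, rfl⟩
    have hc' : ‖c‖ < 1 := by simpa using hc
    have hu' : qnorm φ u < ε := hu
    have : qnorm φ (c • u) = ‖c‖ * qnorm φ u := qnorm_smul φ c u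
    show qnorm φ (c • u) < ε
    nlinarith [qnorm_nonneg φ u, norm_nonneg c]
  smul_left' := by
    rintro c _ ⟨ε, hε, rfl⟩
    refine ⟨_, ⟨ε / (‖c‖ + 1), by positivity, rfl⟩, fun u hu => ?_⟩
    have hu' : qnorm φ u < ε / (‖c‖ + 1) := hu
    rw [lt_div_iff₀ (by positivity)] at hu'
    show qnorm φ (c • u) < ε
    rw [qnorm_smul]
    nlinarith [qnorm_nonneg φ u]
  smul_right' := by
    rintro u _ ⟨ε, hε, rfl⟩
    have : Tendsto (fun c : ℂ => ‖c‖ * qnorm φ u) (𝓝 0) (𝓝 (‖(0 : ℂ)‖ * qnorm φ u)) :=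
      (continuous_norm.mul continuous_const).tendsto 0
    rw [norm_zero, zero_mul] at this
    filter_upwards [this.eventually (gt_mem_nhds hε)] with c hc
    show qnorm φ (c • u) < ε
    rwa [qnorm_smul]

instance (φ : LipZero) : TopologicalSpace (PreZ φ) := (ballBasis φ).topology

instance (φ : LipZero) : IsTopologicalAddGroup (PreZ φ) :=
  (ballBasis φ).toAddGroupFilterBasis.isTopologicalAddGroup

instance (φ : LipZero) : ContinuousSMul ℂ (PreZ φ) := (ballBasis φ).continuousSMul

/-- The uniformity of `PreZ φ`: the entourages are generated by the sets
`{(u, v) | ‖u - v‖_φ < ε}`. -/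
instance (φ : LipZero) : UniformSpace (PreZ φ) := IsTopologicalAddGroup.rightUniformSpace (PreZ φ)

instance (φ : LipZero) : IsUniformAddGroup (PreZ φ) := isUniformAddGroup_of_addCommGroup

instance (φ : LipZero) : UniformContinuousConstSMul ℂ (PreZ φ) :=
  uniformContinuousConstSMul_of_continuousConstSMul ℂ (PreZ φ)

lemma nhds_zero_basis (φ : LipZero) :
    (𝓝 (0 : PreZ φ)).HasBasis (fun ε : ℝ => 0 < ε) (fun ε => {u | qnorm φ u < ε}) := by
  have h := (ballBasis φ).toAddGroupFilterBasis.nhds_zero_hasBasis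
  refine h.to_hasBasis ?_ ?_
  · rintro _ ⟨ε, hε, rfl⟩
    exact ⟨ε, hε, subset_rfl⟩
  · intro ε hε
    exact ⟨_, ⟨ε, hε, rfl⟩, subset_rfl⟩

/-- The twisted Hilbert space `Z(φ)`: the completion of `(ℓ₂ × c₀₀, ‖·‖_φ)`. -/
abbrev Z (φ : LipZero) : Type := UniformSpace.Completion (PreZ φ)

/-- `y ↦ (y, 0)` on the level of `ℓ₂ × c₀₀`. -/
def preIncl (φ : LipZero) : L2 →ₗ[ℂ] PreZ φ := LinearMap.inl ℂ L2 (ℕ →₀ ℂ)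

/-- `(y, x) ↦ x` on the level of `ℓ₂ × c₀₀`. -/
def preQuot (φ : LipZero) : PreZ φ →ₗ[ℂ] L2 := toL2 ∘ₗ LinearMap.snd ℂ L2 (ℕ →₀ ℂ)

lemma continuous_preIncl (φ : LipZero) : Continuous (preIncl φ) := by
  refine continuous_of_continuousAt_zero (preIncl φ) ?_
  rw [ContinuousAt, map_zero, (nhds_zero_basis φ).tendsto_right_iff]
  intro ε hε
  filter_upwards [Metric.ball_mem_nhds (0 : L2) hε] with y hy
  have h1 : (preIncl φ y).1 = y := rfl
  have h2 : (preIncl φ y).2 = 0 := rfl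
  simpa [qnorm, h1, h2] using hy

lemma continuous_preQuot (φ : LipZero) : Continuous (preQuot φ) := by
  refine continuous_of_continuousAt_zero (preQuot φ) ?_
  rw [ContinuousAt, map_zero]
  refine ((nhds_zero_basis φ).tendsto_iff Metric.nhds_basis_ball).2 fun ε hε => ⟨ε, hε, fun u hu => ?_⟩
  have hu' : qnorm φ u < ε := hu
  rw [qnorm] at hu'
  have h : preQuot φ u = toL2 u.2 := rfl
  rw [mem_ball_zero_iff, h]
  linarith [norm_nonneg (u.1 - toL2 (Omega φ u.2))]

/-- The inclusion `i : ℓ₂ → Z(φ)`, `i y = (y, 0)`. -/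
def incl (φ : LipZero) : L2 →L[ℂ] Z φ where
  toFun y := ((preIncl φ y : PreZ φ) : Z φ)
  map_add' y y' := by rw [map_add, UniformSpace.Completion.coe_add]
  map_smul' c y := by rw [map_smul, UniformSpace.Completion.coe_smul, RingHom.id_apply]
  cont := (UniformSpace.Completion.continuous_coe _).comp (continuous_preIncl φ)

/-- The quotient map `q : Z(φ) → ℓ₂`, the continuous extension of `(y, x) ↦ x`. -/
def quot (φ : LipZero) : Z φ →L[ℂ] L2 where
  toFun := (preQuot φ).toAddMonoidHom.extension (continuous_preQuot φ)
  map_add' := map_add _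
  map_smul' c u := by
    have hc := AddMonoidHom.continuous_extension (preQuot φ).toAddMonoidHom (continuous_preQuot φ)
    induction u using UniformSpace.Completion.induction_on with
    | hp => exact isClosed_eq (hc.comp (continuous_const_smul c)) (hc.const_smul c)
    | ih u =>
      rw [← UniformSpace.Completion.coe_smul]
      have h := AddMonoidHom.extension_coe (preQuot φ).toAddMonoidHom (continuous_preQuot φ)
      rw [h, h]
      exact map_smul (preQuot φ) c u
  cont := AddMonoidHom.continuous_extension _ (continuous_preQuot φ)

/-! ### Properties of topological vector spaces -/

/-- `E` is, up to an equivalent norm, a Banach space. -/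
def IsBanachable (E : Type) [AddCommGroup E] [Module ℂ E] [TopologicalSpace E] : Prop :=
  ∃ (B : Type) (_ : NormedAddCommGroup B) (_ : NormedSpace ℂ B),
    CompleteSpace B ∧ Nonempty (E ≃L[ℂ] B)

/-- `q` is strictly singular: its restriction to an infinite-dimensional subspace is never an
isomorphism onto its image. -/
def IsStrictlySingular {E F : Type*} [AddCommGroup E] [Module ℂ E] [TopologicalSpace E]
    [AddCommGroup F] [Module ℂ F] [TopologicalSpace F] (q : E →L[ℂ] F) : Prop :=
  ∀ W : Submodule ℂ E, ¬ FiniteDimensional ℂ W → ¬ IsEmbedding (fun w : W => q w)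

/-- `0 → ℓ₂ → X → ℓ₂ → 0` is a short exact sequence of Banach spaces (`i` is an isomorphism onto
its image, which is the kernel of `q`, and `q` induces an isomorphism of `X / i(ℓ₂)` with `ℓ₂`)
whose quotient map `q` is strictly singular. -/
structure IsSingularTwistedHilbert {X : Type} [AddCommGroup X] [Module ℂ X] [TopologicalSpace X]
    (i : L2 →L[ℂ] X) (q : X →L[ℂ] L2) : Prop where
  banachable : IsBanachable X
  isEmbedding : IsEmbedding i
  exact : Set.range i = {u | q u = 0}
  isQuotientMap : IsQuotientMap q
  singular : IsStrictlySingular q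

/-- `E` is isomorphic to a subspace of `F`. -/
def EmbedsIn (E F : Type*) [AddCommGroup E] [Module ℂ E] [TopologicalSpace E]
    [AddCommGroup F] [Module ℂ F] [TopologicalSpace F] : Prop :=
  ∃ T : E →L[ℂ] F, IsEmbedding T

/-- `E` and `F` are incomparable: neither is isomorphic to a subspace of the other. -/
def Incomparable (E F : Type*) [AddCommGroup E] [Module ℂ E] [TopologicalSpace E]
    [AddCommGroup F] [Module ℂ F] [TopologicalSpace F] : Prop :=
  ¬ EmbedsIn E F ∧ ¬ EmbedsIn F E

/-- `E` is isomorphic to its dual. -/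
def IsoDual (E : Type*) [AddCommGroup E] [Module ℂ E] [TopologicalSpace E] : Prop :=
  Nonempty (E ≃L[ℂ] StrongDual ℂ E)

/-- `E` is isomorphic to its conjugate dual. A linear isomorphism onto the complex conjugate of
the dual is the same thing as a conjugate-linear isomorphism onto the dual. -/
def IsoConjDual (E : Type*) [AddCommGroup E] [Module ℂ E] [TopologicalSpace E] : Prop :=
  Nonempty (E ≃L⋆[ℂ] StrongDual ℂ E)

/-! ### Complex interpolation of four spaces on arcs of the unit circle -/

/-- A Banach (Köthe) sequence space, given by its norm, which takes the value `∞` exactly at the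
sequences outside of the space. -/
structure BanachSeqSpace where
  /-- the norm -/
  nrm : (ℕ → ℂ) → ℝ≥0∞
  eq_zero_iff : ∀ x, nrm x = 0 ↔ x = 0
  nrm_smul : ∀ (c : ℂ) x, nrm (c • x) = ‖c‖ₑ * nrm x
  nrm_add_le : ∀ x y, nrm (x + y) ≤ nrm x + nrm y
  solid : ∀ x y, (∀ n, ‖x n‖ ≤ ‖y n‖) → nrm x ≤ nrm y
  single_lt_top : ∀ n, nrm (Pi.single n 1) < ∞
  complete : ∀ u : ℕ → ℕ → ℂ, (∀ k, nrm (u k) < ∞) →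
    (∀ ε : ℝ≥0∞, 0 < ε → ∃ N, ∀ k l, N ≤ k → N ≤ l → nrm (u k - u l) ≤ ε) →
    ∃ x, nrm x < ∞ ∧ Tendsto (fun k => nrm (u k - x)) atTop (𝓝 0)

/-- `F` belongs to the space `ℱ` of the family that has the space `X j` on the open arc from
`exp (i j π / 2)` to `exp (i (j + 1) π / 2)` of the unit circle, `j = 0, 1, 2, 3`, and its norm
there is at most `M`: `F` is an analytic function on the unit disc whose coordinates are bounded
and whose radial boundary value at almost every point of the `j`-th arc lies in `X j` with norm
at most `M`. (For such boundary values, the coordinates of an `F` in the Smirnov class are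
automatically bounded.) -/
structure MemF (X : Fin 4 → BanachSeqSpace) (F : ℂ → ℕ → ℂ) (M : ℝ) : Prop where
  analytic : ∀ n, DifferentiableOn ℂ (fun z => F z n) (Metric.ball 0 1)
  bounded : ∀ n, ∃ R : ℝ, ∀ z ∈ Metric.ball (0 : ℂ) 1, ‖F z n‖ ≤ R
  boundary : ∀ j : Fin 4,
    ∀ᵐ θ : ℝ ∂(MeasureTheory.volume.restrict
      (Set.Ioo (((j : ℕ) : ℝ) * (Real.pi / 2)) ((((j : ℕ) : ℝ) + 1) * (Real.pi / 2)))),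
    ∃ b : ℕ → ℂ,
      Tendsto (fun r : ℝ => F (r * Complex.exp (θ * Complex.I))) (𝓝[<] 1) (𝓝 b) ∧
      (X j).nrm b ≤ ENNReal.ofReal M

/-- The interpolation space `{F 0 | F ∈ ℱ}` of the family at `0`, with the quotient norm, is `ℓ₂`
up to an equivalent norm. -/
def InterpolatesToL2 (X : Fin 4 → BanachSeqSpace) : Prop :=
  ∃ K : ℝ, (∀ x : L2, ∃ F, MemF X F (K * ‖x‖) ∧ F 0 = x) ∧
    ∀ F M, 0 ≤ M → MemF X F M → ∃ x : L2, F 0 = x ∧ ‖x‖ ≤ K * M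

/-- `B` is a bounded homogeneous selection `ℓ₂ → ℱ` for the evaluation `F ↦ F 0`. -/
structure IsSelection (X : Fin 4 → BanachSeqSpace) (B : L2 → ℂ → ℕ → ℂ) : Prop where
  bounded : ∃ K : ℝ, ∀ x, MemF X (B x) (K * ‖x‖)
  eval : ∀ x, B x 0 = x
  homogeneous : ∀ (c : ℂ) (x : L2), ∀ z ∈ Metric.ball (0 : ℂ) 1, B (c • x) z = c • B x z

/-- The centralizer `x ↦ (B x)' (0)` induced at `0` by a selection `B`. -/
def derivation (B : L2 → ℂ → ℕ → ℂ) (x : L2) : ℕ → ℂ := fun n => deriv (fun z => B x z n) 0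

/-- The differential process of complex interpolation of a family of four Banach sequence spaces
distributed on arcs of the unit circle yields `Z(φ)`: the family interpolates at `0` to `ℓ₂`, and
the centralizer that it induces there (for any choice of the selection) is projectively
equivalent to `Ω_φ`. -/
def ArisesByInterpolation (φ : LipZero) : Prop :=
  ∃ X : Fin 4 → BanachSeqSpace, InterpolatesToL2 X ∧
    ∃ a : ℂ, a ≠ 0 ∧ ∀ B, IsSelection X B → ∃ D : ℝ, ∀ x : ℕ →₀ ℂ,
      ∃ w : L2, (∀ n, w n = derivation B (toL2 x) n - a * Omega φ x n) ∧ ‖w‖ ≤ D * ‖toL2 x‖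

end TwistedHilbert

end

/-! Duality. The form `⟨(y, x), (y', x')⟩ = ∑ (yₙ x'ₙ - xₙ y'ₙ)` is bounded for the quasi-norm,
because `Ω_φ` is symmetric up to a bounded error (`norm_dot_Omega_sub_le`). It determines the
quasi-norm up to constants, so it makes `Z(φ)` a Banach space, and it identifies `Z(φ)` linearly
with its dual (`isoDual_Z`). This works for every Lipschitz `φ`.

Rigidity. Let `T : Z(φ) → Z(ψ)` be a linear or conjugate-linear embedding, with `σ` the identity or
conjugation. On a sum `x` of `N` signed unit vectors `Ω_φ x = φ(log √N) x`, so with `αₖ = T(eₖ, 0)`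
and `βₖ = T(0, eₖ)` the signed sums of `αₖ` and of `βₖ + σφ(log √N) αₖ` are `O(√N)`. If `ψ` is
bi-Lipschitz, the first estimate forces the images of `αₖ` in `ℓ₂` to vanish in the limit, so `αₖ`
is almost some `(fₖ, 0)`, while the images of `βₖ` are almost disjoint blocks `wₖ`. Comparing with
`Ω_ψ` of a sum of blocks, `σφ(log √N) fₖ` is at bounded distance from `wₖ (ψ(τ + log √N) - ψ(τ))`,
where `τ = -log(|wₖ| / M)` coordinatewise. Eliminating `fₖ` between three scales shows that the
values of `σφ` at three large points are nearly proportional to increments of `ψ` from a common `τ`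
(`exists_incr_of_isEmbedding`). The same block argument gives strict singularity.

The cone. The `k`-th generator is `t + i m(t)`, where `m(t)` measures the part of `[0, t)` covered
by the intervals `[j!, (j + 1)!)` of type `k + 1`. Intervals with even `j` have no type, and each
type occurs infinitely often. Apply the proportionality at `j!`, `(j + 1)!`, `(j + 2)!`, where `j`
has type `k + 1`: the averages of the imaginary slope of `φ` over `[0, s)` are about `0, cₖ, 0`, so
those of `ψ` after `τ` must be about `0, ± D cₖ / C, 0`, with `C`, `D` the real slopes and the minus
sign for conjugate-linear `T`. A negative average is impossible. A positive one cannot exceed about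
`dₖ`, by the position of the empty intervals, and `k` can be chosen with `C dₖ < D cₖ` unless the
functions are proportional (`not_isEmbedding`). The first case excludes the conjugate dual, the
second gives incomparability.

Interpolation. Every `φ` arises from four spaces with logarithmic weights `± P ± Q`, where `P` and
`-Q` are multiples of the real and imaginary parts of `φ`. The functions `xₙ exp(P S(z) + Q
S(-iz))`, with `S` the conformal map onto a strip, are extremal, and their derivatives at `0` are
multiples of `Ω_φ x`. -/

noncomputable section

namespace TwistedHilbert

/-! ### The bilinear pairing of `ℓ₂` with itself -/

/-- The bilinear form `∑ₙ yₙ xₙ` on `ℓ₂`. -/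
def dot (y x : L2) : ℂ := inner ℂ (star y) x

lemma dot_eq_tsum (y x : L2) : dot y x = ∑' n, y n * x n := by
  rw [dot, lp.inner_eq_tsum]
  refine tsum_congr fun n => ?_
  rw [lp.star_apply]
  simp [mul_comm]

lemma dot_comm (y x : L2) : dot y x = dot x y := by
  simp_rw [dot_eq_tsum, mul_comm]

lemma dot_add_right (y x x' : L2) : dot y (x + x') = dot y x + dot y x' := inner_add_right _ _ _

lemma dot_smul_right (y : L2) (c : ℂ) (x : L2) : dot y (c • x) = c * dot y x :=
  inner_smul_right _ _ _

lemma dot_add_left (y y' x : L2) : dot (y + y') x = dot y x + dot y' x := by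
  simp only [dot_comm _ x, dot_add_right]

lemma dot_smul_left (c : ℂ) (y x : L2) : dot (c • y) x = c * dot y x := by
  simp only [dot_comm _ x, dot_smul_right]

@[simp] lemma dot_zero_left (x : L2) : dot 0 x = 0 := by simp [dot]

@[simp] lemma dot_zero_right (x : L2) : dot x 0 = 0 := by simp [dot]

lemma dot_sub_right (y x x' : L2) : dot y (x - x') = dot y x - dot y x' := inner_sub_right _ _ _

lemma dot_sub_left (y y' x : L2) : dot (y - y') x = dot y x - dot y' x := by
  simp only [dot_comm _ x, dot_sub_right]

lemma norm_dot_le (y x : L2) : ‖dot y x‖ ≤ ‖y‖ * ‖x‖ := by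
  simpa [dot, norm_star] using norm_inner_le_norm (𝕜 := ℂ) (star y) x

lemma dot_star_self (y : L2) : dot y (star y) = (‖y‖ ^ 2 : ℝ) := by
  rw [dot, inner_self_eq_norm_sq_to_K, norm_star]
  simp

lemma eq_zero_of_dot_eq_zero {y : L2} (h : ∀ x, dot y x = 0) : y = 0 := by
  have := h (star y)
  rw [dot_star_self] at this
  simpa using this

lemma exists_dot_eq (f : L2 →L[ℂ] ℂ) : ∃ y : L2, ∀ x, f x = dot y x := by
  refine ⟨star ((InnerProductSpace.toDual ℂ L2).symm f), fun x => ?_⟩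
  rw [dot, star_star, InnerProductSpace.toDual_symm_apply]

lemma dot_toL2_right (y : L2) (x : ℕ →₀ ℂ) : dot y (toL2 x) = ∑ n ∈ x.support, y n * x n := by
  rw [dot_eq_tsum, tsum_eq_sum (s := x.support)]
  · rfl
  · intro n hn
    simp [Finsupp.notMem_support_iff.1 hn]

lemma toL2_single (i : ℕ) (a : ℂ) : toL2 (Finsupp.single i a) = lp.single 2 i a := by
  ext n
  rw [toL2_apply, lp.single_apply, Finsupp.single_apply, Pi.single_apply]
  simp [eq_comm]

/-- The closure of `c₀₀` in `ℓ₂` is `ℓ₂`. -/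
lemma denseRange_toL2 : DenseRange toL2 := by
  intro x
  have h := lp.hasSum_single (p := 2) (by simp) x
  refine mem_closure_of_tendsto h (Eventually.of_forall fun s => ?_)
  refine ⟨∑ i ∈ s, Finsupp.single i (x i), ?_⟩
  rw [map_sum]
  exact Finset.sum_congr rfl fun i _ => toL2_single i _

lemma norm_toL2_sq (x : ℕ →₀ ℂ) : ‖toL2 x‖ ^ 2 = ∑ n ∈ x.support, ‖x n‖ ^ 2 := by
  have h : HasSum (fun n => ‖toL2 x n‖ ^ (2 : ℝ≥0∞).toReal) (‖toL2 x‖ ^ (2 : ℝ≥0∞).toReal) :=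
    lp.hasSum_norm (by simp) _
  have h' := h.unique (hasSum_sum_of_ne_finset_zero (s := x.support) (fun n hn => by
    simp [Finsupp.notMem_support_iff.1 hn]))
  simpa using h'

lemma norm_apply_le_norm_toL2 (x : ℕ →₀ ℂ) (n : ℕ) : ‖x n‖ ≤ ‖toL2 x‖ :=
  lp.norm_apply_le_norm (by simp) (toL2 x) n

lemma norm_le_of_norm_dot_le {y : L2} {C : ℝ} (hC : 0 ≤ C)
    (h : ∀ x : ℕ →₀ ℂ, ‖dot y (toL2 x)‖ ≤ C * ‖toL2 x‖) : ‖y‖ ≤ C := by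
  have h' : ∀ x : L2, ‖dot y x‖ ≤ C * ‖x‖ := fun x => by
    refine denseRange_toL2.induction_on x (isClosed_le ?_ (by fun_prop)) h
    unfold dot
    fun_prop
  have := h' (star y)
  rw [dot_star_self, norm_star] at this
  rcases (norm_nonneg y).eq_or_lt with h0 | h0
  · rw [← h0]; exact hC
  · rw [Complex.norm_real, Real.norm_of_nonneg (by positivity), pow_two] at this
    exact le_of_mul_le_mul_right this h0

/-! ### The symplectic pairing on `ℓ₂ × c₀₀` -/

/-- Since `log (b / a) ≤ b / a` for `a ≤ b`, the smaller factor cancels and `b²` remains. -/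
lemma mul_mul_abs_log_sub_log_le {a b : ℝ} (ha : 0 < a) (hb : 0 < b) :
    a * b * |Real.log a - Real.log b| ≤ a ^ 2 + b ^ 2 := by
  wlog hab : a ≤ b generalizing a b
  · rw [mul_comm a, abs_sub_comm, add_comm]
    exact this hb ha (le_of_not_ge hab)
  rw [abs_sub_comm, ← Real.log_div hb.ne' ha.ne',
    abs_of_nonneg (Real.log_nonneg ((one_le_div ha).2 hab))]
  have h := (Real.log_le_sub_one_of_pos (show 0 < b / a by positivity)).trans (sub_le_self _ zero_le_one)
  calc a * b * Real.log (b / a) ≤ a * b * (b / a) := by gcongr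
    _ = b ^ 2 := by field_simp
    _ ≤ _ := by nlinarith [sq_nonneg a]

/-- In each coordinate the difference is `xₙ x'ₙ` times a difference of two values of `φ`, hence at
most `K |xₙ x'ₙ|` times a difference of logarithms. After normalization the preceding inequality
bounds it by a sum of two squares, and these are summable. -/
lemma norm_dot_Omega_sub_le {φ : ℝ≥0 → ℂ} {K : ℝ≥0} (hK : LipschitzWith K φ) (x x' : ℕ →₀ ℂ) :
    ‖dot (toL2 (Omega φ x)) (toL2 x') - dot (toL2 x) (toL2 (Omega φ x'))‖ ≤
      2 * K * (‖toL2 x‖ * ‖toL2 x'‖) := by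
  rcases eq_or_ne x 0 with rfl | hx
  · simp
  rcases eq_or_ne x' 0 with rfl | hx'
  · simp
  have px : 0 < ‖toL2 x‖ := norm_pos_iff.2 (by rwa [Ne, toL2_eq_zero])
  have px' : 0 < ‖toL2 x'‖ := norm_pos_iff.2 (by rwa [Ne, toL2_eq_zero])
  set r := ‖toL2 x‖ with hr
  set r' := ‖toL2 x'‖ with hr'
  set s := x.support ∪ x'.support
  have e1 : dot (toL2 (Omega φ x)) (toL2 x') = ∑ n ∈ s, Omega φ x n * x' n := by
    rw [dot_toL2_right]
    refine Finset.sum_subset Finset.subset_union_right fun n _ hn => ?_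
    simp [Finsupp.notMem_support_iff.1 hn]
  have e2 : dot (toL2 x) (toL2 (Omega φ x')) = ∑ n ∈ s, Omega φ x' n * x n := by
    rw [dot_comm, dot_toL2_right]
    refine Finset.sum_subset Finset.subset_union_left fun n _ hn => ?_
    simp [Finsupp.notMem_support_iff.1 hn]
  have sumle : ∀ z : ℕ →₀ ℂ, z.support ⊆ s → ∑ n ∈ s, ‖z n‖ ^ 2 = ‖toL2 z‖ ^ 2 := fun z hz => by
    rw [norm_toL2_sq]
    refine (Finset.sum_subset hz fun n _ hn => ?_).symm
    simp [Finsupp.notMem_support_iff.1 hn]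
  rw [e1, e2, ← Finset.sum_sub_distrib]
  have key : ∀ n ∈ s, ‖Omega φ x n * x' n - Omega φ x' n * x n‖ ≤
      K * (r * r') * ((‖x n‖ / r) ^ 2 + (‖x' n‖ / r') ^ 2) := by
    intro n _
    rcases eq_or_ne (x n) 0 with h0 | h0
    · simp only [Omega_apply, h0, zero_mul, mul_zero, sub_zero, norm_zero]
      positivity
    rcases eq_or_ne (x' n) 0 with h0' | h0'
    · simp only [Omega_apply, h0', zero_mul, mul_zero, sub_zero, norm_zero]
      positivity
    have p1 : 0 < ‖x n‖ / r := div_pos (norm_pos_iff.2 h0) px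
    have p2 : 0 < ‖x' n‖ / r' := div_pos (norm_pos_iff.2 h0') px'
    have h := dist_phi hK (-Real.log (‖x n‖ / r)) (-Real.log (‖x' n‖ / r'))
    rw [neg_sub_neg, abs_sub_comm] at h
    have e : Omega φ x n * x' n - Omega φ x' n * x n = x n * x' n *
        (φ (Real.toNNReal (-Real.log (‖x n‖ / r))) - φ (Real.toNNReal (-Real.log (‖x' n‖ / r')))) := by
      rw [Omega_apply, Omega_apply]; ring
    rw [e, norm_mul, norm_mul]
    calc _ ≤ ‖x n‖ * ‖x' n‖ * (K * |Real.log (‖x n‖ / r) - Real.log (‖x' n‖ / r')|) := by gcongr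
      _ = K * (r * r') * ((‖x n‖ / r) * (‖x' n‖ / r') *
          |Real.log (‖x n‖ / r) - Real.log (‖x' n‖ / r')|) := by field_simp
      _ ≤ _ := by
        gcongr
        exact mul_mul_abs_log_sub_log_le p1 p2
  refine (norm_sum_le _ _).trans ((Finset.sum_le_sum key).trans_eq ?_)
  rw [← Finset.mul_sum, Finset.sum_add_distrib]
  simp_rw [div_pow]
  rw [← Finset.sum_div, ← Finset.sum_div, sumle x Finset.subset_union_left,
    sumle x' Finset.subset_union_right, ← hr, ← hr']
  field_simp
  ring

/-- The element `(y, x)` of `ℓ₂ × c₀₀`. -/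
def pair (φ : LipZero) (y : L2) (x : ℕ →₀ ℂ) : PreZ φ := (y, x)

@[simp] lemma pair_fst (φ : LipZero) (y : L2) (x : ℕ →₀ ℂ) : (pair φ y x).1 = y := rfl

@[simp] lemma pair_snd (φ : LipZero) (y : L2) (x : ℕ →₀ ℂ) : (pair φ y x).2 = x := rfl

lemma pair_eta (φ : LipZero) (u : PreZ φ) : pair φ u.1 u.2 = u := rfl

lemma qnorm_pair (φ : LipZero) (y : L2) (x : ℕ →₀ ℂ) :
    qnorm φ (pair φ y x) = ‖y - toL2 (Omega φ x)‖ + ‖toL2 x‖ := rfl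

lemma pair_add (φ : LipZero) (y y' : L2) (x x' : ℕ →₀ ℂ) :
    pair φ y x + pair φ y' x' = pair φ (y + y') (x + x') := rfl

lemma pair_smul (φ : LipZero) (c : ℂ) (y : L2) (x : ℕ →₀ ℂ) :
    c • pair φ y x = pair φ (c • y) (c • x) := rfl

/-- The bilinear form `⟨(y, x), (y', x')⟩ = ∑ₙ (yₙ x'ₙ - xₙ y'ₙ)`, as a functional of `(y, x)`. -/
def symp (φ : LipZero) (v : PreZ φ) : PreZ φ →ₗ[ℂ] ℂ where
  toFun u := dot u.1 (toL2 v.2) - dot (toL2 u.2) v.1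
  map_add' u u' := by
    have h1 : (u + u').1 = u.1 + u'.1 := rfl
    have h2 : (u + u').2 = u.2 + u'.2 := rfl
    rw [h1, h2, map_add, dot_add_left, dot_add_left]; ring
  map_smul' c u := by
    have h1 : (c • u).1 = c • u.1 := rfl
    have h2 : (c • u).2 = c • u.2 := rfl
    rw [h1, h2, map_smul, dot_smul_left, dot_smul_left, RingHom.id_apply, smul_eq_mul]; ring

lemma symp_apply (φ : LipZero) (u v : PreZ φ) :
    symp φ v u = dot u.1 (toL2 v.2) - dot (toL2 u.2) v.1 := rfl

lemma symp_swap (φ : LipZero) (u v : PreZ φ) : symp φ v u = -symp φ u v := by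
  rw [symp_apply, symp_apply, dot_comm u.1, dot_comm v.1]; ring

/-- Subtracting `Ω_φ` from both first coordinates leaves two terms bounded by Cauchy-Schwarz and the
defect of symmetry of `Ω_φ`. -/
lemma exists_norm_symp_le (φ : LipZero) :
    ∃ C : ℝ, 0 < C ∧ ∀ u v : PreZ φ, ‖symp φ v u‖ ≤ C * (qnorm φ u * qnorm φ v) := by
  obtain ⟨K, hK⟩ := φ.2.2
  refine ⟨1 + 2 * K, by positivity, fun u v => ?_⟩
  have e : symp φ v u = dot (u.1 - toL2 (Omega φ u.2)) (toL2 v.2)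
      - dot (toL2 u.2) (v.1 - toL2 (Omega φ v.2))
      + (dot (toL2 (Omega φ u.2)) (toL2 v.2) - dot (toL2 u.2) (toL2 (Omega φ v.2))) := by
    rw [symp_apply, dot_sub_left, dot_sub_right]; ring
  have h1 := norm_dot_le (u.1 - toL2 (Omega φ u.2)) (toL2 v.2)
  have h2 := norm_dot_le (toL2 u.2) (v.1 - toL2 (Omega φ v.2))
  have h3 := norm_dot_Omega_sub_le hK u.2 v.2
  rw [e]
  refine (norm_add_le _ _).trans ?_
  have h4 := norm_sub_le (dot (u.1 - toL2 (Omega φ u.2)) (toL2 v.2))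
    (dot (toL2 u.2) (v.1 - toL2 (Omega φ v.2)))
  rw [qnorm, qnorm]
  have a1 := norm_nonneg (u.1 - toL2 (Omega φ u.2))
  have a2 := norm_nonneg (v.1 - toL2 (Omega φ v.2))
  have a3 := norm_nonneg (toL2 u.2)
  have a4 := norm_nonneg (toL2 v.2)
  have a5 : (0 : ℝ) ≤ K := K.2
  generalize ‖u.1 - toL2 (Omega φ u.2)‖ = p at *
  generalize ‖v.1 - toL2 (Omega φ v.2)‖ = p' at *
  generalize ‖toL2 u.2‖ = r at *
  generalize ‖toL2 v.2‖ = r' at *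
  have b1 : 0 ≤ p * p' := by positivity
  have b2 : 0 ≤ K * (p * p') := by positivity
  have b3 : 0 ≤ K * (p * r') := by positivity
  have b4 : 0 ≤ K * (r * p') := by positivity
  nlinarith

/-! ### An equivalent norm on `Z(φ)` -/

/-- The unit ball of `ℓ₂ × c₀₀`. -/
abbrev UnitBall (φ : LipZero) : Type := {v : PreZ φ // qnorm φ v ≤ 1}

/-- The space of bounded functions on the unit ball. -/
abbrev BallFun (φ : LipZero) : Type := lp (fun _ : UnitBall φ => ℂ) ∞

/-- The map that takes `u` to the functional `⟨u, ·⟩`, restricted to the unit ball. -/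
def preRep (φ : LipZero) : PreZ φ →ₗ[ℂ] BallFun φ where
  toFun u := ⟨fun v => symp φ v.1 u, memℓp_infty (by
    obtain ⟨C, hC, h⟩ := exists_norm_symp_le φ
    refine ⟨C * qnorm φ u, ?_⟩
    rintro _ ⟨v, rfl⟩
    refine (h u v).trans ?_
    have := qnorm_nonneg φ u
    have := v.2
    gcongr
    nlinarith)⟩
  map_add' u u' := by ext v; exact map_add (symp φ v.1) u u'
  map_smul' c u := by ext v; exact map_smul (symp φ v.1) c u

lemma preRep_apply (φ : LipZero) (u : PreZ φ) (v : UnitBall φ) : preRep φ u v = symp φ v.1 u := rfl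

/-- The quasi-norm is equivalent to the norm of the functional `⟨u, ·⟩`, which is what makes `Z(φ)`
normable. -/
lemma exists_norm_preRep (φ : LipZero) : ∃ K : ℝ, 0 < K ∧ ∀ u : PreZ φ,
    ‖preRep φ u‖ ≤ K * qnorm φ u ∧ qnorm φ u ≤ K * ‖preRep φ u‖ := by
  obtain ⟨C, hC, h⟩ := exists_norm_symp_le φ
  obtain ⟨L, hL⟩ := φ.2.2
  refine ⟨C + 2 * L + 2, by positivity, fun u => ⟨?_, ?_⟩⟩
  · have h0 := qnorm_nonneg φ u
    refine lp.norm_le_of_forall_le (by positivity) fun v => ?_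
    rw [preRep_apply]
    refine (h u v).trans ?_
    have := v.2
    have hL0 : (0 : ℝ) ≤ L := L.2
    have h1 : qnorm φ u * qnorm φ v.1 ≤ qnorm φ u := by nlinarith
    nlinarith [mul_nonneg hL0 h0]
  set P := ‖preRep φ u‖ with hP
  have hP0 : 0 ≤ P := norm_nonneg _
  have hb : ∀ v : PreZ φ, ‖symp φ v u‖ ≤ P * qnorm φ v := by
    intro v
    rcases (qnorm_nonneg φ v).eq_or_lt with h0 | h0
    · have := h u v
      rw [← h0] at this ⊢
      simpa using this
    · have hv : qnorm φ ((((qnorm φ v)⁻¹ : ℝ) : ℂ) • v) ≤ 1 := by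
        rw [qnorm_smul, Complex.norm_real, Real.norm_of_nonneg (by positivity), inv_mul_cancel₀ h0.ne']
      have := lp.norm_apply_le_norm (by simp) (preRep φ u) (⟨_, hv⟩ : UnitBall φ)
      rw [preRep_apply, symp_swap, norm_neg, map_smul, norm_smul, Complex.norm_real,
        Real.norm_of_nonneg (by positivity), ← hP, symp_swap, norm_neg, inv_mul_le_iff₀ h0] at this
      rwa [mul_comm]
  have hx : ‖toL2 u.2‖ ≤ P := by
    refine norm_le_of_norm_dot_le hP0 fun z => ?_
    -- Testing on `(z, 0)` sees only the second coordinate of `u`.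
    have := hb (pair φ (toL2 z) 0)
    rw [symp_apply] at this
    simpa [qnorm_pair] using this
  have hy : ‖u.1 - toL2 (Omega φ u.2)‖ ≤ P + 2 * L * P := by
    refine norm_le_of_norm_dot_le (by positivity) fun z => ?_
    -- The lift `(Ω_φ z, z)` has quasi-norm `‖z‖`. Pairing with it gives `y - Ω_φ x` tested on `z`,
    -- up to the symmetry defect of `Ω_φ`.
    have h1 := hb (pair φ (toL2 (Omega φ z)) z)
    rw [symp_apply] at h1
    simp only [qnorm_pair, pair_fst, pair_snd, sub_self, norm_zero, zero_add] at h1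
    have h2 := norm_dot_Omega_sub_le hL u.2 z
    have e : dot (u.1 - toL2 (Omega φ u.2)) (toL2 z) =
        (dot u.1 (toL2 z) - dot (toL2 u.2) (toL2 (Omega φ z))) -
        (dot (toL2 (Omega φ u.2)) (toL2 z) - dot (toL2 u.2) (toL2 (Omega φ z))) := by
      rw [dot_sub_left]; ring
    rw [e]
    refine (norm_sub_le _ _).trans ((add_le_add h1 h2).trans ?_)
    have : 2 * L * (‖toL2 u.2‖ * ‖toL2 z‖) ≤ 2 * L * (P * ‖toL2 z‖) := by gcongr
    linarith
  rw [qnorm]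
  nlinarith

lemma isUniformInducing_preRep (φ : LipZero) : IsUniformInducing (preRep φ) := by
  obtain ⟨K, hK, h⟩ := exists_norm_preRep φ
  have h0 : 𝓝 (0 : PreZ φ) = comap (preRep φ) (𝓝 0) := by
    refine (nhds_zero_basis φ).ext (Metric.nhds_basis_ball.comap (preRep φ)) ?_ ?_
    · intro ε hε
      refine ⟨ε / K, by positivity, fun u hu => ?_⟩
      rw [Set.mem_preimage, mem_ball_zero_iff, lt_div_iff₀ hK] at hu
      exact (h u).2.trans_lt (by rwa [mul_comm])
    · intro ε hε
      refine ⟨ε / K, by positivity, fun u hu => ?_⟩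
      rw [Set.mem_ofPred_eq, lt_div_iff₀ hK] at hu
      rw [Set.mem_preimage, mem_ball_zero_iff]
      exact (h u).1.trans_lt (by rwa [mul_comm])
  constructor
  rw [uniformity_eq_comap_nhds_zero, uniformity_eq_comap_nhds_zero, comap_comap, h0, comap_comap]
  congr 1
  ext u : 1
  simp

/-- A Banach space isomorphic to `Z(φ)`. -/
def Zn (φ : LipZero) : Type := (LinearMap.range (preRep φ)).topologicalClosure

instance (φ : LipZero) : NormedAddCommGroup (Zn φ) :=
  inferInstanceAs (NormedAddCommGroup (LinearMap.range (preRep φ)).topologicalClosure)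

instance (φ : LipZero) : NormedSpace ℂ (Zn φ) :=
  inferInstanceAs (NormedSpace ℂ (LinearMap.range (preRep φ)).topologicalClosure)

instance (φ : LipZero) : CompleteSpace (Zn φ) :=
  (Submodule.isClosed_topologicalClosure (LinearMap.range (preRep φ))).completeSpace_coe

/-- The dense embedding of `ℓ₂ × c₀₀` into the Banach space isomorphic to `Z(φ)`. -/
def preZn (φ : LipZero) : PreZ φ →ₗ[ℂ] Zn φ :=
  (preRep φ).codRestrict (LinearMap.range (preRep φ)).topologicalClosure
    fun u => Submodule.le_topologicalClosure _ ⟨u, rfl⟩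

lemma denseRange_preZn (φ : LipZero) : DenseRange (preZn φ) := by
  rintro ⟨x, hx⟩
  refine (closure_subtype (p := (· ∈ (LinearMap.range (preRep φ)).topologicalClosure))).2 ?_
  refine closure_mono ?_ hx
  rintro _ ⟨u, rfl⟩
  exact ⟨preZn φ u, ⟨u, rfl⟩, rfl⟩

/-- `Zn φ` as a completion of `ℓ₂ × c₀₀`. -/
def completionZn (φ : LipZero) : AbstractCompletion (PreZ φ) where
  space := Zn φ
  coe := preZn φ
  uniformStruct := inferInstance
  complete := inferInstance
  separation := inferInstance
  isUniformInducing := by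
    have h := isUniformInducing_preRep φ
    exact IsUniformInducing.of_comp_iff isUniformEmbedding_subtype_val.isUniformInducing |>.1 h
  dense := denseRange_preZn φ

/-- `Z(φ)` is isomorphic to a Banach space. -/
def toZn (φ : LipZero) : Z φ ≃L[ℂ] Zn φ :=
  let E : Z φ ≃ᵤ Zn φ := UniformSpace.Completion.cPkg.compareEquiv (completionZn φ)
  have hE : ∀ u : PreZ φ, E (u : Z φ) = preZn φ u := fun u =>
    UniformSpace.Completion.cPkg.compare_coe (completionZn φ) u
  { toFun := E
    invFun := E.symm
    left_inv := E.left_inv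
    right_inv := E.right_inv
    map_add' := fun u v => UniformSpace.Completion.induction_on₂ u v
      (isClosed_eq (E.continuous.comp continuous_add)
        ((E.continuous.comp continuous_fst).add (E.continuous.comp continuous_snd)))
      fun u v => by rw [← UniformSpace.Completion.coe_add, hE, hE, hE, map_add]
    map_smul' := fun c u => UniformSpace.Completion.induction_on u
      (isClosed_eq (E.continuous.comp (continuous_const_smul c)) (E.continuous.const_smul c))
      fun u => by rw [← UniformSpace.Completion.coe_smul, hE, hE, map_smul, RingHom.id_apply]
    continuous_toFun := E.continuous
    continuous_invFun := E.symm.continuous }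

lemma toZn_coe (φ : LipZero) (u : PreZ φ) : toZn φ (u : Z φ) = preZn φ u :=
  UniformSpace.Completion.cPkg.compare_coe (completionZn φ) u

lemma exists_norm_toZn (φ : LipZero) : ∃ K : ℝ, 0 < K ∧ ∀ u : PreZ φ,
    ‖toZn φ (u : Z φ)‖ ≤ K * qnorm φ u ∧ qnorm φ u ≤ K * ‖toZn φ (u : Z φ)‖ := by
  obtain ⟨K, hK, h⟩ := exists_norm_preRep φ
  exact ⟨K, hK, fun u => by rw [toZn_coe]; exact h u⟩

lemma isBanachable_Z (φ : LipZero) : IsBanachable (Z φ) :=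
  ⟨Zn φ, inferInstance, inferInstance, inferInstance, ⟨toZn φ⟩⟩

/-! ### Exactness -/

lemma quot_coe (φ : LipZero) (u : PreZ φ) : quot φ (u : Z φ) = toL2 u.2 :=
  AddMonoidHom.extension_coe (preQuot φ).toAddMonoidHom (continuous_preQuot φ) u

lemma incl_apply (φ : LipZero) (y : L2) : incl φ y = ((pair φ y 0 : PreZ φ) : Z φ) := rfl

lemma quot_incl (φ : LipZero) (y : L2) : quot φ (incl φ y) = 0 := by
  rw [incl_apply, quot_coe, pair_snd, map_zero]

/-- The inclusion of `ℓ₂` in the Banach space isomorphic to `Z(φ)`. -/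
def inclZn (φ : LipZero) : L2 →L[ℂ] Zn φ := (toZn φ : Z φ →L[ℂ] Zn φ) ∘L incl φ

/-- The quotient map from the Banach space isomorphic to `Z(φ)`. -/
def quotZn (φ : LipZero) : Zn φ →L[ℂ] L2 := quot φ ∘L ((toZn φ).symm : Zn φ →L[ℂ] Z φ)

lemma quotZn_preZn (φ : LipZero) (u : PreZ φ) : quotZn φ (preZn φ u) = toL2 u.2 := by
  rw [← toZn_coe, quotZn]
  simp [quot_coe]

lemma quotZn_toZn (φ : LipZero) (u : Z φ) : quotZn φ (toZn φ u) = quot φ u := by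
  simp [quotZn]

lemma inclZn_apply (φ : LipZero) (y : L2) : inclZn φ y = preZn φ (pair φ y 0) := toZn_coe φ _

lemma exists_norm_preZn (φ : LipZero) : ∃ K : ℝ, 0 < K ∧ ∀ u : PreZ φ,
    ‖preZn φ u‖ ≤ K * qnorm φ u ∧ qnorm φ u ≤ K * ‖preZn φ u‖ :=
  exists_norm_preRep φ

lemma qnorm_incl (φ : LipZero) (y : L2) : qnorm φ (pair φ y 0) = ‖y‖ := by simp [qnorm_pair]

lemma qnorm_lift (φ : LipZero) (x : ℕ →₀ ℂ) :
    qnorm φ (pair φ (toL2 (Omega φ x)) x) = ‖toL2 x‖ := by simp [qnorm_pair]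

lemma exists_norm_inclZn (φ : LipZero) : ∃ K : ℝ, 0 < K ∧ ∀ y : L2,
    ‖inclZn φ y‖ ≤ K * ‖y‖ ∧ ‖y‖ ≤ K * ‖inclZn φ y‖ := by
  obtain ⟨K, hK, h⟩ := exists_norm_preZn φ
  refine ⟨K, hK, fun y => ?_⟩
  have := h (pair φ y 0)
  rwa [qnorm_incl, ← inclZn_apply] at this

lemma isClosedEmbedding_inclZn (φ : LipZero) : IsClosedEmbedding (inclZn φ) := by
  obtain ⟨K, hK, h⟩ := exists_norm_inclZn φ
  refine AntilipschitzWith.isClosedEmbedding (K := ⟨K, hK.le⟩) ?_ (inclZn φ).uniformContinuous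
  exact AddMonoidHomClass.antilipschitz_of_bound _ fun y => (h y).2

/-- An element of `Z(φ)` is close to an element of `ℓ₂ × c₀₀` with a given second coordinate that
is close to its image under the quotient map. -/
lemma exists_preZn_close (φ : LipZero) : ∃ K : ℝ, 0 < K ∧ ∀ (u : Zn φ) (w : ℕ →₀ ℂ) (δ : ℝ), 0 < δ →
    ‖quotZn φ u - toL2 w‖ ≤ δ → ∃ y : L2, ‖u - preZn φ (pair φ y w)‖ ≤ K * δ := by
  obtain ⟨K, hK, h⟩ := exists_norm_preZn φ
  refine ⟨1 + K * (‖quotZn φ‖ + 1), by positivity, fun u w δ hδ hw => ?_⟩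
  obtain ⟨v, hv⟩ := (denseRange_preZn φ).exists_dist_lt u hδ
  rw [dist_eq_norm] at hv
  have h1 : ‖toL2 (w - v.2)‖ ≤ (‖quotZn φ‖ + 1) * δ := by
    have e : toL2 (w - v.2) = quotZn φ (u - preZn φ v) - (quotZn φ u - toL2 w) := by
      rw [map_sub, map_sub, quotZn_preZn]; abel
    rw [e]
    refine (norm_sub_le _ _).trans ?_
    have := ((quotZn φ).le_opNorm (u - preZn φ v)).trans
      (mul_le_mul_of_nonneg_left hv.le (norm_nonneg _))
    linarith
  -- Adding the lift of `w - v.2` corrects the second coordinate at a cost proportional to `‖w -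
  -- v.2‖`.
  refine ⟨v.1 + toL2 (Omega φ (w - v.2)), ?_⟩
  have e : pair φ (v.1 + toL2 (Omega φ (w - v.2))) w =
      v + pair φ (toL2 (Omega φ (w - v.2))) (w - v.2) := by
    rw [← pair_eta φ v, pair_add]; simp
  rw [e, map_add, ← sub_sub]
  refine (norm_sub_le _ _).trans ?_
  have h2 := (h (pair φ (toL2 (Omega φ (w - v.2))) (w - v.2))).1
  rw [qnorm_lift] at h2
  have h3 := mul_le_mul_of_nonneg_left h1 hK.le
  linarith

lemma ker_quotZn (φ : LipZero) {u : Zn φ} (hu : quotZn φ u = 0) : ∃ y, inclZn φ y = u := by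
  obtain ⟨K, hK, h⟩ := exists_preZn_close φ
  have hc := (isClosedEmbedding_inclZn φ).isClosed_range
  show u ∈ Set.range (inclZn φ)
  rw [← hc.closure_eq, Metric.mem_closure_range_iff]
  intro ε hε
  obtain ⟨y, hy⟩ := h u 0 (ε / (2 * K)) (by positivity) (by simp [hu]; positivity)
  refine ⟨y, ?_⟩
  rw [dist_eq_norm, inclZn_apply]
  refine hy.trans_lt ?_
  have : K * (ε / (2 * K)) = ε / 2 := by field_simp
  linarith

/-- Elements of `c₀₀` lift to `(Ω_φ x, x)` with a norm bound. Completeness extends such controlled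
lifting from a dense subspace to its closure, all of `ℓ₂`. -/
lemma surjective_quotZn (φ : LipZero) : Function.Surjective (quotZn φ) := by
  obtain ⟨K, hK, h⟩ := exists_norm_preZn φ
  let f : NormedAddGroupHom (Zn φ) L2 := (quotZn φ).toLinearMap.toAddMonoidHom.mkNormedAddGroupHom _
    (quotZn φ).le_opNorm
  have := controlled_closure_of_complete (f := f) (K := toL2.range.toAddSubgroup) hK one_pos (by
    rintro _ ⟨x, rfl⟩
    have := (h (pair φ (toL2 (Omega φ x)) x)).1
    rw [qnorm_lift] at this
    exact ⟨_, quotZn_preZn φ _, this⟩)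
  intro x
  obtain ⟨u, hu, -⟩ := this x (denseRange_toL2 x)
  exact ⟨u, hu⟩

lemma isEmbedding_incl (φ : LipZero) : IsEmbedding (incl φ) := by
  have h := (isClosedEmbedding_inclZn φ).isEmbedding
  exact (toZn φ).toHomeomorph.isEmbedding.of_comp_iff.1 h

lemma range_incl (φ : LipZero) : Set.range (incl φ) = {u | quot φ u = 0} := by
  ext u
  constructor
  · rintro ⟨y, rfl⟩
    exact quot_incl φ y
  · intro hu
    obtain ⟨y, hy⟩ := ker_quotZn φ (u := toZn φ u) (by rw [quotZn_toZn]; exact hu)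
    exact ⟨y, (toZn φ).injective hy⟩

lemma isQuotientMap_quot (φ : LipZero) : IsQuotientMap (quot φ) := by
  have h := (quotZn φ).isQuotientMap (surjective_quotZn φ)
  have := h.comp (toZn φ).toHomeomorph.isQuotientMap
  convert this using 1
  ext1 u
  exact (quotZn_toZn φ u).symm

/-! ### The dual space -/

lemma exists_norm_symp_le_preZn (φ : LipZero) : ∃ C : ℝ, 0 ≤ C ∧ ∀ u v : PreZ φ,
    ‖symp φ v u‖ ≤ C * ‖preZn φ v‖ * ‖preZn φ u‖ := by
  obtain ⟨K, hK, h⟩ := exists_norm_preZn φ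
  obtain ⟨C, hC, hC'⟩ := exists_norm_symp_le φ
  refine ⟨C * (K * K), by positivity, fun u v => (hC' u v).trans ?_⟩
  have := mul_le_mul (h u).2 (h v).2 (qnorm_nonneg φ v) (by positivity)
  calc _ ≤ C * (K * ‖preZn φ u‖ * (K * ‖preZn φ v‖)) := by gcongr
    _ = _ := by ring

/-- The functional `⟨·, v⟩` on the Banach space isomorphic to `Z(φ)`. -/
def sympRight (φ : LipZero) (v : PreZ φ) : StrongDual ℂ (Zn φ) := (symp φ v).extendOfNorm (preZn φ)

lemma sympRight_preZn (φ : LipZero) (u v : PreZ φ) : sympRight φ v (preZn φ u) = symp φ v u := by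
  obtain ⟨C, -, hC⟩ := exists_norm_symp_le_preZn φ
  exact LinearMap.extendOfNorm_eq (denseRange_preZn φ) ⟨_, fun u => hC u v⟩ u

/-- The map `v ↦ ⟨·, v⟩` from `ℓ₂ × c₀₀` to the dual. -/
def sympLinear (φ : LipZero) : PreZ φ →ₗ[ℂ] StrongDual ℂ (Zn φ) where
  toFun := sympRight φ
  map_add' v v' := by
    ext u
    refine (denseRange_preZn φ).induction_on u (isClosed_eq (by fun_prop) (by fun_prop)) fun u => ?_
    rw [add_apply]
    simp only [sympRight_preZn, symp_swap φ u]
    rw [map_add]; ring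
  map_smul' c v := by
    ext u
    refine (denseRange_preZn φ).induction_on u (isClosed_eq (by fun_prop) (by fun_prop)) fun u => ?_
    rw [smul_apply]
    simp only [sympRight_preZn, symp_swap φ u]
    rw [map_smul]; simp

/-- The map `v ↦ ⟨·, v⟩` to the dual. -/
def sympZn (φ : LipZero) : Zn φ →L[ℂ] StrongDual ℂ (Zn φ) :=
  (sympLinear φ).extendOfNorm (preZn φ)

lemma sympZn_preZn (φ : LipZero) (v : PreZ φ) : sympZn φ (preZn φ v) = sympRight φ v := by
  obtain ⟨C, hC0, hC⟩ := exists_norm_symp_le_preZn φ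
  refine LinearMap.extendOfNorm_eq (denseRange_preZn φ) ⟨C, fun v => ?_⟩ v
  refine ContinuousLinearMap.opNorm_le_bound _ (by positivity) fun u => ?_
  exact LinearMap.norm_extendOfNorm_apply_le (denseRange_preZn φ) _ (fun u => hC u v) u

lemma continuous_dot_left (x : L2) : Continuous fun y => dot y x := by
  unfold dot
  fun_prop

lemma continuous_dot_right (y : L2) : Continuous fun x => dot y x := by
  unfold dot
  fun_prop

lemma sympZn_inclZn_right (φ : LipZero) (v : Zn φ) (y : L2) :
    sympZn φ v (inclZn φ y) = dot y (quotZn φ v) := by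
  refine (denseRange_preZn φ).induction_on v (isClosed_eq (by fun_prop)
    ((continuous_dot_right y).comp (quotZn φ).continuous)) fun v => ?_
  rw [sympZn_preZn, inclZn_apply, sympRight_preZn, symp_apply, quotZn_preZn]
  simp

lemma sympZn_inclZn_left (φ : LipZero) (u : Zn φ) (y : L2) :
    sympZn φ (inclZn φ y) u = -dot (quotZn φ u) y := by
  refine (denseRange_preZn φ).induction_on u (isClosed_eq (by fun_prop)
    ((continuous_dot_left y).comp (quotZn φ).continuous).neg) fun u => ?_
  rw [inclZn_apply, sympZn_preZn, sympRight_preZn, symp_apply, quotZn_preZn]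
  simp

lemma injective_sympZn (φ : LipZero) : Function.Injective (sympZn φ) := by
  rw [injective_iff_map_eq_zero]
  intro v hv
  have h1 : quotZn φ v = 0 := eq_zero_of_dot_eq_zero fun y => by
    rw [dot_comm, ← sympZn_inclZn_right, hv]; simp
  obtain ⟨y, rfl⟩ := ker_quotZn φ h1
  have h2 : y = 0 := eq_zero_of_dot_eq_zero fun x => by
    obtain ⟨u, rfl⟩ := surjective_quotZn φ x
    rw [dot_comm, ← neg_eq_zero, ← sympZn_inclZn_left, hv]; simp
  rw [h2, map_zero]

/-- The restriction of `F` to `ℓ₂` is represented by some `q v`. Then `F - ⟨·, v⟩` vanishes on the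
kernel of `q`, so it factors through `ℓ₂` and is represented by an element of the copy of `ℓ₂`. -/
lemma surjective_sympZn (φ : LipZero) : Function.Surjective (sympZn φ) := by
  intro F
  obtain ⟨x, hx⟩ := exists_dot_eq (F ∘L inclZn φ)
  obtain ⟨v, rfl⟩ := surjective_quotZn φ x
  set F' := F - sympZn φ v with hF'
  have h0 : ∀ u, quotZn φ u = 0 → F' u = 0 := by
    intro u hu
    obtain ⟨y, rfl⟩ := ker_quotZn φ hu
    rw [hF', sub_apply, sympZn_inclZn_right, dot_comm, ← hx]
    simp
  have hs := surjective_quotZn φ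
  let g : L2 →ₗ[ℂ] ℂ :=
    { toFun := fun x => F' (Function.surjInv hs x)
      map_add' := fun x x' => by
        rw [← sub_eq_zero, ← map_add, ← map_sub]
        refine h0 _ ?_
        simp [Function.surjInv_eq hs]
      map_smul' := fun c x => by
        rw [RingHom.id_apply, ← sub_eq_zero, ← map_smul, ← map_sub]
        refine h0 _ ?_
        simp [Function.surjInv_eq hs] }
  have hg : ∀ u, g (quotZn φ u) = F' u := fun u => by
    show F' (Function.surjInv hs (quotZn φ u)) = F' u
    rw [← sub_eq_zero, ← map_sub]
    refine h0 _ ?_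
    simp [Function.surjInv_eq hs]
  have hgc : Continuous g := by
    rw [((quotZn φ).isQuotientMap hs).continuous_iff]
    convert F'.continuous using 1
    ext1 u
    exact hg u
  obtain ⟨y, hy⟩ := exists_dot_eq ⟨g, hgc⟩
  refine ⟨v - inclZn φ y, ?_⟩
  ext u
  have h1 : F' u = dot y (quotZn φ u) := by rw [← hg, ← hy]; rfl
  rw [map_sub, sub_apply, sympZn_inclZn_left, dot_comm, ← h1, hF']
  simp

lemma isoDual_Z (φ : LipZero) : IsoDual (Z φ) := by
  let S : Zn φ ≃L[ℂ] StrongDual ℂ (Zn φ) := ContinuousLinearEquiv.ofBijective (sympZn φ)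
    (LinearMap.ker_eq_bot.2 (injective_sympZn φ)) (LinearMap.range_eq_top.2 (surjective_sympZn φ))
  exact ⟨((toZn φ).trans S).trans ((toZn φ).symm.arrowCongr (ContinuousLinearEquiv.refl ℂ ℂ))⟩

/-! ### Choices of signs -/

/-- A sequence of signs. -/
def IsSign (ε : ℕ → ℂ) : Prop := ∀ k, ε k = 1 ∨ ε k = -1

lemma IsSign.norm_eq {ε : ℕ → ℂ} (h : IsSign ε) (k : ℕ) : ‖ε k‖ = 1 := by
  rcases h k with h | h <;> simp [h]

/-- By the parallelogram law one of the two signs of each new vector increases the squared norm by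
at least that of the vector. -/
lemma exists_isSign_sum_norm_sq_le {E : Type*} [NormedAddCommGroup E] [InnerProductSpace ℂ E]
    (A : Finset ℕ) (v : ℕ → E) :
    ∃ ε, IsSign ε ∧ ∑ k ∈ A, ‖v k‖ ^ 2 ≤ ‖∑ k ∈ A, ε k • v k‖ ^ 2 := by
  induction A using Finset.induction_on with
  | empty => exact ⟨fun _ => 1, fun _ => Or.inl rfl, by simp⟩
  | insert a A ha ih =>
    obtain ⟨ε, hε, h⟩ := ih
    have hs : ∀ c : ℂ, ∑ k ∈ A, Function.update ε a c k • v k = ∑ k ∈ A, ε k • v k := fun c =>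
      Finset.sum_congr rfl fun k hk => by
        rw [Function.update_of_ne (ne_of_mem_of_not_mem hk ha)]
    have hu : ∀ c : ℂ, (c = 1 ∨ c = -1) → IsSign (Function.update ε a c) := fun c hc k => by
      rcases eq_or_ne k a with rfl | hk
      · rwa [Function.update_self]
      · rw [Function.update_of_ne hk]; exact hε k
    have hp := parallelogram_law_with_norm ℂ (v a) (∑ k ∈ A, ε k • v k)
    rcases le_total (‖v a - ∑ k ∈ A, ε k • v k‖ ^ 2) (‖v a + ∑ k ∈ A, ε k • v k‖ ^ 2) with hle | hle
    · refine ⟨Function.update ε a 1, hu 1 (Or.inl rfl), ?_⟩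
      rw [Finset.sum_insert ha, Finset.sum_insert ha, hs, Function.update_self, one_smul]
      nlinarith
    · refine ⟨Function.update ε a (-1), hu (-1) (Or.inr rfl), ?_⟩
      rw [Finset.sum_insert ha, Finset.sum_insert ha, hs, Function.update_self, neg_one_smul,
        neg_add_eq_sub, norm_sub_rev]
      nlinarith

lemma exists_isSign_sum_abs_le (A : Finset ℕ) (r : ℕ → ℝ) :
    ∃ ε, IsSign ε ∧ ∑ k ∈ A, ((|r k| : ℝ) : ℂ) = ∑ k ∈ A, ε k * (r k : ℂ) := by
  refine ⟨fun k => if 0 ≤ r k then 1 else -1, fun k => by dsimp only; split_ifs <;> simp, ?_⟩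
  refine Finset.sum_congr rfl fun k _ => ?_
  dsimp only
  split_ifs with h
  · rw [abs_of_nonneg h, one_mul]
  · rw [abs_of_neg (not_le.1 h)]; push_cast; ring

lemma sum_norm_le_of_isSign {A : Finset ℕ} {x : ℕ → ℂ} {B : ℝ}
    (h : ∀ ε, IsSign ε → ‖∑ k ∈ A, ε k * x k‖ ≤ B) : ∑ k ∈ A, ‖x k‖ ≤ 2 * B := by
  obtain ⟨ε, hε, e⟩ := exists_isSign_sum_abs_le A fun k => (x k).re
  obtain ⟨ε', hε', e'⟩ := exists_isSign_sum_abs_le A fun k => (x k).im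
  have im0 : ∀ ε, IsSign ε → ∀ k, (ε k).im = 0 := fun ε hε k => by
    rcases hε k with h | h <;> simp [h]
  have h1 : ∑ k ∈ A, |(x k).re| ≤ B := by
    have : ∑ k ∈ A, |(x k).re| = (∑ k ∈ A, ε k * x k).re := by
      have := congrArg Complex.re e
      simp only [Complex.re_sum, Complex.ofReal_re, Complex.mul_re, Complex.ofReal_im, mul_zero,
        sub_zero, im0 ε hε, zero_mul] at this ⊢
      exact this
    rw [this]
    exact (Complex.re_le_norm _).trans (h ε hε)
  have h2 : ∑ k ∈ A, |(x k).im| ≤ B := by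
    have : ∑ k ∈ A, |(x k).im| = (∑ k ∈ A, ε' k * x k).im := by
      have := congrArg Complex.re e'
      simp only [Complex.re_sum, Complex.im_sum, Complex.ofReal_re, Complex.mul_re, Complex.mul_im,
        Complex.ofReal_im, mul_zero, sub_zero, add_zero, im0 ε' hε', zero_mul] at this ⊢
      exact this
    rw [this]
    exact (Complex.im_le_norm _).trans (h ε' hε')
  calc ∑ k ∈ A, ‖x k‖ ≤ ∑ k ∈ A, (|(x k).re| + |(x k).im|) :=
        Finset.sum_le_sum fun k _ => Complex.norm_le_abs_re_add_abs_im _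
    _ ≤ 2 * B := by rw [Finset.sum_add_distrib]; linarith

/-- Signed sums of order `N^(3/4)` cannot come from `N` coordinates that are all at least `δ` in
modulus. -/
lemma tendsto_zero_of_sum_isSign {x : ℕ → ℂ} {C : ℝ}
    (h : ∀ (A : Finset ℕ) ε, IsSign ε → ‖∑ k ∈ A, ε k * x k‖ ≤ C * √√A.card * √A.card) :
    Tendsto x atTop (𝓝 0) := by
  rw [Metric.tendsto_atTop']
  by_contra! hc
  obtain ⟨δ, hδ, hc⟩ := hc
  have hinf : {k | δ ≤ ‖x k‖}.Infinite := by
    rw [Set.infinite_iff_exists_gt]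
    intro n
    obtain ⟨k, hk, hk'⟩ := hc n
    exact ⟨k, by simpa using hk', hk⟩
  obtain ⟨n, hn⟩ := exists_nat_gt (2 * C / δ)
  have hn0 : 0 < n + 1 := Nat.succ_pos n
  -- A fourth power makes `√√A.card` an integer. The two bounds then read `(n + 1)⁴ δ ≤ 2 C (n +
  -- 1)³`.
  obtain ⟨A, hA, hAc⟩ := hinf.exists_subset_card_eq ((n + 1) ^ 4)
  have h1 := sum_norm_le_of_isSign fun ε hε => h A ε hε
  have h2 : (A.card : ℝ) * δ ≤ ∑ k ∈ A, ‖x k‖ := by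
    rw [← nsmul_eq_mul]
    exact Finset.card_nsmul_le_sum _ _ _ fun k hk => hA hk
  have e1 : √(A.card : ℝ) = ((n : ℝ) + 1) ^ 2 := by
    rw [hAc, Real.sqrt_eq_iff_mul_self_eq (by positivity) (by positivity)]
    push_cast; ring
  have e2 : √√(A.card : ℝ) = (n : ℝ) + 1 := by
    rw [e1, Real.sqrt_sq (by positivity)]
  have e3 : (A.card : ℝ) = ((n : ℝ) + 1) ^ 4 := by rw [hAc]; push_cast; ring
  rw [e1] at h1
  rw [show √(((n : ℝ) + 1) ^ 2) = (n : ℝ) + 1 from Real.sqrt_sq (by positivity)] at h1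
  rw [e3] at h2
  have h3 : ((n : ℝ) + 1) ^ 3 * (((n : ℝ) + 1) * δ) ≤ ((n : ℝ) + 1) ^ 3 * (2 * C) := by nlinarith
  have h4 := le_of_mul_le_mul_left h3 (by positivity)
  rw [div_lt_iff₀ hδ] at hn
  nlinarith

/-! ### Disjoint blocks -/

/-- The supports of the sequences are pairwise disjoint. -/
def DisjointSupports (w : ℕ → ℕ →₀ ℂ) : Prop :=
  Pairwise fun i j => ∀ n, w i n = 0 ∨ w j n = 0

lemma inner_toL2_eq_zero {x y : ℕ →₀ ℂ} (h : ∀ n, x n = 0 ∨ y n = 0) :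
    inner ℂ (toL2 x) (toL2 y) = 0 := by
  rw [lp.inner_eq_tsum]
  refine (tsum_congr fun n => ?_).trans tsum_zero
  rcases h n with h | h <;> simp [h]

lemma norm_sq_sum_blocks {w : ℕ → ℕ →₀ ℂ} (hd : DisjointSupports w) {ε : ℕ → ℂ} (hε : IsSign ε)
    (A : Finset ℕ) : ‖toL2 (∑ k ∈ A, ε k • w k)‖ ^ 2 = ∑ k ∈ A, ‖toL2 (w k)‖ ^ 2 := by
  induction A using Finset.induction_on with
  | empty => simp
  | insert a A ha ih =>
    rw [Finset.sum_insert ha, Finset.sum_insert ha, map_add, ← ih, pow_two, pow_two, pow_two,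
      norm_add_sq_eq_norm_sq_add_norm_sq_of_inner_eq_zero (𝕜 := ℂ), map_smul, norm_smul,
      hε.norm_eq, one_mul]
    rw [map_sum, inner_sum]
    refine Finset.sum_eq_zero fun k hk => inner_toL2_eq_zero fun n => ?_
    rcases hd (ne_of_mem_of_not_mem hk ha).symm n with h | h <;> simp [h]

lemma norm_sum_blocks_le {w : ℕ → ℕ →₀ ℂ} (hd : DisjointSupports w) {ε : ℕ → ℂ} (hε : IsSign ε)
    {M : ℝ} (hM : 0 ≤ M) (hw : ∀ k, ‖toL2 (w k)‖ ≤ M) (A : Finset ℕ) :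
    ‖toL2 (∑ k ∈ A, ε k • w k)‖ ≤ M * √A.card := by
  refine le_of_sq_le_sq ?_ (by positivity)
  rw [norm_sq_sum_blocks hd hε, mul_pow, Real.sq_sqrt (by positivity), mul_comm, ← nsmul_eq_mul]
  exact Finset.sum_le_card_nsmul _ _ _ fun k _ => by gcongr; exact hw k

lemma OmegaAt_apply (φ : ℝ≥0 → ℂ) (t : ℝ) (x : ℕ →₀ ℂ) (n : ℕ) :
    OmegaAt φ t x n = scaled φ t (x n) := rfl

lemma scaled_zero (φ : ℝ≥0 → ℂ) (t : ℝ) : scaled φ t 0 = 0 := by simp [scaled]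

/-- At a fixed scale the map acts coordinatewise and depends on moduli only. This is why `Omega` is
replaced by `OmegaAt`: the former involves the norm of the whole sum. -/
lemma OmegaAt_sum_blocks (φ : ℝ≥0 → ℂ) (t : ℝ) {w : ℕ → ℕ →₀ ℂ} (hd : DisjointSupports w)
    {ε : ℕ → ℂ} (hε : IsSign ε) (A : Finset ℕ) :
    OmegaAt φ t (∑ k ∈ A, ε k • w k) = ∑ k ∈ A, ε k • OmegaAt φ t (w k) := by
  ext n
  simp only [OmegaAt_apply, Finsupp.finsetSum_apply, Finsupp.smul_apply, smul_eq_mul]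
  by_cases h : ∃ k ∈ A, w k n ≠ 0
  · obtain ⟨k, hk, hkn⟩ := h
    have h0 : ∀ l ∈ A, l ≠ k → w l n = 0 := fun l _ hl => (hd hl n).resolve_right hkn
    rw [Finset.sum_eq_single_of_mem k hk fun l hl hlk => by rw [h0 l hl hlk, mul_zero],
      Finset.sum_eq_single_of_mem k hk fun l hl hlk => by rw [h0 l hl hlk, scaled_zero, mul_zero]]
    rw [scaled, scaled, norm_mul, hε.norm_eq, one_mul, mul_assoc]
  · push Not at h
    rw [Finset.sum_eq_zero fun k hk => by rw [h k hk, mul_zero],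
      Finset.sum_eq_zero fun k hk => by rw [h k hk, scaled_zero, mul_zero], scaled_zero]

/-- A block estimate: if all the signed sums of the vectors `(yₖ, wₖ)` are small, then `yₖ` is
close to the image of `wₖ` under the version of `Ω_ψ` at the scale of those sums. -/
lemma sum_norm_sub_OmegaAt_sq_le (ψ : LipZero) {K : ℝ≥0} (hK : LipschitzWith K (ψ : ℝ≥0 → ℂ))
    {M C : ℝ} (hM : 0 ≤ M) {w : ℕ → ℕ →₀ ℂ} (hd : DisjointSupports w)
    (hw : ∀ k, ‖toL2 (w k)‖ ≤ M) (y : ℕ → L2) (A : Finset ℕ)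
    (h : ∀ ε, IsSign ε → qnorm ψ (∑ k ∈ A, ε k • pair ψ (y k) (w k)) ≤ C * √A.card) :
    ∑ k ∈ A, ‖y k - toL2 (OmegaAt ψ (M * √A.card) (w k))‖ ^ 2 ≤ (C + K * M) ^ 2 * A.card := by
  -- One choice of signs bounds the whole sum of squares by a single signed sum, and there `Ω_ψ` may
  -- be moved to the common scale `M √N`.
  obtain ⟨ε, hε, hs⟩ := exists_isSign_sum_norm_sq_le A
    fun k => y k - toL2 (OmegaAt ψ (M * √A.card) (w k))
  refine hs.trans ?_
  set x := ∑ k ∈ A, ε k • w k with hx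
  have hpair : ∑ k ∈ A, ε k • pair ψ (y k) (w k) = pair ψ (∑ k ∈ A, ε k • y k) x := by
    rw [hx]
    clear hs hx x h
    induction A using Finset.induction_on with
    | empty => rfl
    | insert a A ha ih =>
      simp only [Finset.sum_insert ha]
      rw [ih, pair_smul, pair_add]
  have h1 := h ε hε
  rw [hpair, qnorm_pair] at h1
  have h2 := Omega_sub_OmegaAt hK x (norm_sum_blocks_le hd hε hM hw A)
  have e : ∑ k ∈ A, ε k • (y k - toL2 (OmegaAt ψ (M * √A.card) (w k))) =
      (∑ k ∈ A, ε k • y k - toL2 (Omega ψ x)) +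
      toL2 (Omega ψ x - OmegaAt ψ (M * √A.card) x) := by
    rw [hx, OmegaAt_sum_blocks _ _ hd hε, map_sub, map_sum]
    simp only [smul_sub, Finset.sum_sub_distrib, map_smul]
    abel
  have h3 : ‖∑ k ∈ A, ε k • (y k - toL2 (OmegaAt ψ (M * √A.card) (w k)))‖ ≤
      (C + K * M) * √A.card := by
    rw [e]
    refine (norm_add_le _ _).trans ?_
    have := norm_nonneg (toL2 x)
    linarith
  calc _ ≤ ((C + K * M) * √A.card) ^ 2 := by gcongr
    _ = _ := by rw [mul_pow, Real.sq_sqrt (by positivity)]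

lemma norm_toL2_sum_single_le {x : L2} (m : ℕ) :
    ‖toL2 (∑ i ∈ Finset.range m, Finsupp.single i (x i))‖ ≤ ∑ i ∈ Finset.range m, ‖x i‖ := by
  rw [map_sum]
  refine (norm_sum_le _ _).trans (Finset.sum_le_sum fun i _ => ?_)
  rw [toL2_single, lp.norm_single (by simp)]

lemma exists_norm_sub_truncate_le (x : L2) {δ : ℝ} (hδ : 0 < δ) : ∀ᶠ m in atTop,
    ‖x - toL2 (∑ i ∈ Finset.range m, Finsupp.single i (x i))‖ ≤ δ := by
  have h := (lp.hasSum_single (p := 2) (by simp) x).tendsto_sum_nat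
  have h' := (tendsto_const_nhds (x := x)).sub h
  rw [sub_self] at h'
  filter_upwards [h'.norm.eventually_le_const (u := δ) (by simpa using hδ)] with m hm
  rw [map_sum]
  simpa only [toL2_single] using hm

/-- The gliding hump. -/
lemma exists_block_subsequence (x : ℕ → L2) (hx : ∀ n, Tendsto (fun k => x k n) atTop (𝓝 0))
    (P : ℕ → ℕ → Prop) (hP : ∀ j, ∃ᶠ k in atTop, P j k) (η : ℕ → ℝ) (hη : ∀ j, 0 < η j) :
    ∃ (k : ℕ → ℕ) (w : ℕ → ℕ →₀ ℂ), Function.Injective k ∧ DisjointSupports w ∧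
      ∀ j, P j (k j) ∧ ‖x (k j) - toL2 (w j)‖ ≤ η j := by
  have step : ∀ j m, ∃ m' k, ∃ w : ℕ →₀ ℂ, (m ≤ k ∧ k < m') ∧ (∀ n, w n ≠ 0 → m ≤ n ∧ n < m') ∧
      P j k ∧ ‖x k - toL2 w‖ ≤ η j := by
    intro j m
    have h0 : Tendsto (fun k => ∑ i ∈ Finset.range m, ‖x k i‖) atTop (𝓝 0) := by
      have := tendsto_finsetSum (Finset.range m) fun i _ => (hx i).norm
      simpa using this
    obtain ⟨k, hk, hk1, hk2⟩ := ((hP j).and_eventually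
      ((h0.eventually_le_const (half_pos (hη j))).and (eventually_ge_atTop m))).exists
    obtain ⟨m', hm', hm1⟩ := ((exists_norm_sub_truncate_le (x k) (half_pos (hη j))).and
      (eventually_gt_atTop k)).exists
    refine ⟨m', k, (∑ i ∈ Finset.range m', Finsupp.single i (x k i)) -
      ∑ i ∈ Finset.range m, Finsupp.single i (x k i), ⟨hk2, hm1⟩, ?_, hk, ?_⟩
    · intro n hn
      simp only [Finsupp.sub_apply, Finsupp.finsetSum_apply, Finsupp.single_apply,
        Finset.sum_ite_eq', Finset.mem_range] at hn
      by_cases a : n < m <;> by_cases b : n < m' <;> simp [a, b] at hn <;> omega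
    · rw [map_sub, ← sub_add]
      refine (norm_add_le _ _).trans ?_
      have := norm_toL2_sum_single_le (x := x k) m
      linarith
  choose M κ W h1 h2 h3 h4 using step
  -- The window `[a j, a (j + 1))` contains the index `k j` and the support of `w j`, which gives
  -- both injectivity and disjointness.
  let a : ℕ → ℕ := fun j => Nat.rec 0 (fun j m => M j m) j
  have ha : ∀ j, a (j + 1) = M j (a j) := fun j => rfl
  have hmono : StrictMono a := strictMono_nat_of_lt_succ fun j => by
    rw [ha]; exact (h1 j (a j)).1.trans_lt (h1 j (a j)).2
  have huniq : ∀ i j n, a i ≤ n → n < a (i + 1) → a j ≤ n → n < a (j + 1) → i = j := by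
    intro i j n b1 b2 b3 b4
    have c1 := (hmono.lt_iff_lt (a := i) (b := j + 1)).1 (b1.trans_lt b4)
    have c2 := (hmono.lt_iff_lt (a := j) (b := i + 1)).1 (b3.trans_lt b2)
    omega
  refine ⟨fun j => κ j (a j), fun j => W j (a j), fun i j hij => ?_, fun i j hij n => ?_,
    fun j => ⟨h3 _ _, h4 _ _⟩⟩
  · have hi := h1 i (a i)
    have hj := h1 j (a j)
    rw [← ha] at hi hj
    dsimp only at hij
    rw [hij] at hi
    exact huniq i j _ hi.1 hi.2 hj.1 hj.2
  · by_contra! hc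
    have hi := h2 i (a i) n hc.1
    have hj := h2 j (a j) n hc.2
    rw [← ha] at hi hj
    exact hij (huniq i j n hi.1 hi.2 hj.1 hj.2)

lemma sum_pow_half_le (A : Finset ℕ) : ∑ k ∈ A, (1 / 2 : ℝ) ^ k ≤ 2 :=
  (summable_geometric_two.sum_le_tsum A fun k _ => by positivity).trans_eq tsum_geometric_two

lemma one_le_sqrt_card {A : Finset ℕ} (hA : A.Nonempty) : 1 ≤ √(A.card : ℝ) := by
  rw [Real.one_le_sqrt]
  exact_mod_cast hA.card_pos

lemma norm_sum_isSign_le {E : Type*} [NormedAddCommGroup E] [NormedSpace ℂ E] {ε : ℕ → ℂ}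
    (hε : IsSign ε) {r : ℕ → E} {κ : ℝ} (hr : ∀ k, ‖r k‖ ≤ κ * (1 / 2) ^ k) (hκ : 0 ≤ κ)
    (A : Finset ℕ) : ‖∑ k ∈ A, ε k • r k‖ ≤ κ * 2 := by
  refine (norm_sum_le _ _).trans ?_
  calc ∑ k ∈ A, ‖ε k • r k‖ ≤ ∑ k ∈ A, κ * (1 / 2) ^ k :=
        Finset.sum_le_sum fun k _ => by rw [norm_smul, hε.norm_eq, one_mul]; exact hr k
    _ ≤ κ * 2 := by
        rw [← Finset.mul_sum]
        exact mul_le_mul_of_nonneg_left (sum_pow_half_le A) hκ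

lemma norm_sum_isSign_le_of_close {E : Type*} [NormedAddCommGroup E] [NormedSpace ℂ E] {ε : ℕ → ℂ}
    (hε : IsSign ε) {u v : ℕ → E} {κ C : ℝ} (hκ : 0 ≤ κ)
    (huv : ∀ k, ‖u k - v k‖ ≤ κ * (1 / 2) ^ k) {A : Finset ℕ} (hA : A.Nonempty)
    (h : ‖∑ k ∈ A, ε k • u k‖ ≤ C * √A.card) :
    ‖∑ k ∈ A, ε k • v k‖ ≤ (C + κ * 2) * √A.card := by
  have e : ∑ k ∈ A, ε k • v k = ∑ k ∈ A, ε k • u k - ∑ k ∈ A, ε k • (u k - v k) := by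
    simp only [smul_sub, Finset.sum_sub_distrib]; abel
  rw [e]
  refine (norm_sub_le _ _).trans ?_
  have h1 := norm_sum_isSign_le hε huv hκ A
  have h2 := one_le_sqrt_card hA
  nlinarith

/-! ### Changing the scale of `Ω_ψ` on blocks -/

lemma scaled_mul_sub_scaled (ψ : ℝ≥0 → ℂ) {M r : ℝ} (hM : 0 < M) (hr : 0 < r) (a : ℂ) :
    scaled ψ (M * r) a - scaled ψ M a =
      a * (ψ (Real.toNNReal (-Real.log (‖a‖ / M) + Real.log r)) -
        ψ (Real.toNNReal (-Real.log (‖a‖ / M)))) := by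
  rcases eq_or_ne a 0 with rfl | ha
  · simp [scaled]
  have ha' : 0 < ‖a‖ := norm_pos_iff.2 ha
  have e : -Real.log (‖a‖ / (M * r)) = -Real.log (‖a‖ / M) + Real.log r := by
    rw [← div_div, Real.log_div (by positivity) hr.ne']; ring
  rw [scaled, scaled, e]; ring

lemma neg_log_div_nonneg {a : ℂ} {M : ℝ} (h : ‖a‖ ≤ M) : 0 ≤ -Real.log (‖a‖ / M) := by
  rw [neg_nonneg]
  exact Real.log_nonpos (div_nonneg (norm_nonneg _) ((norm_nonneg _).trans h))
    (div_le_one_of_le₀ h ((norm_nonneg _).trans h))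

lemma mul_le_norm_sub_of_expanding {ψ : ℝ≥0 → ℂ} {b : ℝ}
    (hb : ∀ x y, b * dist x y ≤ dist (ψ x) (ψ y)) {τ s : ℝ} (hτ : 0 ≤ τ) (hs : 0 ≤ s) :
    b * s ≤ ‖ψ (Real.toNNReal (τ + s)) - ψ (Real.toNNReal τ)‖ := by
  have := hb (Real.toNNReal (τ + s)) (Real.toNNReal τ)
  rw [NNReal.dist_eq, Real.coe_toNNReal _ (add_nonneg hτ hs), Real.coe_toNNReal _ hτ,
    add_sub_cancel_left, abs_of_nonneg hs, dist_eq_norm] at this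
  exact this

/-- Multiplying the scale by `r` shifts every argument of `ψ` by `log r`. An expanding `ψ` therefore
moves each coordinate by at least `b log r` times its modulus. -/
lemma mul_norm_le_norm_OmegaAt_sub {ψ : ℝ≥0 → ℂ} {b : ℝ} (hb0 : 0 ≤ b)
    (hb : ∀ x y, b * dist x y ≤ dist (ψ x) (ψ y)) {M r : ℝ} (hM : 0 < M) (hr : 1 ≤ r)
    {x : ℕ →₀ ℂ} (hx : ‖toL2 x‖ ≤ M) :
    b * Real.log r * ‖toL2 x‖ ≤ ‖toL2 (OmegaAt ψ (M * r) x - OmegaAt ψ M x)‖ := by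
  have hl := Real.log_nonneg hr
  have : ‖toL2 (((b * Real.log r : ℝ) : ℂ) • x)‖ ≤
      ‖toL2 (OmegaAt ψ (M * r) x - OmegaAt ψ M x)‖ := by
    refine norm_toL2_le fun n => ?_
    rw [Finsupp.smul_apply, smul_eq_mul, Finsupp.sub_apply, OmegaAt_apply, OmegaAt_apply,
      scaled_mul_sub_scaled ψ hM (by linarith), norm_mul, norm_mul, mul_comm ‖x n‖, Complex.norm_real,
      Real.norm_of_nonneg (by positivity)]
    gcongr
    exact mul_le_norm_sub_of_expanding hb
      (neg_log_div_nonneg ((norm_apply_le_norm_toL2 x n).trans hx)) hl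
  rwa [map_smul, norm_smul, Complex.norm_real, Real.norm_of_nonneg (by positivity)] at this

/-- If all the signed sums of the vectors `(yₖ + G(N) vₖ, wₖ)` over `N` indices are `O(√N)`, then
`G(N) vₖ` is, on average, close to the increment of `Ω_ψ` at `wₖ` from the scale `1` to `√N`. -/
lemma exists_sum_norm_sq_le (ψ : LipZero) {M C : ℝ} (hM : 0 ≤ M) {w : ℕ → ℕ →₀ ℂ}
    (hd : DisjointSupports w) (hw : ∀ k, ‖toL2 (w k)‖ ≤ M) (y v : ℕ → L2) (G : ℕ → ℂ)
    (hG : G 1 = 0)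
    (h : ∀ A : Finset ℕ, A.Nonempty → ∀ ε, IsSign ε →
      ‖∑ k ∈ A, ε k • preZn ψ (pair ψ (y k + G A.card • v k) (w k))‖ ≤ C * √A.card) :
    ∃ C' : ℝ, 0 ≤ C' ∧ ∀ A : Finset ℕ, A.Nonempty →
      ∑ k ∈ A, ‖G A.card • v k - toL2 (OmegaAt ψ (M * √A.card) (w k) - OmegaAt ψ M (w k))‖ ^ 2 ≤
        C' * A.card := by
  obtain ⟨K, hK⟩ := ψ.2.2
  obtain ⟨K₂, hK₂, hq⟩ := exists_norm_preZn ψ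
  have key : ∀ A : Finset ℕ, A.Nonempty →
      ∑ k ∈ A, ‖(y k + G A.card • v k) - toL2 (OmegaAt ψ (M * √A.card) (w k))‖ ^ 2 ≤
        (K₂ * C + K * M) ^ 2 * A.card := by
    intro A hA
    refine sum_norm_sub_OmegaAt_sq_le ψ hK hM hd hw (fun k => y k + G A.card • v k) A fun ε hε => ?_
    refine (hq _).2.trans ?_
    rw [map_sum, mul_assoc]
    simp only [map_smul]
    exact mul_le_mul_of_nonneg_left (h A hA ε hε) hK₂.le
  refine ⟨4 * (K₂ * C + K * M) ^ 2, by positivity, fun A hA => ?_⟩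
  -- Singletons give the base scale: `G 1 = 0`, so each `y k` is close to `OmegaAt` at scale `M`.
  -- Subtracting this eliminates `y k`.
  have h1 : ∀ k, ‖y k - toL2 (OmegaAt ψ M (w k))‖ ^ 2 ≤ (K₂ * C + K * M) ^ 2 := fun k => by
    simpa [hG] using key {k} (Finset.singleton_nonempty k)
  have h2 : ∀ k ∈ A, ‖G A.card • v k - toL2 (OmegaAt ψ (M * √A.card) (w k) - OmegaAt ψ M (w k))‖ ^ 2
      ≤ 2 * ‖(y k + G A.card • v k) - toL2 (OmegaAt ψ (M * √A.card) (w k))‖ ^ 2 +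
        2 * (K₂ * C + K * M) ^ 2 := by
    intro k _
    have e : G A.card • v k - toL2 (OmegaAt ψ (M * √A.card) (w k) - OmegaAt ψ M (w k)) =
        ((y k + G A.card • v k) - toL2 (OmegaAt ψ (M * √A.card) (w k))) -
        (y k - toL2 (OmegaAt ψ M (w k))) := by
      rw [map_sub]; abel
    rw [e]
    have h3 := norm_sub_le ((y k + G A.card • v k) - toL2 (OmegaAt ψ (M * √A.card) (w k)))
      (y k - toL2 (OmegaAt ψ M (w k)))
    have h4 := pow_le_pow_left₀ (norm_nonneg _) h3 2
    nlinarith [h1 k, sq_nonneg (‖(y k + G A.card • v k) - toL2 (OmegaAt ψ (M * √A.card) (w k))‖ -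
      ‖y k - toL2 (OmegaAt ψ M (w k))‖)]
  refine (Finset.sum_le_sum h2).trans ?_
  rw [Finset.sum_add_distrib, ← Finset.mul_sum, Finset.sum_const, nsmul_eq_mul]
  linarith [key A hA]

/-- The quotient map is not bounded below on a sequence in `Z(ψ)` whose images are close to disjoint
blocks and whose signed sums have an upper `2`-estimate. -/
lemma not_bounded_below_of_blocks (ψ : LipZero) {b : ℝ} (hb0 : 0 < b)
    (hb : ∀ x y, b * dist x y ≤ dist ((ψ : ℝ≥0 → ℂ) x) ((ψ : ℝ≥0 → ℂ) y)) {α : ℕ → Zn ψ} {C : ℝ}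
    (hα : ∀ (A : Finset ℕ) ε, IsSign ε → ‖∑ k ∈ A, ε k • α k‖ ≤ C * √A.card)
    {w : ℕ → ℕ →₀ ℂ} (hd : DisjointSupports w)
    (hw : ∀ k, ‖quotZn ψ (α k) - toL2 (w k)‖ ≤ (1 / 2) ^ k) {δ : ℝ} (hδ : 0 < δ)
    (hwδ : ∀ k, δ ≤ ‖toL2 (w k)‖) : False := by
  obtain ⟨κ, hκ, hclose⟩ := exists_preZn_close ψ
  choose y hy using fun k => hclose (α k) (w k) ((1 / 2) ^ k) (by positivity) (hw k)
  have hα1 : ∀ k, ‖α k‖ ≤ C := fun k => by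
    simpa using hα {k} (fun _ => 1) fun _ => Or.inl rfl
  have hC : 0 ≤ C := (norm_nonneg _).trans (hα1 0)
  set M := ‖quotZn ψ‖ * C + 1 with hM
  have hM0 : 0 < M := by positivity
  have hwM : ∀ k, ‖toL2 (w k)‖ ≤ M := fun k => by
    have h1 := (quotZn ψ).le_opNorm_of_le (hα1 k)
    have h2 : ((1 / 2 : ℝ)) ^ k ≤ 1 := pow_le_one₀ (by norm_num) (by norm_num)
    have h3 := norm_sub_norm_le (toL2 (w k)) (quotZn ψ (α k))
    rw [norm_sub_rev] at h3
    linarith [hw k]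
  -- With `G = 0` the conclusion bounds the increments of `Ω_ψ` themselves in mean square,
  -- independently of the scale.
  obtain ⟨C', hC', h⟩ := exists_sum_norm_sq_le ψ hM0.le hd hwM y (fun _ => 0) (fun _ => 0) rfl
    (C := C + κ * 2) fun A hA ε hε => by
      simp only [smul_zero, add_zero]
      exact norm_sum_isSign_le_of_close hε hκ.le hy hA (hα A ε hε)
  -- Chosen so that `b δ log √n > C' + 1`: each increment then has norm at least `C' + 1`, against a
  -- mean square of at most `C'`.
  obtain ⟨n, hn⟩ := exists_nat_gt (Real.exp (2 * ((C' + 1) / (b * δ))))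
  have hn1 : (1 : ℝ) ≤ n := (Real.one_le_exp (by positivity)).trans hn.le
  have hlog : (C' + 1) / (b * δ) < Real.log √n := by
    rw [Real.log_sqrt (by positivity), lt_div_iff₀ two_pos, mul_comm,
      Real.lt_log_iff_exp_lt (by linarith)]
    exact hn
  rw [div_lt_iff₀ (by positivity)] at hlog
  have hA : (Finset.range n).Nonempty := by
    rw [Finset.nonempty_range_iff]
    rintro rfl
    norm_num at hn1
  have h1 := h _ hA
  rw [Finset.card_range] at h1
  simp only [smul_zero, zero_sub, norm_neg] at h1
  have h2 : ∀ k ∈ Finset.range n, (C' + 1) ^ 2 ≤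
      ‖toL2 (OmegaAt ψ (M * √n) (w k) - OmegaAt ψ M (w k))‖ ^ 2 := by
    intro k _
    have h3 := mul_norm_le_norm_OmegaAt_sub hb0.le hb hM0 (Real.one_le_sqrt.2 hn1) (hwM k)
    have h4 : b * Real.log √n * δ ≤ b * Real.log √n * ‖toL2 (w k)‖ := by
      have : 0 ≤ Real.log √n := Real.log_nonneg (Real.one_le_sqrt.2 hn1)
      have := hwδ k
      gcongr
    gcongr
    nlinarith
  have h5 := Finset.card_nsmul_le_sum _ _ _ h2
  rw [Finset.card_range, nsmul_eq_mul] at h5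
  have h6 := le_of_mul_le_mul_left ((h5.trans h1).trans_eq (mul_comm _ _)) (by linarith)
  nlinarith

/-! ### Strict singularity -/

/-- Turns continuity at `0` into a norm bound by rescaling. Since `q u` may vanish, the rescaling
uses `r > q u` and then lets `r` decrease to `q u`. -/
lemma le_div_of_homogeneous {V : Type*} [AddCommGroup V] [Module ℂ V] {p q : V → ℝ}
    (hp : ∀ (t : ℝ) u, 0 ≤ t → p ((t : ℂ) • u) = t * p u)
    (hq : ∀ (t : ℝ) u, 0 ≤ t → q ((t : ℂ) • u) = t * q u) (hq0 : ∀ u, 0 ≤ q u) {δ : ℝ} (hδ : 0 < δ)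
    (h : ∀ u, q u < δ → p u < 1) (u : V) : p u ≤ δ⁻¹ * q u := by
  have key : ∀ r, q u < r → p u ≤ δ⁻¹ * r := by
    intro r hr
    have hr0 : 0 < r := (hq0 u).trans_lt hr
    have h1 := h (((δ / r : ℝ) : ℂ) • u) (by
      rw [hq _ _ (by positivity)]
      calc δ / r * q u < δ / r * r := by gcongr
        _ = δ := by field_simp)
    rw [hp _ _ (by positivity)] at h1
    have : p u = r / δ * (δ / r * p u) := by field_simp
    rw [this]
    calc _ ≤ r / δ * 1 := by gcongr
      _ = _ := by ring
  have h2 : Tendsto (fun r => δ⁻¹ * r) (𝓝[>] (q u)) (𝓝 (δ⁻¹ * q u)) :=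
    ((continuous_const.mul continuous_id).tendsto _).mono_left nhdsWithin_le_nhds
  exact ge_of_tendsto h2 (eventually_mem_nhdsWithin.mono fun r hr => key r hr)

lemma exists_norm_one_of_infinite_dimensional {V : Type*} [AddCommGroup V] [Module ℂ V]
    (hV : ¬ FiniteDimensional ℂ V) (f : V →ₗ[ℂ] L2) (hf : Function.Injective f) (m : ℕ) :
    ∃ u, ‖f u‖ = 1 ∧ ∀ n < m, f u n = 0 := by
  let g : V →ₗ[ℂ] (Fin m → ℂ) :=
    { toFun := fun u n => f u n
      map_add' := fun u u' => by ext n; simp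
      map_smul' := fun c u => by ext n; simp }
  have hg : ¬ Function.Injective g := fun h => hV (Module.Finite.of_injective g h)
  rw [injective_iff_map_eq_zero] at hg
  push Not at hg
  obtain ⟨u, hu, hu0⟩ := hg
  have hfu : f u ≠ 0 := fun h => hu0 (hf (by rw [h, map_zero]))
  have hpos : 0 < ‖f u‖ := norm_pos_iff.2 hfu
  refine ⟨((‖f u‖⁻¹ : ℝ) : ℂ) • u, ?_, fun n hn => ?_⟩
  · rw [map_smul, norm_smul, Complex.norm_real, Real.norm_of_nonneg (by positivity),
      inv_mul_cancel₀ hpos.ne']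
  · have : f u n = 0 := congrFun hu ⟨n, hn⟩
    rw [map_smul, lp.coeFn_smul, Pi.smul_apply, this, smul_zero]

/-- If `q` were an isomorphism on an infinite-dimensional `W`, then `W` would contain vectors whose
images are unit vectors vanishing on longer and longer initial segments, hence nearly disjoint
blocks. Blocks in `ℓ₂` have an upper `2`-estimate, which would pull back to `W` and contradict
`not_bounded_below_of_blocks`. -/
lemma isStrictlySingular_quot (ψ : LipZero) (hψ : IsBiLipschitz (ψ : ℝ≥0 → ℂ)) :
    IsStrictlySingular (quot ψ) := by
  obtain ⟨a, b, _, hb0, hb⟩ := hψ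
  intro W hW hemb
  have hc : ∃ c : ℝ, 0 < c ∧ ∀ u : W, ‖toZn ψ u‖ ≤ c * ‖quot ψ u‖ := by
    have hcont : Continuous fun u : W => ‖toZn ψ u‖ := by fun_prop
    have h1 : {u : W | ‖toZn ψ u‖ < 1} ∈ 𝓝 (0 : W) :=
      (isOpen_lt hcont continuous_const).mem_nhds (by simp)
    rw [hemb.nhds_eq_comap] at h1
    have h2 := (Metric.nhds_basis_ball.comap (fun w : W => quot ψ w)).mem_iff.1 h1
    obtain ⟨δ, hδ, h3⟩ := h2
    refine ⟨δ⁻¹, by positivity, fun u => le_div_of_homogeneous (p := fun u : W => ‖toZn ψ u‖)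
      (q := fun u : W => ‖quot ψ u‖) ?_ ?_ (fun _ => norm_nonneg _) hδ (fun u hu => h3 ?_) u⟩
    · intro t u ht
      rw [Submodule.coe_smul, map_smul, norm_smul, Complex.norm_real, Real.norm_of_nonneg ht]
    · intro t u ht
      rw [Submodule.coe_smul, map_smul, norm_smul, Complex.norm_real, Real.norm_of_nonneg ht]
    · simpa using hu
  obtain ⟨c, hc0, hc⟩ := hc
  choose u hu1 hu2 using fun m => exists_norm_one_of_infinite_dimensional hW
    ((quot ψ).toLinearMap ∘ₗ W.subtype) hemb.injective m
  obtain ⟨k, w, -, hd, hkw⟩ := exists_block_subsequence (fun m => quot ψ (u m))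
    (fun n => tendsto_const_nhds.congr' ((eventually_gt_atTop n).mono fun m hm => (hu2 m n hm).symm))
    (fun _ _ => True) (fun _ => Frequently.of_forall fun _ => trivial)
    (fun j => 1 / 4 * (1 / 2) ^ j) (fun j => by positivity)
  have hq1 : ∀ j, ‖quot ψ (u (k j))‖ = 1 := fun j => hu1 (k j)
  have hη : ∀ j : ℕ, (1 / 4 * (1 / 2) ^ j : ℝ) ≤ 1 / 4 := fun j => by
    have : ((1 / 2 : ℝ)) ^ j ≤ 1 := pow_le_one₀ (by norm_num) (by norm_num)
    linarith
  have hw1 : ∀ j, ‖toL2 (w j)‖ ≤ 2 := fun j => by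
    have h3 := norm_sub_norm_le (toL2 (w j)) (quot ψ (u (k j)))
    rw [norm_sub_rev] at h3
    linarith [(hkw j).2, hη j, hq1 j]
  have hw2 : ∀ j, 1 / 2 ≤ ‖toL2 (w j)‖ := fun j => by
    have h3 := norm_sub_norm_le (quot ψ (u (k j))) (toL2 (w j))
    linarith [(hkw j).2, hη j, hq1 j]
  -- Here `2` bounds the blocks, `1 / 4 * 2` bounds the sum of the approximation errors, and `c` is
  -- the norm of the inverse of `q` on `W`.
  refine not_bounded_below_of_blocks ψ hb0 (fun x y => (hb x y).1) (C := c * (2 + 1 / 4 * 2))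
    (α := fun j => toZn ψ (u (k j))) (fun A ε hε => ?_) hd (fun j => ?_) (δ := 1 / 2) (by norm_num) hw2
  · rcases A.eq_empty_or_nonempty with rfl | hA
    · simp
    have e1 : ∑ j ∈ A, ε j • toZn ψ (u (k j)) = toZn ψ ((∑ j ∈ A, ε j • u (k j) : W) : Z ψ) := by
      simp
    have e2 : quot ψ ((∑ j ∈ A, ε j • u (k j) : W) : Z ψ) = ∑ j ∈ A, ε j • quot ψ (u (k j)) := by
      simp
    rw [e1, mul_assoc]
    refine (hc _).trans (mul_le_mul_of_nonneg_left ?_ hc0.le)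
    rw [e2]
    refine norm_sum_isSign_le_of_close hε (by norm_num) (u := fun j => toL2 (w j))
      (fun j => ?_) hA ?_
    · rw [norm_sub_rev]; exact (hkw j).2
    · simp only [← map_smul, ← map_sum]
      exact norm_sum_blocks_le hd hε zero_le_two hw1 A
  · rw [quotZn_toZn]
    refine (hkw j).2.trans ?_
    have : (0 : ℝ) ≤ (1 / 2) ^ j := by positivity
    linarith

/-! ### Block sequences from an embedding -/

/-- Estimates for all finite index sets pass to subsequences even when the vectors depend on the
number of summands, because an injection preserves that number. -/
lemma norm_sum_isSign_comp {E : Type*} [NormedAddCommGroup E] [NormedSpace ℂ E] {u : ℕ → ℕ → E}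
    {B : ℕ → ℝ} (h : ∀ (A : Finset ℕ) ε, IsSign ε → ‖∑ j ∈ A, ε j • u A.card j‖ ≤ B A.card)
    {k : ℕ → ℕ} (hk : Function.Injective k) (A : Finset ℕ) (ε : ℕ → ℂ) (hε : IsSign ε) :
    ‖∑ j ∈ A, ε j • u A.card (k j)‖ ≤ B A.card := by
  have h1 := h (A.map ⟨k, hk⟩) (Function.extend k ε 1) fun n => by
    by_cases hn : ∃ j, k j = n
    · obtain ⟨j, rfl⟩ := hn
      rw [hk.extend_apply]; exact hε j
    · rw [Function.extend_apply' _ _ _ hn]; exact Or.inl rfl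
  rw [Finset.sum_map, Finset.card_map] at h1
  simpa only [Function.Embedding.coeFn_mk, hk.extend_apply] using h1

lemma one_le_sqrt_sqrt_card {A : Finset ℕ} (hA : A.Nonempty) : 1 ≤ √√(A.card : ℝ) :=
  Real.one_le_sqrt.2 (one_le_sqrt_card hA)

lemma tendsto_quotZn_apply (ψ : LipZero) {u : ℕ → Zn ψ} {C : ℝ}
    (h : ∀ (A : Finset ℕ) ε, IsSign ε → ‖∑ k ∈ A, ε k • u k‖ ≤ C * √√A.card * √A.card) (n : ℕ) :
    Tendsto (fun k => quotZn ψ (u k) n) atTop (𝓝 0) := by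
  refine tendsto_zero_of_sum_isSign (C := ‖quotZn ψ‖ * C) fun A ε hε => ?_
  have e : ∑ k ∈ A, ε k * quotZn ψ (u k) n = quotZn ψ (∑ k ∈ A, ε k • u k) n := by
    simp only [map_sum, map_smul]
    rw [lp.coeFn_sum, Finset.sum_apply]
    simp
  rw [e]
  refine (lp.norm_apply_le_norm (by simp) _ n).trans (((quotZn ψ).le_opNorm_of_le (h A ε hε)).trans_eq ?_)
  ring

section Estimates

variable {ψ : LipZero} {α β : ℕ → Zn ψ} {G : ℕ → ℂ} {C L : ℝ}

lemma tendsto_quotZn_apply_of_estimate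
    (h : ∀ (A : Finset ℕ) ε, IsSign ε → ‖∑ k ∈ A, ε k • α k‖ ≤ C * √A.card) (n : ℕ) :
    Tendsto (fun k => quotZn ψ (α k) n) atTop (𝓝 0) := by
  refine tendsto_quotZn_apply ψ (C := C) (fun A ε hε => ?_) n
  rcases A.eq_empty_or_nonempty with rfl | hA
  · simp
  have hC : 0 ≤ C := (norm_nonneg _).trans (by simpa using h {0} (fun _ => 1) fun _ => Or.inl rfl)
  refine (h A ε hε).trans ?_
  have := one_le_sqrt_sqrt_card hA
  gcongr
  exact le_mul_of_one_le_right hC this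

/-- Otherwise a subsequence of the images would be bounded below and, having null coordinates, close
to disjoint blocks. The argument for strict singularity then applies. -/
lemma tendsto_norm_quotZn_of_estimate (hψ : IsBiLipschitz (ψ : ℝ≥0 → ℂ))
    (h : ∀ (A : Finset ℕ) ε, IsSign ε → ‖∑ k ∈ A, ε k • α k‖ ≤ C * √A.card) :
    Tendsto (fun k => ‖quotZn ψ (α k)‖) atTop (𝓝 0) := by
  obtain ⟨a, b, _, hb0, hb⟩ := hψ
  by_contra hcon
  rw [Metric.tendsto_atTop'] at hcon
  push Not at hcon
  obtain ⟨δ, hδ, hcon⟩ := hcon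
  have hfr : ∃ᶠ k in atTop, δ ≤ ‖quotZn ψ (α k)‖ := by
    rw [frequently_atTop]
    intro n
    obtain ⟨k, hk, hk'⟩ := hcon n
    exact ⟨k, hk.le, by simpa using hk'⟩
  obtain ⟨k, w, hk, hd, hkw⟩ := exists_block_subsequence (fun m => quotZn ψ (α m))
    (tendsto_quotZn_apply_of_estimate h) (fun _ k => δ ≤ ‖quotZn ψ (α k)‖) (fun _ => hfr)
    (fun j => min 1 (δ / 2) * (1 / 2) ^ j) (fun j => by positivity)
  have h0 : ∀ j : ℕ, (0 : ℝ) ≤ (1 / 2) ^ j := fun j => by positivity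
  have h1 : ∀ j : ℕ, ((1 / 2 : ℝ)) ^ j ≤ 1 := fun j => pow_le_one₀ (by norm_num) (by norm_num)
  refine not_bounded_below_of_blocks ψ hb0 (fun x y => (hb x y).1) (C := C) (α := fun j => α (k j))
    (fun A ε hε => norm_sum_isSign_comp (u := fun _ => α) (B := fun N => C * √N) h hk A ε hε)
    hd (fun j => ?_) (half_pos hδ) (fun j => ?_)
  · refine (hkw j).2.trans ?_
    have := mul_le_mul_of_nonneg_right (min_le_left 1 (δ / 2)) (h0 j)
    linarith
  · have h2 := norm_sub_norm_le (quotZn ψ (α (k j))) (toL2 (w j))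
    have h3 := mul_le_mul (min_le_right 1 (δ / 2)) (h1 j) (h0 j) (half_pos hδ).le
    linarith [(hkw j).1, (hkw j).2]

/-- Subtracting `G(N)` times the sum of the `αₖ` costs a factor `N^(1/4)`. The resulting order
`N^(3/4)` still suffices for null coordinates, so that the gliding hump applies to the `βₖ`. -/
lemma norm_sum_isSign_right_le (hG : ∀ N : ℕ, ‖G N‖ ≤ L * √√N)
    (hα : ∀ (A : Finset ℕ) ε, IsSign ε → ‖∑ k ∈ A, ε k • α k‖ ≤ C * √A.card)
    (hβ : ∀ (A : Finset ℕ) ε, IsSign ε → ‖∑ k ∈ A, ε k • (β k + G A.card • α k)‖ ≤ C * √A.card)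
    (A : Finset ℕ) (ε : ℕ → ℂ) (hε : IsSign ε) :
    ‖∑ k ∈ A, ε k • β k‖ ≤ (C + L * C) * √√A.card * √A.card := by
  rcases A.eq_empty_or_nonempty with rfl | hA
  · simp
  have hC : 0 ≤ C := (norm_nonneg _).trans (by simpa using hα {0} (fun _ => 1) fun _ => Or.inl rfl)
  have e : ∑ k ∈ A, ε k • β k =
      ∑ k ∈ A, ε k • (β k + G A.card • α k) - G A.card • ∑ k ∈ A, ε k • α k := by
    simp only [smul_add, Finset.sum_add_distrib, Finset.smul_sum, smul_comm (G A.card)]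
    abel
  rw [e]
  refine (norm_sub_le _ _).trans ?_
  rw [norm_smul]
  have h1 := mul_le_mul (hG A.card) (hα A ε hε) (norm_nonneg _) ((norm_nonneg _).trans (hG A.card))
  have h2 := one_le_sqrt_sqrt_card hA
  have h3 : C * √A.card * 1 ≤ C * √A.card * √√A.card := by gcongr
  linarith [hβ A ε hε]

/-- Suppose that the signed sums over `N` indices of `αₖ` and of `βₖ + G(N) αₖ` in `Z(ψ)` are
`O(√N)`. Then `αₖ` is, along a subsequence, given by elements `fₖ` of `ℓ₂`, and `G(N) fₖ` is at a
bounded distance of the increment of `Ω_ψ` from the scale `1` to `√N` at a bounded sequence. -/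
lemma exists_blocks_of_estimates (hψ : IsBiLipschitz (ψ : ℝ≥0 → ℂ)) {c : ℝ} (hc : 0 < c)
    (hG1 : G 1 = 0) (hG : ∀ N : ℕ, ‖G N‖ ≤ L * √√N)
    (hα : ∀ (A : Finset ℕ) ε, IsSign ε → ‖∑ k ∈ A, ε k • α k‖ ≤ C * √A.card)
    (hβ : ∀ (A : Finset ℕ) ε, IsSign ε → ‖∑ k ∈ A, ε k • (β k + G A.card • α k)‖ ≤ C * √A.card)
    (hαc : ∀ k, c ≤ ‖α k‖) :
    ∃ c' M C' : ℝ, 0 < c' ∧ 0 < M ∧ 0 ≤ C' ∧ ∃ (f : ℕ → L2) (w : ℕ → ℕ →₀ ℂ),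
      (∀ j, ‖toL2 (w j)‖ ≤ M) ∧ (∀ᶠ j in atTop, c' ≤ ‖f j‖) ∧
      ∀ N : ℕ, 1 ≤ N → ∀ᶠ j in atTop,
        ‖G N • f j - toL2 (OmegaAt ψ (M * √N) (w j) - OmegaAt ψ M (w j))‖ ≤ C' := by
  have hL : 0 ≤ L := by simpa [hG1] using hG 1
  have hC : 0 ≤ C := (norm_nonneg _).trans (by simpa using hα {0} (fun _ => 1) fun _ => Or.inl rfl)
  have hβ1 : ∀ k, ‖β k‖ ≤ C := fun k => by
    simpa [hG1] using hβ {k} (fun _ => 1) fun _ => Or.inl rfl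
  have hq := tendsto_norm_quotZn_of_estimate hψ hα
  -- The blocks come from the `βₖ`. The side condition makes the images of the `αₖ` summably small
  -- along the same subsequence, so that `αₖ` can be replaced by `(fⱼ, 0)`.
  obtain ⟨k, w, hk, hd, hkw⟩ := exists_block_subsequence (fun m => quotZn ψ (β m))
    (tendsto_quotZn_apply ψ (norm_sum_isSign_right_le hG hα hβ))
    (fun j k => ‖quotZn ψ (α k)‖ ≤ (1 / 2) ^ j)
    (fun j => (hq.eventually_le_const (by positivity)).frequently)
    (fun j => (1 / 2) ^ j) (fun j => by positivity)
  obtain ⟨κ, hκ, hclose⟩ := exists_preZn_close ψ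
  choose y hy using fun j => hclose (β (k j)) (w j) ((1 / 2) ^ j) (by positivity) (hkw j).2
  choose f hf using fun j => hclose (α (k j)) 0 ((1 / 2) ^ j) (by positivity)
    (by simpa using (hkw j).1)
  simp only [← inclZn_apply] at hf
  set M := ‖quotZn ψ‖ * C + 1 with hM
  have hM0 : 0 < M := by positivity
  have hwM : ∀ j, ‖toL2 (w j)‖ ≤ M := fun j => by
    have h1 := (quotZn ψ).le_opNorm_of_le (hβ1 (k j))
    have h2 : ((1 / 2 : ℝ)) ^ j ≤ 1 := pow_le_one₀ (by norm_num) (by norm_num)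
    have h3 := norm_sub_norm_le (toL2 (w j)) (quotZn ψ (β (k j)))
    rw [norm_sub_rev] at h3
    linarith [(hkw j).2]
  have hsum : ∀ A : Finset ℕ, A.Nonempty → ∀ ε, IsSign ε →
      ‖∑ j ∈ A, ε j • preZn ψ (pair ψ (y j + G A.card • f j) (w j))‖ ≤
        (C + κ * 2 + L * (κ * 2)) * √A.card := by
    intro A hA ε hε
    have e : ∀ j, preZn ψ (pair ψ (y j + G A.card • f j) (w j)) =
        preZn ψ (pair ψ (y j) (w j)) + G A.card • inclZn ψ (f j) := fun j => by
      rw [inclZn_apply, ← map_smul, ← map_add, pair_smul, pair_add]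
      simp
    have e2 : ∑ j ∈ A, ε j • preZn ψ (pair ψ (y j + G A.card • f j) (w j)) =
        ∑ j ∈ A, ε j • (β (k j) + G A.card • α (k j)) -
        ∑ j ∈ A, ε j • (β (k j) - preZn ψ (pair ψ (y j) (w j))) -
        G A.card • ∑ j ∈ A, ε j • (α (k j) - inclZn ψ (f j)) := by
      simp only [e, smul_add, smul_sub, Finset.sum_add_distrib, Finset.sum_sub_distrib,
        Finset.smul_sum, smul_comm (G A.card)]
      abel
    have h1 := norm_sum_isSign_comp (u := fun N j => β j + G N • α j) (B := fun N => C * √N) hβ hk A ε hε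
    have h2 := norm_sum_isSign_le hε hy hκ.le A
    have h3 := norm_sum_isSign_le hε hf hκ.le A
    have h4 : ‖G A.card • ∑ j ∈ A, ε j • (α (k j) - inclZn ψ (f j))‖ ≤ L * √√A.card * (κ * 2) := by
      rw [norm_smul]
      exact mul_le_mul (hG _) h3 (norm_nonneg _) (by positivity)
    have h5 := one_le_sqrt_card hA
    -- The error in replacing `αₖ` is multiplied by `G(N)`, which is harmless because `G(N) =
    -- O(√N)`.
    have h6 : √√(A.card : ℝ) ≤ √A.card := by
      rw [Real.sqrt_le_left (by positivity)]
      exact le_self_pow₀ h5 two_ne_zero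
    have h7 : L * √√A.card * (κ * 2) ≤ L * √A.card * (κ * 2) := by gcongr
    have h8 : κ * 2 * 1 ≤ κ * 2 * √A.card := by gcongr
    rw [e2]
    refine (norm_sub_le _ _).trans ?_
    have h9 := norm_sub_le (∑ j ∈ A, ε j • (β (k j) + G A.card • α (k j)))
      (∑ j ∈ A, ε j • (β (k j) - preZn ψ (pair ψ (y j) (w j))))
    linarith
  obtain ⟨C', hC', h⟩ := exists_sum_norm_sq_le ψ hM0.le hd hwM y f G hG1 hsum
  obtain ⟨κ₂, hκ₂, hincl⟩ := exists_norm_inclZn ψ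
  refine ⟨c / (2 * κ₂), M, √C', by positivity, hM0, by positivity, f, w, hwM, ?_, fun N hN => ?_⟩
  · have h1 : Tendsto (fun j : ℕ => κ * (1 / 2 : ℝ) ^ j) atTop (𝓝 (κ * 0)) :=
      (tendsto_pow_atTop_nhds_zero_of_lt_one (by norm_num) (by norm_num)).const_mul κ
    rw [mul_zero] at h1
    filter_upwards [h1.eventually_le_const (half_pos hc)] with j hj
    have h2 := norm_sub_norm_le (α (k j)) (inclZn ψ (f j))
    rw [div_le_iff₀ (by positivity)]
    nlinarith [hf j, (hincl (f j)).1, hαc (k j)]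
  -- For a fixed `N`, infinitely many exceptional `j` would include `N` of them, and these would
  -- violate the bound for sums of `N` squares.
  · rw [← Nat.cofinite_eq_atTop]
    by_contra hcon
    rw [not_eventually, frequently_cofinite_iff_infinite] at hcon
    obtain ⟨A, hA, hAN⟩ := hcon.exists_subset_card_eq N
    have hAne : A.Nonempty := Finset.card_pos.1 (by omega)
    have h1 := h A hAne
    have h2 : ∑ j ∈ A, C' < ∑ j ∈ A,
        ‖G A.card • f j - toL2 (OmegaAt ψ (M * √A.card) (w j) - OmegaAt ψ M (w j))‖ ^ 2 := by
      refine Finset.sum_lt_sum_of_nonempty hAne fun j hj => ?_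
      have := hA hj
      rw [Set.mem_ofPred_eq, not_le, ← hAN] at this
      exact (Real.sqrt_lt' ((Real.sqrt_nonneg _).trans_lt this)).1 this
    rw [Finset.sum_const, nsmul_eq_mul] at h2
    linarith

end Estimates

/-! ### Embeddings of `Z(φ)` in `Z(ψ)` -/

/-- The flat vector `∑ₖ εₖ eₖ`, where `k` runs through a finite set. -/
def flat (A : Finset ℕ) (ε : ℕ → ℂ) : ℕ →₀ ℂ := ∑ k ∈ A, ε k • Finsupp.single k 1

lemma disjointSupports_single : DisjointSupports fun k => Finsupp.single k (1 : ℂ) := by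
  intro i j hij n
  rcases eq_or_ne i n with rfl | h
  · exact Or.inr (Finsupp.single_eq_of_ne hij)
  · exact Or.inl (Finsupp.single_eq_of_ne h.symm)

lemma norm_toL2_flat (A : Finset ℕ) {ε : ℕ → ℂ} (hε : IsSign ε) : ‖toL2 (flat A ε)‖ = √A.card := by
  rw [eq_comm, Real.sqrt_eq_iff_mul_self_eq (by positivity) (norm_nonneg _), ← pow_two, flat,
    norm_sq_sum_blocks disjointSupports_single hε]
  simp [toL2_single, lp.norm_single]

/-- All nonzero coordinates have modulus `1`, so `φ` is evaluated at a single point depending only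
on the number of coordinates. -/
lemma Omega_flat (φ : ℝ≥0 → ℂ) (A : Finset ℕ) {ε : ℕ → ℂ} (hε : IsSign ε) :
    Omega φ (flat A ε) = φ (Real.toNNReal (Real.log √A.card)) • flat A ε := by
  ext n
  rw [Omega_apply, norm_toL2_flat A hε, Finsupp.smul_apply, smul_eq_mul, mul_comm]
  have e : flat A ε n = if n ∈ A then ε n else 0 := by
    simp [flat, Finsupp.single_apply]
  rw [e]
  split_ifs with h
  · rw [hε.norm_eq, one_div, Real.log_inv, neg_neg]
  · simp

lemma norm_toL2_le_add {x y z : ℕ →₀ ℂ} (h : ∀ n, ‖x n‖ ≤ ‖y n‖ + ‖z n‖) :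
    ‖toL2 x‖ ≤ ‖toL2 y‖ + ‖toL2 z‖ := by
  set y' : ℕ →₀ ℂ := y.mapRange (fun a => (‖a‖ : ℂ)) (by simp) with hy'
  set z' : ℕ →₀ ℂ := z.mapRange (fun a => (‖a‖ : ℂ)) (by simp) with hz'
  have h1 : ‖toL2 x‖ ≤ ‖toL2 (y' + z')‖ := norm_toL2_le fun n => by
    have e : ‖(y' + z') n‖ = ‖y n‖ + ‖z n‖ := by
      simp only [hy', hz', Finsupp.add_apply, Finsupp.mapRange_apply, ← Complex.ofReal_add]
      rw [Complex.norm_real, Real.norm_of_nonneg (by positivity)]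
    rw [e]
    exact h n
  rw [map_add] at h1
  refine h1.trans ((norm_add_le _ _).trans (add_le_add ?_ ?_))
  · exact norm_toL2_le fun n => by simp [hy']
  · exact norm_toL2_le fun n => by simp [hz']

section Embedding

variable {φ ψ : LipZero} {σ : ℂ →+* ℂ}

/-- An isometric `σ` allows linear and conjugate-linear embeddings to be treated together. -/
lemma exists_toZn_bounds (hσ : ∀ z, ‖σ z‖ = ‖z‖) (T : Z φ →SL[σ] Z ψ) (hT : IsEmbedding T) :
    ∃ c : ℝ, 0 < c ∧ ∀ u, ‖toZn ψ (T u)‖ ≤ c * ‖toZn φ u‖ ∧ ‖toZn φ u‖ ≤ c * ‖toZn ψ (T u)‖ := by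
  have hp : ∀ (t : ℝ) (u : Z φ), 0 ≤ t → ‖toZn φ ((t : ℂ) • u)‖ = t * ‖toZn φ u‖ := fun t u ht => by
    rw [map_smul, norm_smul, Complex.norm_real, Real.norm_of_nonneg ht]
  have hq : ∀ (t : ℝ) (u : Z φ), 0 ≤ t → ‖toZn ψ (T ((t : ℂ) • u))‖ = t * ‖toZn ψ (T u)‖ :=
    fun t u ht => by
      rw [map_smulₛₗ, map_smul, norm_smul, hσ, Complex.norm_real, Real.norm_of_nonneg ht]
  have hφ : 𝓝 (0 : Z φ) = comap (toZn φ) (𝓝 0) := by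
    rw [(toZn φ).toHomeomorph.isInducing.nhds_eq_comap 0]; simp
  have hψ : 𝓝 (0 : Z φ) = comap (fun u => toZn ψ (T u)) (𝓝 0) := by
    rw [((toZn ψ).toHomeomorph.isInducing.comp hT.isInducing).nhds_eq_comap 0]; simp [Function.comp_def]
  have h1 : ∃ δ : ℝ, 0 < δ ∧ ∀ u, ‖toZn φ u‖ < δ → ‖toZn ψ (T u)‖ < 1 := by
    have := (Metric.nhds_basis_ball (x := (0 : Zn ψ))).comap (fun u => toZn ψ (T u)) |>.mem_of_mem one_pos
    rw [← hψ, hφ] at this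
    obtain ⟨δ, hδ, h⟩ := ((Metric.nhds_basis_ball (x := (0 : Zn φ))).comap (toZn φ)).mem_iff.1 this
    exact ⟨δ, hδ, fun u hu => by simpa using h (by simpa using hu)⟩
  have h2 : ∃ δ : ℝ, 0 < δ ∧ ∀ u, ‖toZn ψ (T u)‖ < δ → ‖toZn φ u‖ < 1 := by
    have := (Metric.nhds_basis_ball (x := (0 : Zn φ))).comap (toZn φ) |>.mem_of_mem one_pos
    rw [← hφ, hψ] at this
    obtain ⟨δ, hδ, h⟩ := ((Metric.nhds_basis_ball (x := (0 : Zn ψ))).comap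
      (fun u => toZn ψ (T u))).mem_iff.1 this
    exact ⟨δ, hδ, fun u hu => by simpa using h (by simpa using hu)⟩
  obtain ⟨δ₁, hδ₁, h1⟩ := h1
  obtain ⟨δ₂, hδ₂, h2⟩ := h2
  refine ⟨δ₁⁻¹ + δ₂⁻¹, by positivity, fun u => ⟨?_, ?_⟩⟩
  · refine (le_div_of_homogeneous hq hp (fun _ => norm_nonneg _) hδ₁ h1 u).trans ?_
    gcongr
    exact le_add_of_nonneg_right (by positivity)
  · refine (le_div_of_homogeneous hp hq (fun _ => norm_nonneg _) hδ₂ h2 u).trans ?_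
    gcongr
    exact le_add_of_nonneg_left (by positivity)

/-- Apply `exists_blocks_of_estimates` to `αₖ = T(eₖ, 0)` and `βₖ = T(0, eₖ)`, with `G(N) = σφ(log
√N)`. The estimate for `βₖ + G(N) αₖ` holds because these vectors sum to `T` of the lift `(Ω_φ x,
x)` of a flat vector `x`. -/
lemma exists_blocks_of_isEmbedding (hψ : IsBiLipschitz (ψ : ℝ≥0 → ℂ)) (hσ : ∀ z, ‖σ z‖ = ‖z‖)
    (T : Z φ →SL[σ] Z ψ) (hT : IsEmbedding T) :
    ∃ c' M C' : ℝ, 0 < c' ∧ 0 < M ∧ 0 ≤ C' ∧ ∃ (f : ℕ → L2) (w : ℕ → ℕ →₀ ℂ),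
      (∀ j, ‖toL2 (w j)‖ ≤ M) ∧ (∀ᶠ j in atTop, c' ≤ ‖f j‖) ∧
      ∀ N : ℕ, 1 ≤ N → ∀ᶠ j in atTop,
        ‖σ ((φ : ℝ≥0 → ℂ) (Real.toNNReal (Real.log √N))) • f j -
          toL2 (OmegaAt ψ (M * √N) (w j) - OmegaAt ψ M (w j))‖ ≤ C' := by
  obtain ⟨c, hc, hTc⟩ := exists_toZn_bounds hσ T hT
  obtain ⟨κ, hκ, hpre⟩ := exists_norm_toZn φ
  obtain ⟨hφ0, K, hK⟩ := φ.2
  -- Only real signs are used, so they pass through a conjugate-linear `T` unchanged.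
  have hsign : ∀ ε, IsSign ε → ∀ k, σ (ε k) = ε k := fun ε hε k => by
    rcases hε k with h | h <;> simp [h]
  have hsum : ∀ (A : Finset ℕ) (ε : ℕ → ℂ), IsSign ε → ∀ a b : ℂ,
      ∑ k ∈ A, ε k • (σ b • toZn ψ (T ((pair φ 0 (Finsupp.single k 1) : PreZ φ) : Z φ)) +
        σ a • toZn ψ (T ((pair φ (toL2 (Finsupp.single k 1)) 0 : PreZ φ) : Z φ))) =
      toZn ψ (T ((pair φ (a • toL2 (flat A ε)) (b • flat A ε) : PreZ φ) : Z φ)) := by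
    intro A ε hε a b
    have e : ∀ k, ε k • (σ b • toZn ψ (T ((pair φ 0 (Finsupp.single k 1) : PreZ φ) : Z φ)) +
        σ a • toZn ψ (T ((pair φ (toL2 (Finsupp.single k 1)) 0 : PreZ φ) : Z φ))) =
        toZn ψ (T ((pair φ (a • toL2 (ε k • Finsupp.single k 1)) (b • (ε k • Finsupp.single k 1)) :
          PreZ φ) : Z φ)) := by
      intro k
      rw [← map_smul (toZn ψ), ← map_smul (toZn ψ), ← map_add, ← map_smul (toZn ψ), ← map_smulₛₗ T,
        ← map_smulₛₗ T, ← map_add, ← hsign ε hε k, ← map_smulₛₗ T, hsign ε hε k,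
        ← UniformSpace.Completion.coe_smul, ← UniformSpace.Completion.coe_smul,
        ← UniformSpace.Completion.coe_add, ← UniformSpace.Completion.coe_smul,
        pair_smul, pair_smul, pair_add, pair_smul]
      simp only [smul_zero, zero_add, add_zero, map_smul, smul_comm (ε k)]
    rw [Finset.sum_congr rfl fun k _ => e k, flat]
    induction A using Finset.induction_on with
    | empty =>
      have : pair φ 0 0 = 0 := rfl
      simp [this, UniformSpace.Completion.coe_zero]
    | insert i A hi ih =>
      rw [Finset.sum_insert hi, Finset.sum_insert hi, ih, ← map_add, ← map_add,
        ← UniformSpace.Completion.coe_add, pair_add, map_add, smul_add, smul_add]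
  have hbd : ∀ u : PreZ φ, ‖toZn ψ (T (u : Z φ))‖ ≤ c * κ * qnorm φ u := fun u => by
    rw [mul_assoc]
    exact (hTc _).1.trans (mul_le_mul_of_nonneg_left (hpre u).1 hc.le)
  refine exists_blocks_of_estimates (C := c * κ) (L := K * 2) (c := (c * κ)⁻¹)
    (α := fun k => toZn ψ (T ((pair φ (toL2 (Finsupp.single k 1)) 0 : PreZ φ) : Z φ)))
    (β := fun k => toZn ψ (T ((pair φ 0 (Finsupp.single k 1) : PreZ φ) : Z φ)))
    (G := fun N => σ ((φ : ℝ≥0 → ℂ) (Real.toNNReal (Real.log √N))))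
    hψ (by positivity) ?_ ?_ ?_ ?_ ?_
  · simp [hφ0]
  · intro N
    rw [hσ]
    have h1 := dist_phi hK (Real.log √N) 0
    rw [Real.toNNReal_zero, hφ0, sub_zero, sub_zero] at h1
    have h2 : |Real.log √(N : ℝ)| ≤ 2 * √√N := by
      rcases Nat.eq_zero_or_pos N with rfl | hN
      · simp
      have h3 : (1 : ℝ) ≤ N := by exact_mod_cast hN
      rw [abs_of_nonneg (Real.log_nonneg (Real.one_le_sqrt.2 h3))]
      have h4 := Real.log_le_self (Real.sqrt_nonneg √(N : ℝ))
      rw [Real.log_sqrt (Real.sqrt_nonneg _)] at h4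
      linarith
    rw [mul_assoc]
    exact h1.trans (mul_le_mul_of_nonneg_left h2 K.2)
  · intro A ε hε
    have := hsum A ε hε 1 0
    simp only [map_zero, zero_smul, zero_add, map_one, one_smul] at this
    rw [this]
    refine (hbd _).trans_eq ?_
    rw [qnorm_incl, norm_toL2_flat A hε]
  · intro A ε hε
    have := hsum A ε hε ((φ : ℝ≥0 → ℂ) (Real.toNNReal (Real.log √A.card))) 1
    simp only [map_one, one_smul] at this
    rw [this, ← map_smul, ← Omega_flat _ A hε]
    refine (hbd _).trans_eq ?_
    rw [qnorm_lift, norm_toL2_flat A hε]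
  · intro k
    have h1 := (hpre (pair φ (toL2 (Finsupp.single k 1)) 0)).2
    rw [qnorm_incl, toL2_single, lp.norm_single (by simp), norm_one, ← toL2_single] at h1
    have h2 := (hTc ((pair φ (toL2 (Finsupp.single k 1)) 0 : PreZ φ) : Z φ)).2
    rw [inv_le_iff_one_le_mul₀ (by positivity)]
    nlinarith

end Embedding

/-! ### Increments at three scales -/

/-- The increment of `ψ` from `τ` to `τ + s`. -/
def incr (ψ : ℝ≥0 → ℂ) (τ s : ℝ) : ℂ := ψ (Real.toNNReal (τ + s)) - ψ (Real.toNNReal τ)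

lemma norm_incr_le {ψ : ℝ≥0 → ℂ} {K : ℝ≥0} (hK : LipschitzWith K ψ) (τ s : ℝ) :
    ‖incr ψ τ s‖ ≤ K * |s| := by
  simpa [incr] using dist_phi hK (τ + s) τ

lemma norm_incr_sub_le {ψ : ℝ≥0 → ℂ} {K : ℝ≥0} (hK : LipschitzWith K ψ) (τ s s' : ℝ) :
    ‖incr ψ τ s - incr ψ τ s'‖ ≤ K * |s - s'| := by
  have := dist_phi hK (τ + s) (τ + s')
  simpa [incr] using this

lemma OmegaAt_sub_apply (ψ : ℝ≥0 → ℂ) {M : ℝ} (hM : 0 < M) (s : ℝ) (w : ℕ →₀ ℂ) (n : ℕ) :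
    (OmegaAt ψ (M * Real.exp s) w - OmegaAt ψ M w) n = w n * incr ψ (-Real.log (‖w n‖ / M)) s := by
  rw [Finsupp.sub_apply, OmegaAt_apply, OmegaAt_apply, scaled_mul_sub_scaled ψ hM (Real.exp_pos s),
    Real.log_exp, incr]

/-- If multiples `γᵢ f` of a vector are close to the increments of `Ω_ψ` at `w` from the scale `1`
to the scales `exp sᵢ`, then the `γᵢ` are close to be proportional to increments of `ψ`. -/
lemma exists_incr_of_norm_le {ψ : ℝ≥0 → ℂ} {M C c B : ℝ} (hM : 0 < M) (hC : 0 ≤ C) (hB : 0 ≤ B)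
    {w : ℕ →₀ ℂ} (hw : ‖toL2 w‖ ≤ M) {f : L2} {γ : Fin 3 → ℂ} {s : Fin 3 → ℝ} (hs : ∀ i, 0 < s i)
    (hs0 : ∀ i, s 0 ≤ s i)
    (hf : ∀ i, ‖γ i • f - toL2 (OmegaAt ψ (M * Real.exp (s i)) w - OmegaAt ψ M w)‖ ≤ C)
    (hγ : ∀ i, ‖γ i‖ ≤ B * s i) (hc : 0 < c) (hwc : c ≤ ‖toL2 w‖) :
    ∃ τ, 0 ≤ τ ∧ ∀ i, ‖γ 0 * incr ψ τ (s i) - γ i * incr ψ τ (s 0)‖ ≤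
      (4 * C * B + 1) / c * s i := by
  by_contra! hcon
  set D : Fin 3 → ℕ →₀ ℂ := fun i => OmegaAt ψ (M * Real.exp (s i)) w - OmegaAt ψ M w with hD
  set X : Fin 3 → ℕ →₀ ℂ := fun i => (((s i)⁻¹ : ℝ) : ℂ) • (γ 0 • D i - γ i • D 0) with hX
  have hXn : ∀ i n, ‖X i n‖ = (s i)⁻¹ * (‖w n‖ *
      ‖γ 0 * incr ψ (-Real.log (‖w n‖ / M)) (s i) - γ i * incr ψ (-Real.log (‖w n‖ / M)) (s 0)‖) := by
    intro i n
    have := hs i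
    simp only [hX, hD, Finsupp.smul_apply, smul_eq_mul, norm_mul, Complex.norm_real]
    rw [Real.norm_of_nonneg (by positivity), Finsupp.sub_apply, Finsupp.smul_apply,
      Finsupp.smul_apply, OmegaAt_sub_apply ψ hM, OmegaAt_sub_apply ψ hM, ← norm_mul]
    congr 2
    simp only [smul_eq_mul]
    ring
  have hXb : ∀ i, ‖toL2 (X i)‖ ≤ 2 * C * B := by
    intro i
    have hsi := hs i
    -- Cross-multiplication eliminates the unknown vector `f`.
    have e : toL2 (γ 0 • D i - γ i • D 0) =
        γ i • (γ 0 • f - toL2 (D 0)) - γ 0 • (γ i • f - toL2 (D i)) := by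
      simp only [map_sub, map_smul, smul_sub, smul_comm (γ i) (γ 0)]
      abel
    have h1 : ‖toL2 (γ 0 • D i - γ i • D 0)‖ ≤ s i * (2 * C * B) := by
      rw [e]
      refine (norm_sub_le _ _).trans ?_
      rw [norm_smul, norm_smul]
      have h2 := mul_le_mul (hγ i) (hf 0) (norm_nonneg _) (by positivity)
      have h3 := mul_le_mul ((hγ 0).trans (mul_le_mul_of_nonneg_left (hs0 i) hB)) (hf i)
        (norm_nonneg _) (by positivity)
      linarith
    rw [map_smul, norm_smul, Complex.norm_real, Real.norm_of_nonneg (by positivity),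
      inv_mul_le_iff₀ hsi]
    exact h1
  have hK : 0 ≤ (4 * C * B + 1) / c := by positivity
  -- If every `τ` failed, each coordinate `n`, with its own `τ = -log(|wₙ| / M)`, would make `X 1`
  -- or `X 2` large there. Together they would dominate a multiple of `w` of norm at least `4 C B +
  -- 1`, while their norms add up to at most `4 C B`.
  have hle : ‖toL2 ((((4 * C * B + 1) / c : ℝ) : ℂ) • w)‖ ≤ ‖toL2 (X 1)‖ + ‖toL2 (X 2)‖ := by
    refine norm_toL2_le_add fun n => ?_
    rw [Finsupp.smul_apply, smul_eq_mul, norm_mul, Complex.norm_real, Real.norm_of_nonneg hK]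
    obtain ⟨i, hi⟩ := hcon (-Real.log (‖w n‖ / M))
      (neg_log_div_nonneg ((norm_apply_le_norm_toL2 w n).trans hw))
    have key : (4 * C * B + 1) / c * ‖w n‖ ≤ ‖X i n‖ := by
      rw [hXn, le_inv_mul_iff₀ (hs i)]
      calc _ = ‖w n‖ * ((4 * C * B + 1) / c * s i) := by ring
        _ ≤ _ := mul_le_mul_of_nonneg_left hi.le (norm_nonneg _)
    -- The index `0` cannot fail, since its expression is identically zero.
    fin_cases i
    · have h0 := hs 0
      simp only [Fin.zero_eta, sub_self, norm_zero] at hi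
      exact absurd hi (not_lt.2 (by positivity))
    · exact key.trans (le_add_of_nonneg_right (norm_nonneg _))
    · exact key.trans (le_add_of_nonneg_left (norm_nonneg _))
  rw [map_smul, norm_smul, Complex.norm_real, Real.norm_of_nonneg hK] at hle
  have h1 : (4 * C * B + 1) / c * c ≤ (4 * C * B + 1) / c * ‖toL2 w‖ := by gcongr
  rw [div_mul_cancel₀ _ hc.ne'] at h1
  linarith [hXb 1, hXb 2]

/-- The previous estimates hold at scales `log √N` only. Rounding `exp (2 s)` up to an integer
multiplies it by less than `exp 2`. -/
lemma exists_log_sqrt_nat_close {s : ℝ} (hs : 0 ≤ s) :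
    ∃ N : ℕ, 1 ≤ N ∧ s ≤ Real.log √N ∧ Real.log √N ≤ s + 1 := by
  have h1 : 1 ≤ Real.exp (2 * s) := Real.one_le_exp (by positivity)
  have hN : 1 ≤ ⌈Real.exp (2 * s)⌉₊ := Nat.one_le_ceil_iff.2 (by positivity)
  have hN' : (1 : ℝ) ≤ ⌈Real.exp (2 * s)⌉₊ := by exact_mod_cast hN
  refine ⟨⌈Real.exp (2 * s)⌉₊, hN, ?_, ?_⟩
  · rw [Real.log_sqrt (by positivity), le_div_iff₀ two_pos, Real.le_log_iff_exp_le (by linarith),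
      mul_comm]
    exact Nat.le_ceil _
  · rw [Real.log_sqrt (by positivity), div_le_iff₀ two_pos, Real.log_le_iff_le_exp (by linarith)]
    refine (Nat.ceil_lt_add_one (by positivity)).le.trans ?_
    have e : Real.exp ((s + 1) * 2) = Real.exp (2 * s) * Real.exp 2 := by
      rw [← Real.exp_add]; ring_nf
    have h2 : 3 ≤ Real.exp 2 := by linarith [Real.add_one_le_exp (2 : ℝ)]
    rw [e]
    nlinarith

/-- If `Z(φ)` embeds in `Z(ψ)` then the values of `φ` at three large points are close to be
proportional to the corresponding increments of `ψ` somewhere. -/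
lemma exists_incr_of_isEmbedding {φ ψ : LipZero} {σ : ℂ →+* ℂ} (hφ : IsBiLipschitz (φ : ℝ≥0 → ℂ))
    (hψ : IsBiLipschitz (ψ : ℝ≥0 → ℂ)) (hσ : ∀ z, ‖σ z‖ = ‖z‖) (T : Z φ →SL[σ] Z ψ)
    (hT : IsEmbedding T) : ∃ K s₀ : ℝ, 0 < K ∧ 0 < s₀ ∧ ∀ s : Fin 3 → ℝ, s₀ ≤ s 0 →
      (∀ i, s 0 ≤ s i) → ∃ τ, 0 ≤ τ ∧ ∀ i,
        ‖σ (incr φ 0 (s 0)) * incr ψ τ (s i) - σ (incr φ 0 (s i)) * incr ψ τ (s 0)‖ ≤ K * s i := by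
  obtain ⟨c', M, C', hc', hM, hC', f, w, hwM, hfc, hN⟩ := exists_blocks_of_isEmbedding hψ hσ T hT
  obtain ⟨a, b, _, hb0, hb⟩ := hφ
  obtain ⟨hφ0, L, hL⟩ := φ.2
  obtain ⟨-, K, hK⟩ := ψ.2
  have hincr : ∀ s, (φ : ℝ≥0 → ℂ) (Real.toNNReal s) = incr φ 0 s := fun s => by simp [incr, hφ0]
  simp only [hincr] at hN
  -- A lower bound for the blocks: `σφ f` has norm at least `b c' t₀`, the increment of `Ω_ψ` has
  -- norm at most `K t₀ ‖w‖`, and the error `C'` is at most half of the former by the choice of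
  -- `s₀`. The summand `1` only keeps the denominator positive.
  set c := b * c' / (2 * (K + 1)) with hc
  have hc0 : 0 < c := by positivity
  set R := (4 * C' * L + 1) / c with hR
  have hR0 : 0 < R := by positivity
  refine ⟨2 * R + 6 * L * K + 1, max 1 (2 * C' / (b * c')), by positivity, by positivity,
    fun s hs hs0 => ?_⟩
  have hs1 : ∀ i, 1 ≤ s i := fun i => (le_max_left _ _).trans (hs.trans (hs0 i))
  choose N hN1 hN2 hN3 using fun i => exists_log_sqrt_nat_close (zero_le_one.trans (hs1 i))
  -- Rounding may destroy the order of nearly equal scales. In that case `N 0` is also a good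
  -- approximation for the other scale.
  wlog hmono : ∀ i, Real.log √(N 0) ≤ Real.log √(N i) generalizing N
  · refine this (fun i => if Real.log √(N 0) ≤ Real.log √(N i) then N i else N 0) (fun i => ?_)
      (fun i => ?_) (fun i => ?_) (fun i => ?_)
    · split_ifs
      exacts [hN1 i, hN1 0]
    · split_ifs with h
      exacts [hN2 i, (hN2 i).trans (not_le.1 h).le]
    · split_ifs with h
      exacts [hN3 i, (hN3 0).trans (by linarith [hs0 i])]
    · by_cases h : Real.log √(N 0) ≤ Real.log √(N i) <;> simp [h]
  set t : Fin 3 → ℝ := fun i => Real.log √(N i) with ht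
  have hexp : ∀ i, Real.exp (t i) = √(N i) := fun i => by
    have : (0 : ℝ) < N i := by exact_mod_cast hN1 i
    exact Real.exp_log (by positivity)
  have ht0 : ∀ i, 0 < t i := fun i => (zero_lt_one.trans_le (hs1 i)).trans_le (hN2 i)
  -- One index `j`, hence the same `f j` and `w j`, serves all three scales.
  obtain ⟨j, hj, hj0, hj1, hj2⟩ := (hfc.and ((hN (N 0) (hN1 0)).and ((hN (N 1) (hN1 1)).and
    (hN (N 2) (hN1 2))))).exists
  have hf : ∀ i, ‖σ (incr φ 0 (t i)) • f j -
      toL2 (OmegaAt ψ (M * Real.exp (t i)) (w j) - OmegaAt ψ M (w j))‖ ≤ C' := by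
    intro i
    rw [hexp]
    fin_cases i
    exacts [hj0, hj1, hj2]
  have hγ : ∀ i, ‖σ (incr φ 0 (t i))‖ ≤ L * t i := fun i => by
    rw [hσ]
    simpa [abs_of_pos (ht0 i)] using norm_incr_le hL 0 (t i)
  have hwc : c ≤ ‖toL2 (w j)‖ := by
    have h1 : b * t 0 ≤ ‖σ (incr φ 0 (t 0))‖ := by
      rw [hσ]
      exact mul_le_norm_sub_of_expanding (fun x y => (hb x y).1) le_rfl (ht0 0).le
    have h2 : ‖toL2 (OmegaAt ψ (M * Real.exp (t 0)) (w j) - OmegaAt ψ M (w j))‖ ≤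
        K * t 0 * ‖toL2 (w j)‖ := by
      refine norm_toL2_le_mul (mul_nonneg K.2 (ht0 0).le) fun n => ?_
      rw [OmegaAt_sub_apply _ hM, norm_mul, mul_comm]
      have := norm_incr_le hK (-Real.log (‖w j n‖ / M)) (t 0)
      rw [abs_of_pos (ht0 0)] at this
      gcongr
    have h3 := norm_sub_norm_le (σ (incr φ 0 (t 0)) • f j)
      (toL2 (OmegaAt ψ (M * Real.exp (t 0)) (w j) - OmegaAt ψ M (w j)))
    rw [norm_smul] at h3
    have h4 : b * t 0 * c' ≤ ‖σ (incr φ 0 (t 0))‖ * ‖f j‖ := by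
      have := ht0 0
      gcongr
    have h5 : 2 * C' ≤ t 0 * (b * c') := by
      rw [← div_le_iff₀ (by positivity)]
      exact (le_max_right _ _).trans (hs.trans (hN2 0))
    have h6 : t 0 * (b * c') ≤ t 0 * ((‖toL2 (w j)‖) * (2 * (K + 1))) := by
      have := hf 0
      have := mul_nonneg (ht0 0).le (norm_nonneg (toL2 (w j)))
      nlinarith
    rw [hc, div_le_iff₀ (by positivity)]
    exact le_of_mul_le_mul_left h6 (ht0 0)
  obtain ⟨τ, hτ, h⟩ := exists_incr_of_norm_le (B := (L : ℝ)) hM hC' L.coe_nonneg (hwM j) ht0 hmono hf hγ hc0 hwc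
  refine ⟨τ, hτ, fun i => ?_⟩
  have hts : ∀ i, |s i - t i| ≤ 1 := fun i => by
    rw [abs_sub_comm, abs_le]
    constructor <;> linarith [hN2 i, hN3 i]
  have hφd : ∀ i, ‖σ (incr φ 0 (s i)) - σ (incr φ 0 (t i))‖ ≤ L := fun i => by
    rw [← map_sub, hσ]
    exact (norm_incr_sub_le hL 0 _ _).trans (mul_le_of_le_one_right L.2 (hts i))
  have hψd : ∀ i, ‖incr ψ τ (s i) - incr ψ τ (t i)‖ ≤ K := fun i =>
    (norm_incr_sub_le hK τ _ _).trans (mul_le_of_le_one_right K.2 (hts i))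
  have hφs : ∀ i, ‖σ (incr φ 0 (s i))‖ ≤ L * s i := fun i => by
    rw [hσ]
    simpa [abs_of_pos (zero_lt_one.trans_le (hs1 i))] using norm_incr_le hL 0 (s i)
  have hψt : ∀ i, ‖incr ψ τ (t i)‖ ≤ K * t i := fun i => by
    simpa [abs_of_pos (ht0 i)] using norm_incr_le hK τ (t i)
  -- Returning from the rounded scales changes each factor by a bounded amount and hence each
  -- product by `O(s i)`, the order of the permitted error.
  have prod : ∀ k l, s k ≤ s i → s l ≤ s i →
      ‖σ (incr φ 0 (s k)) * incr ψ τ (s l) - σ (incr φ 0 (t k)) * incr ψ τ (t l)‖ ≤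
        3 * L * K * s i := by
    intro k l hk hl
    have e : σ (incr φ 0 (s k)) * incr ψ τ (s l) - σ (incr φ 0 (t k)) * incr ψ τ (t l) =
        σ (incr φ 0 (s k)) * (incr ψ τ (s l) - incr ψ τ (t l)) +
        (σ (incr φ 0 (s k)) - σ (incr φ 0 (t k))) * incr ψ τ (t l) := by ring
    rw [e]
    refine (norm_add_le _ _).trans ?_
    rw [norm_mul, norm_mul]
    have h1 := mul_le_mul (hφs k) (hψd l) (norm_nonneg _) (mul_nonneg L.2 (zero_le_one.trans (hs1 k)))
    have h2 := mul_le_mul (hφd k) (hψt l) (norm_nonneg _) L.2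
    have h3 : t l ≤ 2 * s i := by linarith [hN3 l, hs1 i]
    have hLK : (0 : ℝ) ≤ L * K := mul_nonneg L.2 K.2
    have h4 := mul_le_mul_of_nonneg_left h3 hLK
    have h5 := mul_le_mul_of_nonneg_left hk hLK
    linarith
  have hti : t i ≤ 2 * s i := by linarith [hN3 i, hs1 i]
  have e : σ (incr φ 0 (s 0)) * incr ψ τ (s i) - σ (incr φ 0 (s i)) * incr ψ τ (s 0) =
      (σ (incr φ 0 (s 0)) * incr ψ τ (s i) - σ (incr φ 0 (t 0)) * incr ψ τ (t i)) -
      (σ (incr φ 0 (s i)) * incr ψ τ (s 0) - σ (incr φ 0 (t i)) * incr ψ τ (t 0)) +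
      (σ (incr φ 0 (t 0)) * incr ψ τ (t i) - σ (incr φ 0 (t i)) * incr ψ τ (t 0)) := by ring
  rw [e]
  refine (norm_add_le _ _).trans ?_
  have h1 := norm_sub_le
    (σ (incr φ 0 (s 0)) * incr ψ τ (s i) - σ (incr φ 0 (t 0)) * incr ψ τ (t i))
    (σ (incr φ 0 (s i)) * incr ψ τ (s 0) - σ (incr φ 0 (t i)) * incr ψ τ (t 0))
  have h2 := prod 0 i (hs0 i) le_rfl
  have h3 := prod i 0 le_rfl (hs0 i)
  have h4 := (h i).trans (mul_le_mul_of_nonneg_left hti hR0.le)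
  rw [← hR] at h4
  linarith [hs1 i]

section

/-! ### The generators of the cone -/

open MeasureTheory
open scoped Nat

/-- The type of the `j`-th interval `[j!, (j + 1)!)`: it is `0` if `j` is even, and each `k + 1` is the type
of infinitely many intervals with odd `j`. -/
def intervalType (j : ℕ) : ℕ := if Odd j then (Nat.unpair (j / 2)).1 + 1 else 0

lemma intervalType_even {j : ℕ} (hj : Even j) : intervalType j = 0 :=
  if_neg (Nat.not_odd_iff_even.2 hj)

lemma exists_intervalType_eq (k n : ℕ) : ∃ j, n ≤ j ∧ Odd j ∧ intervalType j = k + 1 := by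
  have ho : Odd (2 * Nat.pair k n + 1) := odd_two_mul_add_one _
  refine ⟨2 * Nat.pair k n + 1, ?_, ho, ?_⟩
  · have := Nat.right_le_pair k n
    omega
  · rw [intervalType, if_pos ho]
    have : (2 * Nat.pair k n + 1) / 2 = Nat.pair k n := by omega
    rw [this, Nat.unpair_pair]

/-- The interval `[j!, (j + 1)!)`. -/
def factInterval (j : ℕ) : Set ℝ := Set.Ico (j ! : ℝ) ((j + 1)! : ℝ)

lemma factInterval_unique {i j : ℕ} {x : ℝ} (hi : x ∈ factInterval i) (hj : x ∈ factInterval j) :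
    i = j := by
  have key : ∀ {a b : ℕ}, x ∈ factInterval a → x ∈ factInterval b → a ≤ b := by
    intro a b ha hb
    by_contra! h
    have h1 : (b + 1)! ≤ a ! := Nat.factorial_le h
    have h2 : (((b + 1)! : ℕ) : ℝ) ≤ (a ! : ℕ) := by exact_mod_cast h1
    exact absurd (ha.1.trans_lt hb.2) (not_lt.2 h2)
  exact le_antisymm (key hi hj) (key hj hi)

lemma exists_mem_factInterval {x : ℝ} (hx : 1 ≤ x) : ∃ j, x ∈ factInterval j := by
  have hex : ∃ n : ℕ, x < (n ! : ℝ) := by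
    obtain ⟨n, hn⟩ := exists_nat_gt x
    exact ⟨n, hn.trans_le (by exact_mod_cast Nat.self_le_factorial n)⟩
  classical
  have h1 := Nat.find_spec hex
  obtain ⟨j, hj⟩ : ∃ j, Nat.find hex = j + 1 := Nat.exists_eq_succ_of_ne_zero fun h => by
    rw [h] at h1
    simp at h1
    linarith
  refine ⟨j, not_lt.1 (Nat.find_min hex (m := j) (by omega)), ?_⟩
  rwa [hj] at h1

/-- The union of the intervals of type `k + 1`. -/
def typeSet (k : ℕ) : Set ℝ := ⋃ j ∈ {j | intervalType j = k + 1}, factInterval j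

lemma measurableSet_typeSet (k : ℕ) : MeasurableSet (typeSet k) :=
  MeasurableSet.biUnion (Set.to_countable _) fun _ _ => measurableSet_Ico

lemma typeSet_inter (k : ℕ) {j : ℕ} {a b : ℝ} (h : Set.Ico a b ⊆ factInterval j) :
    typeSet k ∩ Set.Ico a b = if intervalType j = k + 1 then Set.Ico a b else ∅ := by
  ext x
  constructor
  · rintro ⟨h1, h2⟩
    simp only [typeSet, Set.mem_iUnion] at h1
    obtain ⟨i, hi, hx⟩ := h1
    rw [if_pos]
    · exact h2
    · rwa [← factInterval_unique hx (h h2)]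
  · split_ifs with hj
    · exact fun hx => ⟨Set.mem_biUnion (show j ∈ {j | intervalType j = k + 1} from hj) (h hx), hx⟩
    · exact fun hx => absurd hx (Set.notMem_empty x)

/-- The integral over `[a, b)` of the function with the value `cₖ` on the intervals of type `k + 1`. -/
def mass (c : ℕ →₀ ℝ) (a b : ℝ) : ℝ := c.sum fun k r => r * volume.real (typeSet k ∩ Set.Ico a b)

/-- The sum of the coefficients. -/
def total (c : ℕ →₀ ℝ) : ℝ := c.sum fun _ r => r

lemma volume_inter_Ico_ne_top (s : Set ℝ) (a b : ℝ) : volume (s ∩ Set.Ico a b) ≠ ∞ :=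
  measure_ne_top_of_subset Set.inter_subset_right (by simp)

lemma mass_add_mass (c : ℕ →₀ ℝ) {a b b' : ℝ} (h : a ≤ b) (h' : b ≤ b') :
    mass c a b + mass c b b' = mass c a b' := by
  rw [mass, mass, mass, Finsupp.sum, Finsupp.sum, Finsupp.sum, ← Finset.sum_add_distrib]
  refine Finset.sum_congr rfl fun k _ => ?_
  rw [← mul_add, ← Set.Ico_union_Ico_eq_Ico h h', Set.inter_union_distrib_left,
    measureReal_union (Set.Ico_disjoint_Ico_same.mono Set.inter_subset_right Set.inter_subset_right)
      ((measurableSet_typeSet k).inter measurableSet_Ico) (volume_inter_Ico_ne_top _ _ _)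
      (volume_inter_Ico_ne_top _ _ _)]

lemma mass_nonneg {c : ℕ →₀ ℝ} (hc : ∀ k, 0 ≤ c k) (a b : ℝ) : 0 ≤ mass c a b :=
  Finset.sum_nonneg fun k _ => mul_nonneg (hc k) measureReal_nonneg

lemma mass_le {c : ℕ →₀ ℝ} (hc : ∀ k, 0 ≤ c k) {a b : ℝ} (h : a ≤ b) :
    mass c a b ≤ total c * (b - a) := by
  rw [mass, total, Finsupp.sum, Finsupp.sum, Finset.sum_mul]
  refine Finset.sum_le_sum fun k _ => mul_le_mul_of_nonneg_left ?_ (hc k)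
  refine (measureReal_mono Set.inter_subset_right (by simp)).trans_eq ?_
  rw [Real.volume_real_Ico_of_le h]

/-- The value on the `j`-th interval of the function with the value `cₖ` on the intervals of
type `k + 1`. -/
def valueOn (c : ℕ →₀ ℝ) (j : ℕ) : ℝ := if intervalType j = 0 then 0 else c (intervalType j - 1)

lemma mass_of_subset (c : ℕ →₀ ℝ) {j : ℕ} {a b : ℝ} (hab : a ≤ b) (h : Set.Ico a b ⊆ factInterval j) :
    mass c a b = valueOn c j * (b - a) := by
  have e : ∀ k, volume.real (typeSet k ∩ Set.Ico a b) =
      if intervalType j = k + 1 then b - a else 0 := fun k => by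
    rw [typeSet_inter k h]
    split_ifs
    · rw [Real.volume_real_Ico_of_le hab]
    · simp
  simp only [mass, e, mul_ite, mul_zero]
  rw [valueOn]
  rcases hj : intervalType j with _ | k
  · simp [Finsupp.sum]
  · simp only [Nat.add_right_cancel_iff, Nat.add_eq_zero_iff, one_ne_zero, and_false, if_false,
      Nat.add_sub_cancel]
    rw [Finsupp.sum, Finset.sum_ite_eq]
    split_ifs with h0
    · rfl
    · rw [Finsupp.notMem_support_iff.1 h0, zero_mul]

lemma mass_self (c : ℕ →₀ ℝ) (a : ℝ) : mass c a a = 0 := by simp [mass, Finsupp.sum]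

lemma valueOn_nonneg {c : ℕ →₀ ℝ} (hc : ∀ k, 0 ≤ c k) (j : ℕ) : 0 ≤ valueOn c j := by
  unfold valueOn; split_ifs <;> simp [hc]

lemma valueOn_even (c : ℕ →₀ ℝ) {j : ℕ} (hj : Even j) : valueOn c j = 0 :=
  if_pos (intervalType_even hj)

lemma factorial_succ_real (j : ℕ) : ((j + 1)! : ℝ) = (j + 1) * (j ! : ℝ) := by
  rw [Nat.factorial_succ]; push_cast; ring

/-- The function is one of those of the cone, with the coefficients `c`. -/
def HasCoeffs (ζ : ℝ≥0 → ℂ) (c : ℕ →₀ ℝ) : Prop :=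
  ∀ t : ℝ≥0, ζ t = ((total c * t : ℝ) : ℂ) + ((mass c 0 t : ℝ) : ℂ) * Complex.I

lemma HasCoeffs.incr_eq {ζ : ℝ≥0 → ℂ} {c : ℕ →₀ ℝ} (h : HasCoeffs ζ c) {τ s : ℝ} (hτ : 0 ≤ τ)
    (hs : 0 ≤ s) :
    incr ζ τ s = ((total c * s : ℝ) : ℂ) + ((mass c τ (τ + s) : ℝ) : ℂ) * Complex.I := by
  rw [incr, h, h, Real.coe_toNNReal _ hτ, Real.coe_toNNReal _ (add_nonneg hτ hs),
    ← mass_add_mass c hτ (le_add_of_nonneg_right hs)]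
  push_cast
  ring

/-- The real part is linear with slope `total c`, which gives the lower bound. The imaginary part
has slopes between `0` and `total c`. -/
lemma HasCoeffs.isBiLipschitz {ζ : ℝ≥0 → ℂ} {c : ℕ →₀ ℝ} (h : HasCoeffs ζ c) (hc : ∀ k, 0 ≤ c k)
    (hc0 : 0 < total c) : IsBiLipschitz ζ := by
  refine ⟨total c + total c, total c, by positivity, hc0, fun x y => ?_⟩
  wlog hxy : y ≤ x generalizing x y
  · rw [dist_comm, dist_comm (ζ x)]
    exact this y x (le_of_not_ge hxy)
  have hxy' : (y : ℝ) ≤ x := hxy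
  have h0 : 0 ≤ (x : ℝ) - y := sub_nonneg.2 hxy'
  have e : ζ x - ζ y = ((total c * ((x : ℝ) - y) : ℝ) : ℂ) + ((mass c y x : ℝ) : ℂ) * Complex.I := by
    rw [h x, h y, ← mass_add_mass c y.coe_nonneg hxy']
    push_cast
    ring
  rw [NNReal.dist_eq, dist_eq_norm, e, abs_of_nonneg h0]
  constructor
  · refine le_trans ?_ (Complex.re_le_norm _)
    simp
  · refine (norm_add_le _ _).trans ?_
    have h1 := mass_nonneg hc y x
    have h2 := mass_le hc hxy'
    rw [norm_mul, Complex.norm_I, mul_one, Complex.norm_real, Complex.norm_real,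
      Real.norm_of_nonneg (by positivity), Real.norm_of_nonneg h1, add_mul]
    linarith

/-! ### Comparison of increments -/

lemma mass_factorial_bounds {c : ℕ →₀ ℝ} (hc : ∀ k, 0 ≤ c k) (j : ℕ) :
    valueOn c j * ((j + 1)! - j !) ≤ mass c 0 ((j + 1)! : ℝ) ∧
      mass c 0 ((j + 1)! : ℝ) ≤ valueOn c j * ((j + 1)! - j !) + total c * j ! := by
  have h1 : (j ! : ℝ) ≤ (j + 1)! := by exact_mod_cast Nat.factorial_le (Nat.le_succ j)
  rw [← mass_add_mass c (Nat.cast_nonneg (j !)) h1,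
    mass_of_subset c h1 (show Set.Ico (j ! : ℝ) ((j + 1)! : ℝ) ⊆ factInterval j from subset_rfl)]
  have h2 := mass_nonneg hc 0 (j !)
  have h3 := mass_le hc (Nat.cast_nonneg (α := ℝ) (j !))
  constructor <;> linarith

/-- On a window that starts in the `l`-th interval and ends at most in the next one. -/
lemma mass_window (c : ℕ →₀ ℝ) {l : ℕ} {τ s : ℝ} (hτ : τ ∈ factInterval l) (hs : 0 ≤ s)
    (hs' : τ + s ≤ (l + 2)!) :
    mass c τ (τ + s) = valueOn c l * min s ((l + 1)! - τ) +
      valueOn c (l + 1) * max (s - ((l + 1)! - τ)) 0 := by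
  have h1 : τ ≤ (l + 1)! := hτ.2.le
  rcases le_total s ((l + 1)! - τ) with h | h
  · rw [min_eq_left h, max_eq_right (by linarith),
      mass_of_subset c (by linarith) (j := l) fun x hx => ⟨hτ.1.trans hx.1, hx.2.trans_le (by linarith)⟩]
    ring
  · rw [min_eq_right h, max_eq_left (by linarith), ← mass_add_mass c h1 (by linarith),
      mass_of_subset c h1 (j := l) fun x hx => ⟨hτ.1.trans hx.1, hx.2⟩,
      mass_of_subset c (by linarith) (j := l + 1) fun x hx => ⟨hx.1, hx.2.trans_le hs'⟩]
    ring

/-- After `(j + 1)!`, the average over a window of length `(j + 1)!` is at most the sum of those over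
the windows of the lengths `j!` and `(j + 2)!`. -/
lemma mass_average_le {c : ℕ →₀ ℝ} (hc : ∀ k, 0 ≤ c k) {j : ℕ} {τ : ℝ} (hτ : ((j + 1)! : ℝ) ≤ τ) :
    mass c τ (τ + (j + 1)!) / (j + 1)! ≤
      mass c τ (τ + j !) / j ! + mass c τ (τ + (j + 2)!) / (j + 2)! := by
  have hτ1 : 1 ≤ τ := le_trans (by exact_mod_cast Nat.succ_le_of_lt (Nat.factorial_pos _)) hτ
  obtain ⟨l, hl⟩ := exists_mem_factInterval hτ1
  have hjl : j + 1 ≤ l := by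
    by_contra! h
    have : ((l + 1)! : ℝ) ≤ (j + 1)! := by exact_mod_cast Nat.factorial_le (by omega)
    linarith [hl.2]
  have p0 : (0 : ℝ) < j ! := by exact_mod_cast Nat.factorial_pos _
  have p1 : (0 : ℝ) < (j + 1)! := by exact_mod_cast Nat.factorial_pos _
  have p2 : (0 : ℝ) < (j + 2)! := by exact_mod_cast Nat.factorial_pos _
  have m1 : (j ! : ℝ) ≤ (j + 1)! := by exact_mod_cast Nat.factorial_le (by omega)
  have m2 : ((j + 1)! : ℝ) ≤ (j + 2)! := by exact_mod_cast Nat.factorial_le (by omega)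
  have m3 : ((j + 2)! : ℝ) ≤ (l + 1)! := by exact_mod_cast Nat.factorial_le (by omega)
  -- Even the longest window meets only the intervals `l` and `l + 1`, one of which is even and
  -- carries no mass.
  have hw : τ + (j + 2)! ≤ (l + 2)! := by
    have h1 : ((l + 2)! : ℝ) = (l + 1 + 1) * (l + 1)! := by
      rw [factorial_succ_real (l + 1)]; push_cast; ring
    have h2 : (0 : ℝ) ≤ l := Nat.cast_nonneg l
    rw [h1]
    nlinarith [hl.2]
  have n0 := mass_nonneg hc τ (τ + j !)
  have n2 := mass_nonneg hc τ (τ + (j + 2)!)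
  have hq : (0 : ℝ) < (l + 1)! - τ := sub_pos.2 hl.2
  rcases Nat.even_or_odd l with he | ho
  -- The mass lies at the end of the window, so the average increases with the length: compare with
  -- the longest window.
  · refine le_trans ?_ (le_add_of_nonneg_left (by positivity))
    rw [mass_window c hl p1.le (by linarith), mass_window c hl p2.le hw, valueOn_even c he, zero_mul,
      zero_mul, zero_add, zero_add, mul_div_assoc, mul_div_assoc]
    refine mul_le_mul_of_nonneg_left ?_ (valueOn_nonneg hc _)
    rw [div_le_div_iff₀ p1 p2]
    rcases le_total ((j + 1)! - ((l + 1)! - τ)) 0 with h | h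
    · rw [max_eq_right h]
      have := le_max_right (((j + 2)! : ℝ) - ((l + 1)! - τ)) 0
      nlinarith
    · rw [max_eq_left h, max_eq_left (by linarith)]
      nlinarith
  -- The mass lies at the beginning, so the average decreases with the length: compare with the
  -- shortest window.
  · refine le_trans ?_ (le_add_of_nonneg_right (by positivity))
    rw [mass_window c hl p1.le (by linarith), mass_window c hl p0.le (by linarith),
      valueOn_even c ho.add_one, zero_mul, zero_mul, add_zero, add_zero, mul_div_assoc, mul_div_assoc]
    refine mul_le_mul_of_nonneg_left ?_ (valueOn_nonneg hc _)
    rw [div_le_div_iff₀ p1 p0]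
    rcases le_total (j ! : ℝ) ((l + 1)! - τ) with h | h
    · rw [min_eq_left h]
      have := min_le_left ((j + 1)! : ℝ) ((l + 1)! - τ)
      nlinarith
    · rw [min_eq_right h, min_eq_right (by linarith)]
      nlinarith

/-- The average over a window of length `(j + 1)!` that starts before `(j + 1)!`. -/
lemma mass_average_le_valueOn {c : ℕ →₀ ℝ} (hc : ∀ k, 0 ≤ c k) {j : ℕ} (hj : Odd j) {τ : ℝ}
    (hτ0 : 0 ≤ τ) (hτ : τ ≤ (j + 1)!) :
    mass c τ (τ + (j + 1)!) / (j + 1)! ≤ valueOn c j + total c / j := by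
  have p0 : (0 : ℝ) < j ! := by exact_mod_cast Nat.factorial_pos _
  have p1 : (0 : ℝ) < (j + 1)! := by exact_mod_cast Nat.factorial_pos _
  have m1 : (j ! : ℝ) ≤ (j + 1)! := by exact_mod_cast Nat.factorial_le (by omega)
  have hj1 : (1 : ℝ) ≤ j := by exact_mod_cast hj.pos
  have hT : 0 ≤ total c := Finset.sum_nonneg fun k _ => hc k
  have h2 : ((j + 1 + 1)! : ℝ) = (j + 1 + 1) * (j + 1)! := by
    rw [factorial_succ_real (j + 1)]; push_cast; ring
  have m2 : τ + (j + 1)! ≤ ((j + 1 + 1)! : ℝ) := by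
    rw [h2]; nlinarith
  -- The window ends before `(j + 2)!` and the interval `j + 1` is even, so the mass comes from `[0,
  -- j!)` and from the interval `j`.
  have hb : mass c τ (τ + (j + 1)!) ≤ total c * j ! + valueOn c j * (j + 1)! := by
    have h3 : mass c 0 τ + mass c τ (τ + (j + 1)!) + mass c (τ + (j + 1)!) ((j + 1 + 1)!) =
        mass c 0 (j !) + mass c (j !) ((j + 1)!) + mass c ((j + 1)!) ((j + 1 + 1)!) := by
      rw [mass_add_mass c hτ0 (by linarith), mass_add_mass c (by linarith) m2,
        mass_add_mass c p0.le m1, mass_add_mass c p1.le (by linarith)]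
    rw [mass_of_subset c m1 (j := j) subset_rfl,
      mass_of_subset c (by linarith) (j := j + 1) subset_rfl, valueOn_even c hj.add_one] at h3
    have h4 := mass_le hc p0.le
    have h5 := mass_nonneg hc 0 τ
    have h6 := mass_nonneg hc (τ + (j + 1)!) ((j + 1 + 1)!)
    have h7 := mul_nonneg (valueOn_nonneg hc j) p0.le
    linarith
  rw [div_le_iff₀ p1, add_mul]
  refine hb.trans ?_
  rw [add_comm]
  refine add_le_add_right ?_ _
  rw [div_mul_eq_mul_div, le_div_iff₀ (by linarith), factorial_succ_real]
  nlinarith [mul_nonneg hT p0.le]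

end

section

open MeasureTheory
open scoped Nat

/-! ### Absence of embeddings -/

/-- The `vᵢ` are averages for `φ` over `[0, sᵢ)` and the `uᵢ` are averages for `ψ` after `τ`, with
`x = 1 / j`. The real part and `v₀ ≈ 0` give `u₀ ≈ 0`, then the imaginary part gives `C u₁ ≈ κ D p`.
For `κ = -1` this contradicts `u₁ ≥ 0`. For `κ = 1` also `u₂ ≈ 0`, so both upper bounds for `u₁` are
too small. -/
lemma false_of_averages {C D K p q κ x u₀ u₁ u₂ v₀ v₁ v₂ : ℝ} (hC : 0 < C) (hD : 0 < D) (hK : 0 < K)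
    (hp : 0 < p) (hx : 0 < x) (hx2 : x ≤ 1 / 2)
    (hu₀ : 0 ≤ u₀) (hu₁ : u₁ ≤ D) (hu₁' : 0 ≤ u₁) (hv₀ : 0 ≤ v₀) (hv₀' : v₀ ≤ C * x) (hv₂' : v₂ ≤ C * x)
    (hv₁ : p * (1 - x) ≤ v₁)
    (hre : |v₀ * u₁ - v₁ * u₀| ≤ K * x)
    (him₁ : |C * u₁ + κ * D * v₀ - C * u₀ - κ * D * v₁| ≤ K * x)
    (him₂ : |C * u₂ + κ * D * v₀ - C * u₀ - κ * D * v₂| ≤ K * x)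
    (hsmall : (D * p ^ 2 + 4 * C * (K + C * D) + 2 * p * (D * C + K)) * x < D * p ^ 2)
    (hκ : κ = -1 ∨ κ = 1 ∧ (D * p + 2 * C * D + K) * x < D * p - C * q ∧
      (u₁ ≤ q + D * x ∨ u₁ ≤ u₀ + u₂)) : False := by
  have a1 := abs_le.1 hre
  have a2 := abs_le.1 him₁
  have a3 := abs_le.1 him₂
  have b1 : v₀ * u₁ ≤ C * x * D := by
    calc v₀ * u₁ ≤ v₀ * D := mul_le_mul_of_nonneg_left hu₁ hv₀
      _ ≤ C * x * D := mul_le_mul_of_nonneg_right hv₀' hD.le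
  have b2 : p * (1 - x) * u₀ ≤ v₁ * u₀ := mul_le_mul_of_nonneg_right hv₁ hu₀
  have b3 : p * u₀ * (1 / 2) ≤ p * u₀ * (1 - x) :=
    mul_le_mul_of_nonneg_left (by linarith) (by positivity)
  have b4 : p * u₀ ≤ 2 * (K + C * D) * x := by linarith
  have b5 : C * (p * u₀) ≤ C * (2 * (K + C * D) * x) := mul_le_mul_of_nonneg_left b4 hC.le
  have b6 : D * (p * (1 - x)) ≤ D * v₁ := mul_le_mul_of_nonneg_left hv₁ hD.le
  have b7 : D * v₀ ≤ D * (C * x) := mul_le_mul_of_nonneg_left hv₀' hD.le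
  have b8 : D * v₂ ≤ D * (C * x) := mul_le_mul_of_nonneg_left hv₂' hD.le
  have b9 : 0 ≤ D * v₀ := by positivity
  have b10 : 0 ≤ p * (D * C + K) * x := by positivity
  have b11 : 0 ≤ C * (K + C * D) * x := by positivity
  rcases hκ with rfl | ⟨rfl, h1, h2⟩
  · have c1 : D * (p * (1 - x)) ≤ C * u₀ + (D * C + K) * x := by
      have : 0 ≤ C * u₁ := by positivity
      linarith
    have c2 := mul_le_mul_of_nonneg_left c1 hp.le
    nlinarith
  · have c0 : 0 ≤ C * u₀ := by positivity
    have c1 : D * (p * (1 - x)) ≤ C * u₁ + (D * C + K) * x := by linarith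
    rcases h2 with h2 | h2
    · have c2 := mul_le_mul_of_nonneg_left h2 hC.le
      nlinarith
    · have c2 := mul_le_mul_of_nonneg_left h2 hC.le
      have c3 : C * u₂ ≤ C * u₀ + (D * C + K) * x := by linarith
      have c4 : D * (p * (1 - x)) ≤ 2 * (C * u₀) + 2 * ((D * C + K) * x) := by linarith
      have c5 := mul_le_mul_of_nonneg_left c4 hp.le
      nlinarith

/-- The products of the linear real parts cancel. What remains, divided by `s s'`, are relations
between averages with error `K / s`. -/
lemma re_im_le_of_norm_le {C D K κ s s' V V' U U' : ℝ} (hκ : |κ| = 1) (hs : 0 < s) (hs' : 0 < s')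
    (h : ‖(((C * s : ℝ) : ℂ) + ((κ * V : ℝ) : ℂ) * Complex.I) *
        (((D * s' : ℝ) : ℂ) + ((U' : ℝ) : ℂ) * Complex.I) -
      (((C * s' : ℝ) : ℂ) + ((κ * V' : ℝ) : ℂ) * Complex.I) *
        (((D * s : ℝ) : ℂ) + ((U : ℝ) : ℂ) * Complex.I)‖ ≤ K * s') :
    |V / s * (U' / s') - V' / s' * (U / s)| ≤ K / s ∧
      |C * (U' / s') + κ * D * (V / s) - C * (U / s) - κ * D * (V' / s')| ≤ K / s := by
  have h1 := (Complex.abs_re_le_norm _).trans h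
  have h2 := (Complex.abs_im_le_norm _).trans h
  simp only [Complex.sub_re, Complex.mul_re, Complex.add_re, Complex.ofReal_re, Complex.I_re,
    Complex.ofReal_im, Complex.I_im, Complex.add_im, Complex.mul_im, Complex.sub_im] at h1 h2
  constructor
  · have e : V / s * (U' / s') - V' / s' * (U / s) = (V * U' - V' * U) / (s * s') := by
      field_simp
    rw [e, abs_div, abs_of_pos (mul_pos hs hs'), div_le_div_iff₀ (mul_pos hs hs') hs]
    have e2 : |V * U' - V' * U| = |κ * (V * U' - V' * U)| := by rw [abs_mul, hκ, one_mul]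
    rw [e2]
    calc _ ≤ K * s' * s := by
          refine mul_le_mul_of_nonneg_right (le_trans (le_of_eq ?_) h1) hs.le
          rw [← abs_neg]
          congr 1
          ring
      _ = _ := by ring
  · have e : C * (U' / s') + κ * D * (V / s) - C * (U / s) - κ * D * (V' / s') =
        (C * s * U' + κ * V * (D * s') - (C * s' * U + κ * V' * (D * s))) / (s * s') := by
      field_simp
      ring
    rw [e, abs_div, abs_of_pos (mul_pos hs hs'), div_le_div_iff₀ (mul_pos hs hs') hs]
    calc _ ≤ K * s' * s := by
          refine mul_le_mul_of_nonneg_right (le_trans (le_of_eq ?_) h2) hs.le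
          congr 1
          ring
      _ = _ := by ring

/-- `κ = 1` stands for linear maps and `κ = -1` for conjugate-linear ones. In the latter case no
comparison of `c` and `d` is needed. -/
lemma not_isEmbedding {ζ η : LipZero} {c d : ℕ →₀ ℝ} (hζ : HasCoeffs ζ c) (hη : HasCoeffs η d)
    (hc : ∀ k, 0 ≤ c k) (hd : ∀ k, 0 ≤ d k) (hC : 0 < total c) (hD : 0 < total d)
    {σ : ℂ →+* ℂ} {κ : ℝ} (hσ : ∀ a b : ℝ, σ (a + b * Complex.I) = a + ((κ * b : ℝ) : ℂ) * Complex.I)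
    {k : ℕ} (hk : κ = -1 ∧ 0 < c k ∨ κ = 1 ∧ total c * d k < total d * c k) (T : Z ζ →SL[σ] Z η) :
    ¬ IsEmbedding T := by
  intro hT
  have hκ : |κ| = 1 := by rcases hk with ⟨rfl, _⟩ | ⟨rfl, _⟩ <;> simp
  have hp : 0 < c k := by
    rcases hk with h | ⟨_, h⟩
    · exact h.2
    · exact pos_of_mul_pos_right ((mul_nonneg hC.le (hd k)).trans_lt h) hD.le
  have hnorm : ∀ z, ‖σ z‖ = ‖z‖ := fun z => by
    have hκ2 : κ * κ = 1 := by rcases hk with ⟨rfl, _⟩ | ⟨rfl, _⟩ <;> norm_num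
    nth_rewrite 1 [← Complex.re_add_im z]
    rw [hσ, ← sq_eq_sq₀ (norm_nonneg _) (norm_nonneg _), ← Complex.normSq_eq_norm_sq,
      ← Complex.normSq_eq_norm_sq, Complex.normSq_add_mul_I, Complex.normSq_apply]
    linear_combination z.im ^ 2 * hκ2
  obtain ⟨K, s₀, hK, hs₀, h⟩ := exists_incr_of_isEmbedding (hζ.isBiLipschitz hc hC)
    (hη.isBiLipschitz hd hD) hnorm T hT
  set C := total c
  set D := total d
  have hev : ∀ A δ : ℝ, 0 < δ → ∀ᶠ j : ℕ in atTop, A * (1 / (j : ℝ)) < δ := fun A δ hδ => by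
    have := (tendsto_one_div_atTop_nhds_zero_nat (𝕜 := ℝ)).const_mul A
    rw [mul_zero] at this
    exact this.eventually (gt_mem_nhds hδ)
  obtain ⟨n, hn⟩ := eventually_atTop.1 <|
    (hev (D * c k ^ 2 + 4 * C * (K + C * D) + 2 * c k * (D * C + K)) (D * c k ^ 2)
      (by positivity)).and <|
    (hev (D * c k + 2 * C * D + K) (if C * d k < D * c k then D * c k - C * d k else 1)
      (by split_ifs with h0 <;> linarith)).and <|
    ((tendsto_natCast_atTop_atTop (R := ℝ)).eventually (eventually_ge_atTop s₀)).and <|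
    eventually_ge_atTop 2
  obtain ⟨j, hj, hodd, htype⟩ := exists_intervalType_eq k n
  obtain ⟨hsmall, hsmall', hjs, hj2⟩ := hn j hj
  have hj2' : (2 : ℝ) ≤ j := by exact_mod_cast hj2
  have hx : (0 : ℝ) < 1 / j := by positivity
  have p0 : (0 : ℝ) < j ! := by exact_mod_cast Nat.factorial_pos _
  have p1 : (0 : ℝ) < (j + 1)! := by exact_mod_cast Nat.factorial_pos _
  have p2 : (0 : ℝ) < (j + 2)! := by exact_mod_cast Nat.factorial_pos _
  have m1 : (j ! : ℝ) ≤ (j + 1)! := by exact_mod_cast Nat.factorial_le (by omega)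
  have m2 : (j ! : ℝ) ≤ (j + 2)! := by exact_mod_cast Nat.factorial_le (by omega)
  have mj : (j : ℝ) ≤ j ! := by exact_mod_cast Nat.self_le_factorial j
  have hKs : K / (j ! : ℝ) ≤ K * (1 / j) := by
    rw [mul_one_div]
    exact div_le_div_of_nonneg_left hK.le (by positivity) mj
  have hval : valueOn c j = c k := by rw [valueOn, htype]; simp
  have hval' : valueOn d j = d k := by rw [valueOn, htype]; simp
  obtain ⟨τ, hτ, hb⟩ := h ![(j ! : ℝ), ((j + 1)! : ℝ), ((j + 2)! : ℝ)] (hjs.trans mj) (by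
    intro i
    fin_cases i
    · exact le_rfl
    · exact m1
    · exact m2)
  have key : ∀ s : ℝ, 0 < s → ‖σ (incr ζ 0 (j !)) * incr η τ s - σ (incr ζ 0 s) * incr η τ (j !)‖ ≤
      K * s → _ := fun s hs hb' => by
    rw [hζ.incr_eq le_rfl p0.le, hζ.incr_eq le_rfl hs.le, hη.incr_eq hτ p0.le, hη.incr_eq hτ hs.le,
      hσ, hσ, zero_add, zero_add] at hb'
    exact re_im_le_of_norm_le hκ p0 hs hb'
  have k1 := key _ p1 (hb 1)
  have k2 := key _ p2 (hb 2)
  have w : ∀ s : ℝ, 0 < s → mass d τ (τ + s) / s ≤ D := fun s hs => by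
    rw [div_le_iff₀ hs]
    simpa using mass_le hd (show τ ≤ τ + s by linarith)
  have f1 := factorial_succ_real j
  have f2 := factorial_succ_real (j + 1)
  -- As `j` is odd, the intervals `j - 1` and `j + 1` carry no mass. Up to `j!` and `(j + 2)!` all
  -- mass therefore lies before `(j - 1)!` and `(j + 1)!`, a fraction of at most `1 / j`.
  have t0 : mass c 0 (j ! : ℝ) / (j ! : ℝ) ≤ C * (1 / j) := by
    obtain ⟨i, rfl⟩ : ∃ i, j = i + 1 := ⟨j - 1, by omega⟩
    have h1 := (mass_factorial_bounds hc i).2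
    have hi : Even i := by
      rcases Nat.even_or_odd i with h | h
      · exact h
      · exact absurd h.add_one (Nat.not_even_iff_odd.2 hodd)
    rw [valueOn_even c hi, zero_mul, zero_add] at h1
    rw [div_le_iff₀ p0]
    refine h1.trans_eq ?_
    rw [factorial_succ_real i]
    push_cast
    field_simp
    rfl
  have t2 : mass c 0 ((j + 2)! : ℝ) / ((j + 2)! : ℝ) ≤ C * (1 / j) := by
    have h1 := (mass_factorial_bounds hc (j + 1)).2
    rw [valueOn_even c hodd.add_one, zero_mul, zero_add] at h1
    rw [div_le_iff₀ p2]
    refine h1.trans ?_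
    rw [f2, mul_assoc]
    refine mul_le_mul_of_nonneg_left ?_ hC.le
    rw [one_div_mul_eq_div, le_div_iff₀ (by positivity)]
    push_cast
    nlinarith
  have t1 : c k * (1 - 1 / j) ≤ mass c 0 ((j + 1)! : ℝ) / ((j + 1)! : ℝ) := by
    have h1 := (mass_factorial_bounds hc j).1
    rw [hval] at h1
    rw [le_div_iff₀ p1]
    refine le_trans ?_ h1
    rw [mul_assoc]
    refine mul_le_mul_of_nonneg_left ?_ hp.le
    rw [sub_mul, one_mul]
    refine sub_le_sub_left ?_ _
    rw [one_div_mul_eq_div, le_div_iff₀ (by positivity), f1]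
    nlinarith
  refine false_of_averages (q := d k) hC hD hK hp hx
    (by rw [div_le_div_iff₀ (by positivity) two_pos]; linarith)
    (div_nonneg (mass_nonneg hd _ _) p0.le) (w _ p1) (div_nonneg (mass_nonneg hd _ _) p1.le) (div_nonneg (mass_nonneg hc _ _) p0.le) t0 t2 t1
    (k1.1.trans hKs) (k1.2.trans hKs) (k2.2.trans hKs) hsmall ?_
  rcases hk with h | h
  · exact Or.inl h.1
  · refine Or.inr ⟨h.1, ?_, ?_⟩
    · rwa [if_pos h.2] at hsmall'
    · rcases le_total τ ((j + 1)! : ℝ) with h' | h'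
      · left
        have := mass_average_le_valueOn hd hodd hτ h'
        rwa [hval', div_eq_mul_one_div (total d)] at this
      · exact Or.inr (mass_average_le hd h')

end

/-! ### The cone -/

section Cone

open MeasureTheory
open scoped Nat

lemma total_add (c d : ℕ →₀ ℝ) : total (c + d) = total c + total d :=
  Finsupp.sum_add_index' (fun _ => rfl) fun _ _ _ => rfl

lemma total_smul (r : ℝ) (c : ℕ →₀ ℝ) : total (r • c) = r * total c := by
  rw [total, total, Finsupp.sum_smul_index' fun _ => rfl, Finsupp.mul_sum]
  rfl

lemma mass_add (c d : ℕ →₀ ℝ) (a b : ℝ) : mass (c + d) a b = mass c a b + mass d a b :=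
  Finsupp.sum_add_index' (fun _ => zero_mul _) fun _ _ _ => add_mul _ _ _

lemma mass_smul (r : ℝ) (c : ℕ →₀ ℝ) (a b : ℝ) : mass (r • c) a b = r * mass c a b := by
  rw [mass, mass, Finsupp.sum_smul_index' fun _ => zero_mul _, Finsupp.mul_sum]
  refine Finset.sum_congr rfl fun k _ => ?_
  exact mul_assoc _ _ _

lemma HasCoeffs.add {f g : ℝ≥0 → ℂ} {c d : ℕ →₀ ℝ} (hf : HasCoeffs f c) (hg : HasCoeffs g d) :
    HasCoeffs (f + g) (c + d) := fun t => by
  rw [Pi.add_apply, hf, hg, total_add, mass_add]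
  push_cast
  ring

lemma HasCoeffs.smul {f : ℝ≥0 → ℂ} {c : ℕ →₀ ℝ} (hf : HasCoeffs f c) (r : ℝ) :
    HasCoeffs ((r : ℂ) • f) (r • c) := fun t => by
  rw [Pi.smul_apply, hf, total_smul, mass_smul, smul_eq_mul]
  push_cast
  ring

lemma HasCoeffs.unique {f g : ℝ≥0 → ℂ} {c : ℕ →₀ ℝ} (hf : HasCoeffs f c) (hg : HasCoeffs g c) :
    f = g := funext fun t => (hf t).trans (hg t).symm

/-- The value on the `j`-th interval of the `k`-th generator. -/
lemma valueOn_single (k j : ℕ) :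
    valueOn (Finsupp.single k 1) j = if intervalType j = k + 1 then 1 else 0 := by
  rw [valueOn, Finsupp.single_apply]
  split_ifs <;> first | rfl | omega

/-- The generators of the cone. -/
def generator (k : ℕ) : LipZero :=
  ⟨fun t => ((total (Finsupp.single k 1) * t : ℝ) : ℂ) +
    ((mass (Finsupp.single k 1) 0 t : ℝ) : ℂ) * Complex.I, by
    refine ⟨by simp [mass_self], ?_⟩
    have h : HasCoeffs (fun t => ((total (Finsupp.single k 1) * t : ℝ) : ℂ) +
      ((mass (Finsupp.single k 1) 0 t : ℝ) : ℂ) * Complex.I) (Finsupp.single k 1) := fun _ => rfl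
    obtain ⟨a, b, ha, -, hab⟩ := h.isBiLipschitz (fun i => by
      rw [Finsupp.single_apply]; split_ifs <;> norm_num) (by simp [total])
    exact ⟨⟨a, ha⟩, LipschitzWith.of_dist_le_mul fun x y => (hab x y).2⟩⟩

lemma hasCoeffs_generator (k : ℕ) : HasCoeffs (generator k) (Finsupp.single k 1) := fun _ => rfl

/-- On an even interval all generators have slope `1`, so the coefficients of a relation sum to `0`.
On an interval of type `i + 1` only the `i`-th slope has an imaginary part, which isolates its
coefficient. -/
lemma linearIndependent_generator : LinearIndependent ℂ generator := by
  rw [linearIndependent_iff']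
  intro s g hg i hi
  have h : ∀ j : ℕ, 0 < j → ∑ k ∈ s, g k *
      (1 + ((valueOn (Finsupp.single k 1) j : ℝ) : ℂ) * Complex.I) = 0 := by
    intro j hj
    have e : ∀ t : ℝ≥0, ∑ k ∈ s, g k * (generator k : ℝ≥0 → ℂ) t = 0 := fun t => by
      have := congrArg (fun f : LipZero => (f : ℝ≥0 → ℂ) t) hg
      simpa using this
    have hlt : (j ! : ℝ) < (j + 1)! := by
      exact_mod_cast (Nat.factorial_lt hj).2 (Nat.lt_succ_self j)
    have e' := congrArg₂ (· - ·) (e (((j + 1)! : ℕ) : ℝ≥0)) (e ((j ! : ℕ) : ℝ≥0))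
    rw [sub_zero, ← Finset.sum_sub_distrib] at e'
    have hne : (((j + 1)! - j ! : ℝ) : ℂ) ≠ 0 := by
      exact_mod_cast (sub_pos.2 hlt).ne'
    refine (mul_eq_zero.1 ?_).resolve_left hne
    rw [Finset.mul_sum, ← e']
    refine Finset.sum_congr rfl fun k _ => ?_
    rw [hasCoeffs_generator, hasCoeffs_generator, NNReal.coe_natCast, NNReal.coe_natCast,
      ← mass_add_mass _ (Nat.cast_nonneg (j !)) hlt.le, mass_of_subset _ hlt.le (j := j) subset_rfl,
      show total (Finsupp.single k 1) = 1 by simp [total]]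
    push_cast
    ring
  obtain ⟨j, hj1, -, hj⟩ := exists_intervalType_eq i 1
  have h0 := h 2 two_pos
  have h1 := h j hj1
  simp only [valueOn_single, hj, intervalType_even even_two, Nat.add_right_cancel_iff, mul_add,
    mul_one, Finset.sum_add_distrib] at h0 h1
  simp at h0
  rw [h0, zero_add, Finset.sum_eq_single i (fun k _ hk => by simp [hk.symm]) (absurd hi)] at h1
  simpa using h1

lemma exists_hasCoeffs {ζ : LipZero} (hζ : ζ ∈ ConvexCone.hull ℝ (Set.range generator)) :
    ∃ c : ℕ →₀ ℝ, (∀ k, 0 ≤ c k) ∧ 0 < total c ∧ HasCoeffs ζ c := by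
  let S : ConvexCone ℝ LipZero :=
    { carrier := {ζ | ∃ c : ℕ →₀ ℝ, (∀ k, 0 ≤ c k) ∧ 0 < total c ∧ HasCoeffs ζ c}
      smul_mem' := by
        rintro r hr x ⟨c, h0, h1, h2⟩
        exact ⟨r • c, fun k => mul_nonneg hr.le (h0 k), by rw [total_smul]; positivity, h2.smul r⟩
      add_mem' := by
        rintro x ⟨c, h0, h1, h2⟩ y ⟨d, h0', h1', h2'⟩
        exact ⟨c + d, fun k => add_nonneg (h0 k) (h0' k), by rw [total_add]; positivity, h2.add h2'⟩ }
  have h : Set.range generator ⊆ S := by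
    rintro _ ⟨k, rfl⟩
    exact ⟨Finsupp.single k 1, fun i => by rw [Finsupp.single_apply]; split_ifs <;> norm_num,
      by simp [total], hasCoeffs_generator k⟩
  exact ConvexCone.hull_min h hζ

/-- Both sides have the same sum over `k`, so if no strict inequality of this direction occurred,
all would be equalities and the coefficients proportional. -/
lemma exists_mul_lt_mul {ζ₁ ζ₂ : LipZero} {c d : ℕ →₀ ℝ} (h₁ : HasCoeffs ζ₁ c) (h₂ : HasCoeffs ζ₂ d)
    (hd : 0 < total d) (h : ∀ a : ℂ, ζ₁ ≠ a • ζ₂) : ∃ k, total c * d k < total d * c k := by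
  by_contra! hk
  have e : total d • c = total c • d := by
    have hsum : total (total c • d - total d • c) = 0 := by
      have := total_add (total c • d - total d • c) (total d • c)
      rw [sub_add_cancel, total_smul, total_smul] at this
      linarith
    have hz := (Finset.sum_eq_zero_iff_of_nonneg fun k _ => by simpa using hk k).1 hsum
    ext k
    by_contra hne
    have hk0 : (total c • d - total d • c) k ≠ 0 := by
      rw [Finsupp.sub_apply]; exact sub_ne_zero.2 (Ne.symm hne)
    exact hk0 (hz k (Finsupp.mem_support_iff.2 hk0))
  have e' : c = (total c / total d) • d := by
    rw [div_eq_inv_mul, mul_smul, ← e, smul_smul, inv_mul_cancel₀ hd.ne', one_smul]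
  refine h ((total c / total d : ℝ) : ℂ) (Subtype.ext ?_)
  rw [e'] at h₁
  exact h₁.unique (h₂.smul _)

lemma exists_pos_of_total_pos {c : ℕ →₀ ℝ} (h : 0 < total c) : ∃ k, 0 < c k := by
  obtain ⟨k, -, hk⟩ := Finset.exists_lt_of_sum_lt (s := c.support) (f := fun _ => (0 : ℝ)) (g := c)
    (by rw [Finset.sum_const_zero]; exact h)
  exact ⟨k, hk⟩

/-- Composing with the linear isomorphism onto the dual would give a conjugate-linear isomorphism of
`Z(ζ)` onto itself. -/
lemma not_isoConjDual {ζ : LipZero} {c : ℕ →₀ ℝ} (h : HasCoeffs ζ c) (hc : ∀ k, 0 ≤ c k)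
    (hc0 : 0 < total c) : ¬ IsoConjDual (Z ζ) := by
  rintro ⟨e⟩
  obtain ⟨e'⟩ := isoDual_Z ζ
  obtain ⟨k, hk⟩ := exists_pos_of_total_pos hc0
  let T : Z ζ →SL[starRingEnd ℂ] Z ζ :=
    (e'.symm : StrongDual ℂ (Z ζ) →L[ℂ] Z ζ).comp (e : Z ζ →SL[starRingEnd ℂ] StrongDual ℂ (Z ζ))
  refine not_isEmbedding h h hc hc hc0 hc0 (κ := -1) (fun a b => ?_) (Or.inl ⟨rfl, hk⟩) T ?_
  · simp
  · exact e'.symm.toHomeomorph.isEmbedding.comp e.toHomeomorph.isEmbedding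

lemma incomparable_of_hasCoeffs {ζ₁ ζ₂ : LipZero} {c d : ℕ →₀ ℝ} (h₁ : HasCoeffs ζ₁ c)
    (h₂ : HasCoeffs ζ₂ d) (hc : ∀ k, 0 ≤ c k) (hd : ∀ k, 0 ≤ d k) (hc0 : 0 < total c)
    (hd0 : 0 < total d) (h : ∀ a : ℂ, ζ₁ ≠ a • ζ₂) : Incomparable (Z ζ₁) (Z ζ₂) := by
  have hσ : ∀ a b : ℝ, RingHom.id ℂ (a + b * Complex.I) = a + (((1 : ℝ) * b : ℝ) : ℂ) * Complex.I :=
    fun a b => by simp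
  have h' : ∀ a : ℂ, ζ₂ ≠ a • ζ₁ := by
    rintro a rfl
    rcases eq_or_ne a 0 with rfl | ha
    · have := h₂ 1
      have := congrArg Complex.re this
      simp at this
      linarith
    · exact h a⁻¹ (by rw [smul_smul, inv_mul_cancel₀ ha, one_smul])
  obtain ⟨k, hk⟩ := exists_mul_lt_mul h₁ h₂ hd0 h
  obtain ⟨l, hl⟩ := exists_mul_lt_mul h₂ h₁ hc0 h'
  exact ⟨fun ⟨T, hT⟩ => not_isEmbedding h₁ h₂ hc hd hc0 hd0 hσ (Or.inr ⟨rfl, hk⟩) T hT,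
    fun ⟨T, hT⟩ => not_isEmbedding h₂ h₁ hd hc hd0 hc0 hσ (Or.inr ⟨rfl, hl⟩) T hT⟩

end Cone

/-! ### Sequence spaces given by test sequences -/

/-- The norm `x ↦ sup_w ∑ₙ |xₙ| wₙ`, where `w` ranges over `W`. -/
def testNorm (W : Set (ℕ →₀ ℝ≥0)) (x : ℕ → ℂ) : ℝ≥0∞ :=
  ⨆ w ∈ W, ∑ n ∈ w.support, ‖x n‖ₑ * w n

section TestNorm

variable {W : Set (ℕ →₀ ℝ≥0)}

lemma sum_le_testNorm {w : ℕ →₀ ℝ≥0} (hw : w ∈ W) (x : ℕ → ℂ) :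
    ∑ n ∈ w.support, ‖x n‖ₑ * w n ≤ testNorm W x :=
  le_iSup₂_of_le w hw le_rfl

lemma testNorm_le {x : ℕ → ℂ} {M : ℝ≥0∞} (h : ∀ w ∈ W, ∑ n ∈ w.support, ‖x n‖ₑ * w n ≤ M) :
    testNorm W x ≤ M :=
  iSup₂_le h

lemma enorm_mul_le_testNorm {w : ℕ →₀ ℝ≥0} (hw : w ∈ W) (x : ℕ → ℂ) (n : ℕ) :
    ‖x n‖ₑ * w n ≤ testNorm W x := by
  by_cases h : n ∈ w.support
  · exact (Finset.single_le_sum (f := fun n => ‖x n‖ₑ * (w n : ℝ≥0∞)) (fun _ _ => zero_le) h).trans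
      (sum_le_testNorm hw x)
  · simp [Finsupp.notMem_support_iff.1 h]

lemma testNorm_smul (c : ℂ) (x : ℕ → ℂ) : testNorm W (c • x) = ‖c‖ₑ * testNorm W x := by
  simp only [testNorm, ENNReal.mul_iSup, Finset.mul_sum, Pi.smul_apply, enorm_smul, mul_assoc]

lemma testNorm_add_le (x y : ℕ → ℂ) : testNorm W (x + y) ≤ testNorm W x + testNorm W y := by
  refine testNorm_le fun w hw => ?_
  refine le_trans ?_ (add_le_add (sum_le_testNorm hw x) (sum_le_testNorm hw y))
  rw [← Finset.sum_add_distrib]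
  refine Finset.sum_le_sum fun n _ => ?_
  rw [← add_mul]
  gcongr
  exact enorm_add_le _ _

lemma testNorm_mono {x y : ℕ → ℂ} (h : ∀ n, ‖x n‖ ≤ ‖y n‖) : testNorm W x ≤ testNorm W y := by
  refine testNorm_le fun w hw => le_trans ?_ (sum_le_testNorm hw y)
  gcongr with n _
  exact enorm_le_iff_norm_le.2 (h n)

lemma testNorm_sub_comm (x y : ℕ → ℂ) : testNorm W (x - y) = testNorm W (y - x) :=
  le_antisymm (testNorm_mono fun n => (norm_sub_rev (x n) (y n)).le)
    (testNorm_mono fun n => (norm_sub_rev (y n) (x n)).le)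

/-- A Cauchy sequence converges in each coordinate. Every test involves finitely many coordinates,
so the Cauchy bounds pass to the limit test by test. -/
lemma testNorm_complete (hW : ∀ n, ∃ w ∈ W, w n ≠ 0) (u : ℕ → ℕ → ℂ) (hu : ∀ k, testNorm W (u k) < ∞)
    (hc : ∀ ε : ℝ≥0∞, 0 < ε → ∃ N, ∀ k l, N ≤ k → N ≤ l → testNorm W (u k - u l) ≤ ε) :
    ∃ x, testNorm W x < ∞ ∧ Tendsto (fun k => testNorm W (u k - x)) atTop (𝓝 0) := by
  have hcoord : ∀ n, ∃ a, Tendsto (fun k => u k n) atTop (𝓝 a) := fun n => by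
    obtain ⟨w, hw, hn⟩ := hW n
    refine cauchySeq_tendsto_of_complete (EMetric.cauchySeq_iff.2 fun ε hε => ?_)
    have hn' : (w n : ℝ≥0∞) ≠ 0 := by simpa using hn
    obtain ⟨δ, hδ0, hδ⟩ := exists_between (ENNReal.mul_pos hε.ne' hn')
    obtain ⟨N, hN⟩ := hc δ hδ0
    refine ⟨N, fun k hk l hl => ?_⟩
    have h1 := ((enorm_mul_le_testNorm hw (u k - u l) n).trans (hN k l hk hl)).trans_lt hδ
    rw [edist_eq_enorm_sub]
    exact lt_of_mul_lt_mul_right' h1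
  choose x hx using hcoord
  have hlim : ∀ ε : ℝ≥0∞, 0 < ε → ∃ N, ∀ k, N ≤ k → testNorm W (u k - x) ≤ ε := fun ε hε => by
    obtain ⟨N, hN⟩ := hc ε hε
    refine ⟨N, fun k hk => testNorm_le fun w hw => ?_⟩
    have ht : Tendsto (fun l => ∑ n ∈ w.support, ‖u k n - u l n‖ₑ * (w n : ℝ≥0∞)) atTop
        (𝓝 (∑ n ∈ w.support, ‖u k n - x n‖ₑ * (w n : ℝ≥0∞))) := by
      refine tendsto_finsetSum _ fun n _ => ENNReal.Tendsto.mul_const ?_ (Or.inr ENNReal.coe_ne_top)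
      exact (tendsto_const_nhds.sub (hx n)).enorm
    refine le_of_tendsto ht ?_
    filter_upwards [eventually_ge_atTop N] with l hl
    exact (sum_le_testNorm hw (u k - u l)).trans (hN k l hk hl)
  refine ⟨x, ?_, ?_⟩
  · obtain ⟨N, hN⟩ := hlim 1 one_pos
    have h1 := testNorm_add_le (W := W) (x - u N) (u N)
    rw [sub_add_cancel, testNorm_sub_comm] at h1
    exact h1.trans_lt (ENNReal.add_lt_top.2 ⟨(hN N le_rfl).trans_lt ENNReal.one_lt_top, hu N⟩)
  · rw [ENNReal.tendsto_atTop_zero]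
    exact fun ε hε => hlim ε hε

/-- The Banach sequence space with the norm `testNorm W`. -/
def ofTests (W : Set (ℕ →₀ ℝ≥0)) (hW : ∀ n, ∃ w ∈ W, w n ≠ 0) (hW' : ∀ n, ∃ R : ℝ≥0, ∀ w ∈ W, w n ≤ R) :
    BanachSeqSpace where
  nrm := testNorm W
  eq_zero_iff x := by
    constructor
    · intro h
      ext n
      obtain ⟨w, hw, hn⟩ := hW n
      have h1 := enorm_mul_le_testNorm hw x n
      rw [h, nonpos_iff_eq_zero, mul_eq_zero] at h1
      simpa [hn] using h1
    · rintro rfl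
      simp [testNorm]
  nrm_smul := testNorm_smul
  nrm_add_le := testNorm_add_le
  solid _ _ := testNorm_mono
  single_lt_top n := by
    obtain ⟨R, hR⟩ := hW' n
    refine (testNorm_le (M := R) fun w hw => ?_).trans_lt ENNReal.coe_lt_top
    refine (Finset.sum_le_sum_of_subset (Finset.subset_insert n w.support)).trans ?_
    rw [Finset.sum_eq_single n (fun k _ hk => by simp [hk])
      (fun h => absurd (Finset.mem_insert_self _ _) h)]
    simpa using hR w hw
  complete := testNorm_complete hW

end TestNorm

/-! ### The weights -/

/-- `a ↦ a * exp (- A (- log a))`. -/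
def weight (A : ℝ≥0 → ℝ) (a : ℝ) : ℝ := a * Real.exp (-A (Real.toNNReal (-Real.log a)))

lemma weight_nonneg (A : ℝ≥0 → ℝ) {a : ℝ} (ha : 0 ≤ a) : 0 ≤ weight A a :=
  mul_nonneg ha (Real.exp_pos _).le

/-- As `A` is `1`-Lipschitz in `-log`, the exponential factor is at most the larger of `a / b` and
`b / a`. Hence the spaces with weights `-A` and `A` are in duality. -/
lemma mul_weight_neg_le {A : ℝ≥0 → ℝ} (hA : ∀ s t, |A s - A t| ≤ dist s t) {a b : ℝ} (ha : 0 ≤ a)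
    (hb : 0 ≤ b) (ha1 : a ≤ 1) (hb1 : b ≤ 1) :
    weight (-A) a * weight A b ≤ a ^ 2 + b ^ 2 := by
  rcases ha.eq_or_lt with rfl | ha0
  · simp [weight]; positivity
  rcases hb.eq_or_lt with rfl | hb0
  · simp [weight]; positivity
  have hla : 0 ≤ -Real.log a := neg_nonneg.2 (Real.log_nonpos ha ha1)
  have hlb : 0 ≤ -Real.log b := neg_nonneg.2 (Real.log_nonpos hb hb1)
  have h := hA (Real.toNNReal (-Real.log a)) (Real.toNNReal (-Real.log b))
  rw [NNReal.dist_eq, Real.coe_toNNReal _ hla, Real.coe_toNNReal _ hlb] at h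
  have h1 := (le_abs_self _).trans h
  have e : weight (-A) a * weight A b = a * b *
      Real.exp (A (Real.toNNReal (-Real.log a)) - A (Real.toNNReal (-Real.log b))) := by
    rw [weight, weight, Pi.neg_apply, neg_neg, sub_eq_add_neg, Real.exp_add]
    ring
  rw [e]
  have h2 : Real.exp (A (Real.toNNReal (-Real.log a)) - A (Real.toNNReal (-Real.log b))) ≤
      a / b + b / a := by
    rcases abs_cases (-Real.log a - -Real.log b) with ⟨h3, -⟩ | ⟨h3, -⟩
    · have : Real.exp (-Real.log a - -Real.log b) = b / a := by
        rw [show -Real.log a - -Real.log b = Real.log (b / a) by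
          rw [Real.log_div hb0.ne' ha0.ne']; ring, Real.exp_log (by positivity)]
      calc _ ≤ Real.exp (-Real.log a - -Real.log b) := Real.exp_le_exp.2 (h1.trans_eq h3)
        _ = b / a := this
        _ ≤ _ := le_add_of_nonneg_left (by positivity)
    · have : Real.exp (-(-Real.log a - -Real.log b)) = a / b := by
        rw [show -(-Real.log a - -Real.log b) = Real.log (a / b) by
          rw [Real.log_div ha0.ne' hb0.ne']; ring, Real.exp_log (by positivity)]
      calc _ ≤ Real.exp (-(-Real.log a - -Real.log b)) := Real.exp_le_exp.2 (h1.trans_eq h3)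
        _ = a / b := this
        _ ≤ _ := le_add_of_nonneg_right (by positivity)
  calc _ ≤ a * b * (a / b + b / a) := mul_le_mul_of_nonneg_left h2 (by positivity)
    _ = a ^ 2 + b ^ 2 := by field_simp

/-- The sequence of the weights of `|yₙ|`. -/
def weightSeq (A : ℝ≥0 → ℝ) (y : ℕ →₀ ℂ) : ℕ →₀ ℝ≥0 :=
  y.mapRange (fun a => ⟨weight A ‖a‖, weight_nonneg A (norm_nonneg a)⟩)
    (Subtype.ext (by simp [weight]))

lemma coe_weightSeq (A : ℝ≥0 → ℝ) (y : ℕ →₀ ℂ) (n : ℕ) : (weightSeq A y n : ℝ) = weight A ‖y n‖ := rfl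

lemma support_weightSeq_subset (A : ℝ≥0 → ℝ) (y : ℕ →₀ ℂ) : (weightSeq A y).support ⊆ y.support :=
  Finsupp.support_mapRange

/-- The sequences of weights of the `y` in the unit ball of `ℓ₂`. -/
def weightTests (A : ℝ≥0 → ℝ) : Set (ℕ →₀ ℝ≥0) := weightSeq A '' {y | ‖toL2 y‖ ≤ 1}

/-- The Banach sequence space tested by the sequences of weights of the `y` in the unit ball of `ℓ₂`. -/
def weightSpace (A : ℝ≥0 → ℝ) (hA : ∀ s t, |A s - A t| ≤ dist s t) (hA0 : A 0 = 0) : BanachSeqSpace :=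
  ofTests (weightTests A)
    (fun n => by
      refine ⟨_, ⟨Finsupp.single n 1, by simp [toL2_single], rfl⟩, fun h => ?_⟩
      have h' := congrArg NNReal.toReal h
      rw [coe_weightSeq] at h'
      simp [weight] at h')
    (fun n => by
      refine ⟨1, ?_⟩
      rintro _ ⟨y, hy, rfl⟩
      have h0 : ‖y n‖ ≤ 1 := (norm_apply_le_norm_toL2 y n).trans hy
      have h1 : weight A ‖y n‖ ≤ 1 := by
        rcases (norm_nonneg (y n)).eq_or_lt with h | h
        · rw [← h]; simp [weight]
        have hl : 0 ≤ -Real.log ‖y n‖ := neg_nonneg.2 (Real.log_nonpos h.le h0)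
        have h2 := (neg_le_abs _).trans (hA (Real.toNNReal (-Real.log ‖y n‖)) 0)
        rw [hA0, sub_zero, NNReal.dist_eq, Real.coe_toNNReal _ hl, NNReal.coe_zero, sub_zero,
          abs_of_nonneg hl] at h2
        calc weight A ‖y n‖ ≤ ‖y n‖ * Real.exp (-Real.log ‖y n‖) :=
              mul_le_mul_of_nonneg_left (Real.exp_le_exp.2 h2) h.le
          _ = 1 := by rw [Real.exp_neg, Real.exp_log h, mul_inv_cancel₀ h.ne']
      exact_mod_cast h1)

lemma sum_norm_mul_weight_le {A : ℝ≥0 → ℝ} {b : ℕ → ℂ} {M : ℝ} (hM : 0 ≤ M)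
    (h : testNorm (weightTests A) b ≤ ENNReal.ofReal M) {y : ℕ →₀ ℂ} (hy : ‖toL2 y‖ ≤ 1) :
    ∑ n ∈ y.support, ‖b n‖ * weight A ‖y n‖ ≤ M := by
  have h1 := (sum_le_testNorm (Set.mem_image_of_mem (weightSeq A) hy) b).trans h
  have e : ∑ n ∈ (weightSeq A y).support, ‖b n‖ₑ * (weightSeq A y n : ℝ≥0∞) =
      ENNReal.ofReal (∑ n ∈ y.support, ‖b n‖ * weight A ‖y n‖) := by
    rw [ENNReal.ofReal_sum_of_nonneg fun n _ => mul_nonneg (norm_nonneg _) (weight_nonneg A (norm_nonneg _))]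
    refine (Finset.sum_subset (support_weightSeq_subset A y) fun n _ hn => ?_).trans
      (Finset.sum_congr rfl fun n _ => ?_)
    · rw [Finsupp.notMem_support_iff.1 hn]; simp
    · rw [ENNReal.ofReal_mul (norm_nonneg _), ofReal_norm, ← coe_weightSeq,
        ENNReal.ofReal_coe_nnreal]
  rw [e] at h1
  exact (ENNReal.ofReal_le_ofReal_iff hM).1 h1

lemma testNorm_weightTests_le {A : ℝ≥0 → ℝ} {b : ℕ → ℂ} {M : ℝ}
    (h : ∀ y : ℕ →₀ ℂ, ‖toL2 y‖ ≤ 1 → ∑ n ∈ y.support, ‖b n‖ * weight A ‖y n‖ ≤ M) :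
    testNorm (weightTests A) b ≤ ENNReal.ofReal M := by
  refine testNorm_le ?_
  rintro _ ⟨y, hy, rfl⟩
  refine le_trans (le_trans ?_ (le_of_eq (ENNReal.ofReal_sum_of_nonneg (s := y.support)
    fun n _ => mul_nonneg (norm_nonneg (b n)) (weight_nonneg A (norm_nonneg (y n)))).symm))
    (ENNReal.ofReal_le_ofReal (h y hy))
  refine (Finset.sum_le_sum_of_subset (support_weightSeq_subset A y)).trans
    (Finset.sum_le_sum fun n _ => le_of_eq ?_)
  rw [ENNReal.ofReal_mul (norm_nonneg _), ofReal_norm, ← coe_weightSeq,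
    ENNReal.ofReal_coe_nnreal]

/-- The sequences with the moduli `‖x‖ * weight (-A) (|xₙ| / ‖x‖)` have norm at most `2 ‖x‖`. -/
lemma testNorm_le_two_mul {A : ℝ≥0 → ℝ} (hA : ∀ s t, |A s - A t| ≤ dist s t) (x : L2) {b : ℕ → ℂ}
    (hb : ∀ n, ‖b n‖ = ‖x‖ * weight (-A) (‖x n‖ / ‖x‖)) :
    testNorm (weightTests A) b ≤ ENNReal.ofReal (2 * ‖x‖) := by
  refine testNorm_weightTests_le fun y hy => ?_
  rcases eq_or_ne x 0 with rfl | hx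
  · simp [hb]
  have hx0 : 0 < ‖x‖ := norm_pos_iff.2 hx
  have h1 : ∀ n, ‖x n‖ / ‖x‖ ≤ 1 := fun n =>
    (div_le_one hx0).2 (lp.norm_apply_le_norm (by simp) x n)
  have hsum : ∀ (z : L2) (s : Finset ℕ), ∑ n ∈ s, ‖z n‖ ^ 2 ≤ ‖z‖ ^ 2 := fun z s => by
    have := lp.sum_rpow_le_norm_rpow (p := 2) (by norm_num) z s
    simpa using this
  have h2 : ∑ n ∈ y.support, (‖x n‖ / ‖x‖) ^ 2 ≤ 1 := by
    simp only [div_pow]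
    rw [← Finset.sum_div, div_le_one (by positivity)]
    exact hsum x _
  have h3 : ∑ n ∈ y.support, ‖y n‖ ^ 2 ≤ 1 :=
    (hsum (toL2 y) _).trans (pow_le_one₀ (norm_nonneg _) hy)
  calc ∑ n ∈ y.support, ‖b n‖ * weight A ‖y n‖
      ≤ ∑ n ∈ y.support, ‖x‖ * ((‖x n‖ / ‖x‖) ^ 2 + ‖y n‖ ^ 2) := by
        refine Finset.sum_le_sum fun n _ => ?_
        rw [hb, mul_assoc]
        exact mul_le_mul_of_nonneg_left (mul_weight_neg_le hA (by positivity) (norm_nonneg _) (h1 n)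
          ((norm_apply_le_norm_toL2 y n).trans hy)) hx0.le
    _ = ‖x‖ * (∑ n ∈ y.support, (‖x n‖ / ‖x‖) ^ 2 + ∑ n ∈ y.support, ‖y n‖ ^ 2) := by
        rw [← Finset.mul_sum, Finset.sum_add_distrib]
    _ ≤ ‖x‖ * (1 + 1) := by gcongr
    _ = 2 * ‖x‖ := by ring

open MeasureTheory

/-! ### A conformal map of the disc onto a strip -/

/-- A conformal map of the unit disc onto the strip `|Re| < 1`. -/
def strip (z : ℂ) : ℂ := -(2 * Complex.I / Real.pi) * Complex.log ((1 + z) / (1 - z))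

lemma re_mobius (z : ℂ) : ((1 + z) / (1 - z)).re = (1 - ‖z‖ ^ 2) / Complex.normSq (1 - z) := by
  rw [Complex.div_re, ← Complex.normSq_eq_norm_sq, Complex.normSq_apply z]
  simp only [Complex.add_re, Complex.sub_re, Complex.one_re, Complex.add_im, Complex.sub_im,
    Complex.one_im]
  ring

lemma im_mobius (z : ℂ) : ((1 + z) / (1 - z)).im = 2 * z.im / Complex.normSq (1 - z) := by
  rw [Complex.div_im]
  simp only [Complex.add_re, Complex.sub_re, Complex.one_re, Complex.add_im, Complex.sub_im,
    Complex.one_im]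
  ring

lemma one_sub_ne_zero {z : ℂ} (hz : ‖z‖ < 1) : 1 - z ≠ 0 := fun h => by
  rw [← sub_eq_zero.1 h] at hz
  simp at hz

lemma re_mobius_pos {z : ℂ} (hz : ‖z‖ < 1) : 0 < ((1 + z) / (1 - z)).re := by
  rw [re_mobius]
  have := Complex.normSq_pos.2 (one_sub_ne_zero hz)
  have h1 : ‖z‖ ^ 2 < 1 := pow_lt_one₀ (norm_nonneg z) hz two_ne_zero
  have : 0 < 1 - ‖z‖ ^ 2 := sub_pos.2 h1
  positivity

lemma re_strip (z : ℂ) : (strip z).re = 2 / Real.pi * ((1 + z) / (1 - z)).arg := by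
  rw [strip, ← Complex.log_im]
  simp [Complex.div_re, Complex.div_im, Complex.normSq_apply]
  left
  field_simp

@[simp] lemma strip_zero : strip 0 = 0 := by simp [strip]

lemma abs_re_strip_le {z : ℂ} (hz : ‖z‖ < 1) : |(strip z).re| ≤ 1 := by
  rw [re_strip, abs_mul, abs_of_pos (by positivity)]
  have h := Complex.abs_arg_le_pi_div_two_iff.2 (re_mobius_pos hz).le
  calc 2 / Real.pi * |((1 + z) / (1 - z)).arg| ≤ 2 / Real.pi * (Real.pi / 2) := by gcongr
    _ = 1 := by field_simp

lemma differentiableAt_strip {z : ℂ} (hz : 1 - z ≠ 0) (h : (1 + z) / (1 - z) ∈ Complex.slitPlane) :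
    DifferentiableAt ℂ strip z := by
  have h1 : DifferentiableAt ℂ (fun z : ℂ => (1 + z) / (1 - z)) z := by
    fun_prop (disch := exact hz)
  exact (h1.clog h).const_mul _

lemma differentiableOn_strip : DifferentiableOn ℂ strip (Metric.ball 0 1) := fun z hz => by
  have hz' : ‖z‖ < 1 := mem_ball_zero_iff.1 hz
  exact (differentiableAt_strip (one_sub_ne_zero hz')
    (Or.inl (re_mobius_pos hz'))).differentiableWithinAt

lemma hasDerivAt_strip_zero : HasDerivAt strip (-(4 * Complex.I / Real.pi)) 0 := by
  have h1 : HasDerivAt (fun z : ℂ => (1 + z) / (1 - z)) 2 0 := by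
    have := ((hasDerivAt_id (0 : ℂ)).const_add 1).div ((hasDerivAt_id (0 : ℂ)).const_sub 1) (by simp)
    exact this.congr_deriv (by norm_num)
  have h2 := (h1.clog (by simp)).const_mul (-(2 * Complex.I / Real.pi))
  exact h2.congr_deriv (by simp; ring)

/-- The boundary values of `strip`. -/
lemma strip_boundary {z : ℂ} (hz : ‖z‖ = 1) {κ : ℝ} (hκ : κ = 1 ∧ 0 < z.im ∨ κ = -1 ∧ z.im < 0) :
    ContinuousAt strip z ∧ (strip z).re = κ := by
  have him : z.im ≠ 0 := by rcases hκ with h | h; exacts [h.2.ne', h.2.ne]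
  have hne : 1 - z ≠ 0 := fun h => him (by rw [← sub_eq_zero.1 h]; simp)
  have hpos := Complex.normSq_pos.2 hne
  have hre : ((1 + z) / (1 - z)).re = 0 := by rw [re_mobius, hz]; simp
  refine ⟨(differentiableAt_strip hne (Or.inr ?_)).continuousAt, ?_⟩
  · rw [im_mobius]
    positivity
  · rw [re_strip]
    rcases hκ with ⟨rfl, h⟩ | ⟨rfl, h⟩
    · rw [Complex.arg_eq_pi_div_two_iff.2 ⟨hre, by rw [im_mobius]; positivity⟩]
      field_simp
    · rw [Complex.arg_eq_neg_pi_div_two_iff.2 ⟨hre, by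
        rw [im_mobius]; exact div_neg_of_neg_of_pos (by linarith) hpos⟩]
      field_simp

/-- The signs of `Re (strip z)` and `Re (strip (-i z))` on the four arcs. -/
def sgn₁ : Fin 4 → ℝ := ![1, 1, -1, -1]

/-- The signs of `Re (strip (-i z))` on the four arcs. -/
def sgn₂ : Fin 4 → ℝ := ![-1, 1, 1, -1]

lemma abs_sgn₁ (j : Fin 4) : |sgn₁ j| = 1 := by fin_cases j <;> simp [sgn₁]

lemma abs_sgn₂ (j : Fin 4) : |sgn₂ j| = 1 := by fin_cases j <;> simp [sgn₂]

/-- `exp (strip z * p + strip (-i z) * q)`. -/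
def expStrip (p q : ℝ) (z : ℂ) : ℂ := Complex.exp (strip z * p + strip (-Complex.I * z) * q)

@[simp] lemma expStrip_zero (p q : ℝ) : expStrip p q 0 = 1 := by simp [expStrip]

lemma norm_expStrip (p q : ℝ) (z : ℂ) :
    ‖expStrip p q z‖ = Real.exp ((strip z).re * p + (strip (-Complex.I * z)).re * q) := by
  rw [expStrip, Complex.norm_exp]
  simp

lemma norm_expStrip_le (p q : ℝ) {z : ℂ} (hz : ‖z‖ < 1) : ‖expStrip p q z‖ ≤ Real.exp (|p| + |q|) := by
  rw [norm_expStrip]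
  have hz' : ‖-Complex.I * z‖ < 1 := by simpa using hz
  refine Real.exp_le_exp.2 (add_le_add ?_ ?_)
  · refine (le_abs_self _).trans ?_
    rw [abs_mul]
    exact mul_le_of_le_one_left (abs_nonneg _) (abs_re_strip_le hz)
  · refine (le_abs_self _).trans ?_
    rw [abs_mul]
    exact mul_le_of_le_one_left (abs_nonneg _) (abs_re_strip_le hz')

lemma differentiableOn_expStrip (p q : ℝ) : DifferentiableOn ℂ (expStrip p q) (Metric.ball 0 1) := by
  refine DifferentiableOn.cexp ((differentiableOn_strip.mul_const _).add
    (DifferentiableOn.mul_const (differentiableOn_strip.comp (by fun_prop) fun z hz => ?_) _))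
  rw [mem_ball_zero_iff] at hz ⊢
  simpa using hz

/-- Rotating the second strip map by `-i` turns the two real parameters into the complex number `p -
i q`. Four arcs therefore produce complex-valued `φ`. -/
lemma hasDerivAt_expStrip (p q : ℝ) :
    HasDerivAt (expStrip p q) (-(4 * Complex.I / Real.pi) * (p - q * Complex.I)) 0 := by
  have h1 : HasDerivAt (fun z : ℂ => -Complex.I * z) (-Complex.I) 0 := by
    simpa using (hasDerivAt_id (0 : ℂ)).const_mul (-Complex.I)
  have h2 : HasDerivAt (fun z => strip (-Complex.I * z)) (-(4 * Complex.I / Real.pi) * -Complex.I) 0 :=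
    HasDerivAt.comp (h₂ := strip) 0 (by simpa using hasDerivAt_strip_zero) h1
  have h3 := ((hasDerivAt_strip_zero.mul_const (p : ℂ)).add (h2.mul_const (q : ℂ))).cexp
  exact h3.congr_deriv (by simp; ring)

/-- The radial boundary values of `expStrip` on the arcs. -/
lemma expStrip_boundary {j : Fin 4} {θ : ℝ}
    (hθ : θ ∈ Set.Ioo (((j : ℕ) : ℝ) * (Real.pi / 2)) ((((j : ℕ) : ℝ) + 1) * (Real.pi / 2))) (p q : ℝ) :
    Tendsto (fun r : ℝ => expStrip p q (r * Complex.exp (θ * Complex.I))) (𝓝[<] 1)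
        (𝓝 (expStrip p q (Complex.exp (θ * Complex.I)))) ∧
      ‖expStrip p q (Complex.exp (θ * Complex.I))‖ = Real.exp (sgn₁ j * p + sgn₂ j * q) := by
  set w := Complex.exp (θ * Complex.I) with hw
  have hw1 : ‖w‖ = 1 := Complex.norm_exp_ofReal_mul_I θ
  have hw2 : ‖-Complex.I * w‖ = 1 := by simpa using hw1
  have him : w.im = Real.sin θ := Complex.exp_ofReal_mul_I_im θ
  have hre : (-Complex.I * w).im = -Real.cos θ := by
    simp [hw, Complex.exp_ofReal_mul_I_re]
  have hπ := Real.pi_pos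
  have hsin : sgn₁ j = 1 ∧ 0 < Real.sin θ ∨ sgn₁ j = -1 ∧ Real.sin θ < 0 := by
    fin_cases j
    · left; exact ⟨rfl, Real.sin_pos_of_pos_of_lt_pi (by simpa using hθ.1) (by have := hθ.2; simp at this; linarith)⟩
    · left; refine ⟨rfl, Real.sin_pos_of_pos_of_lt_pi ?_ ?_⟩ <;> have h1 := hθ.1 <;> have h2 := hθ.2 <;> norm_num at h1 h2 <;> linarith
    · right; refine ⟨rfl, ?_⟩
      have h1 := hθ.1; have h2 := hθ.2; norm_num at h1 h2
      have := Real.sin_pos_of_pos_of_lt_pi (x := θ - Real.pi) (by linarith) (by linarith)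
      rw [Real.sin_sub_pi] at this; linarith
    · right; refine ⟨rfl, ?_⟩
      have h1 := hθ.1; have h2 := hθ.2; norm_num at h1 h2
      have := Real.sin_pos_of_pos_of_lt_pi (x := θ - Real.pi) (by linarith) (by linarith)
      rw [Real.sin_sub_pi] at this; linarith
  have hcos : sgn₂ j = 1 ∧ 0 < -Real.cos θ ∨ sgn₂ j = -1 ∧ -Real.cos θ < 0 := by
    fin_cases j
    · right; refine ⟨rfl, neg_neg_of_pos (Real.cos_pos_of_mem_Ioo ?_)⟩
      have h1 := hθ.1; have h2 := hθ.2; norm_num at h1 h2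
      constructor <;> linarith
    · left; refine ⟨rfl, ?_⟩
      have h1 := hθ.1; have h2 := hθ.2; norm_num at h1 h2
      have := Real.cos_neg_of_pi_div_two_lt_of_lt (x := θ) (by linarith) (by linarith)
      linarith
    · left; refine ⟨rfl, ?_⟩
      have h1 := hθ.1; have h2 := hθ.2; norm_num at h1 h2
      have := Real.cos_neg_of_pi_div_two_lt_of_lt (x := θ) (by linarith) (by linarith)
      linarith
    · right; refine ⟨rfl, ?_⟩
      have h1 := hθ.1; have h2 := hθ.2; norm_num at h1 h2
      have := Real.cos_pos_of_mem_Ioo (x := θ - 2 * Real.pi) ⟨by linarith, by linarith⟩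
      rw [Real.cos_sub_two_pi] at this; linarith
  obtain ⟨c1, e1⟩ := strip_boundary hw1 (by rwa [him])
  obtain ⟨c2, e2⟩ := strip_boundary hw2 (by rwa [hre])
  constructor
  · have hc : ContinuousAt (expStrip p q) w := by
      refine Complex.continuous_exp.continuousAt.comp ((c1.mul_const _).add (ContinuousAt.mul_const ?_ _))
      exact ContinuousAt.comp (g := strip) c2 (by fun_prop)
    have ht : Tendsto (fun r : ℝ => (r : ℂ) * w) (𝓝[<] 1) (𝓝 w) := by
      have : Continuous fun r : ℝ => (r : ℂ) * w := by fun_prop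
      simpa using (this.tendsto 1).mono_left nhdsWithin_le_nhds
    exact hc.tendsto.comp ht
  · rw [norm_expStrip, e1, e2]

/-! ### Bounded analytic functions and their radial boundary values -/

lemma norm_apply_zero_le_integral {g : ℂ → ℂ} (hg : DifferentiableOn ℂ g (Metric.ball 0 1)) {r : ℝ}
    (hr0 : 0 < r) (hr : r < 1) :
    2 * Real.pi * ‖g 0‖ ≤ ∫ θ in (0 : ℝ)..2 * Real.pi, ‖g (r * Complex.exp (θ * Complex.I))‖ := by
  have hd : DiffContOnCl ℂ g (Metric.ball 0 |r|) := by
    rw [abs_of_pos hr0]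
    refine DifferentiableOn.diffContOnCl (hg.mono ?_)
    rw [closure_ball _ hr0.ne']
    exact Metric.closedBall_subset_ball hr
  have h := hd.circleAverage
  rw [Real.circleAverage_def] at h
  rw [← h, norm_smul, norm_inv, Real.norm_of_nonneg (by positivity), ← mul_assoc,
    mul_inv_cancel₀ (by positivity), one_mul]
  refine (intervalIntegral.norm_integral_le_integral_norm (by positivity)).trans_eq ?_
  simp [circleMap]

/-- The mean value property on circles of radius `r`, followed by dominated convergence as `r → 1`.
-/
lemma norm_apply_zero_le {g : ℂ → ℂ} (hg : DifferentiableOn ℂ g (Metric.ball 0 1)) {R M : ℝ}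
    (hR : ∀ z ∈ Metric.ball (0 : ℂ) 1, ‖g z‖ ≤ R) (hM : 0 ≤ M)
    (hb : ∀ᵐ θ : ℝ ∂volume.restrict (Set.Ioc 0 (2 * Real.pi)), ∃ b : ℂ,
      Tendsto (fun r : ℝ => g (r * Complex.exp (θ * Complex.I))) (𝓝[<] 1) (𝓝 b) ∧ ‖b‖ ≤ M) :
    ‖g 0‖ ≤ M := by
  have hmem : ∀ (r : ℝ), 0 < r → r < 1 → ∀ θ : ℝ, (r : ℂ) * Complex.exp (θ * Complex.I) ∈ Metric.ball (0 : ℂ) 1 :=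
    fun r h0 h1 θ => by
      rw [mem_ball_zero_iff, norm_mul, Complex.norm_exp_ofReal_mul_I, mul_one, Complex.norm_real,
        Real.norm_of_nonneg h0.le]
      exact h1
  have hπ := Real.pi_pos
  -- The maximum with `M` tends to the constant `M`, whatever the boundary value is, so no integral
  -- of the boundary function is needed.
  set G : ℝ → ℝ → ℝ := fun r θ => max ‖g (r * Complex.exp (θ * Complex.I))‖ M with hG
  have hcont : ∀ r : ℝ, 0 < r → r < 1 → Continuous (fun θ : ℝ => g (r * Complex.exp (θ * Complex.I))) :=
    fun r h0 h1 => hg.continuousOn.comp_continuous (by fun_prop) (hmem r h0 h1)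
  have hev : ∀ᶠ r : ℝ in 𝓝[<] 1, 0 < r ∧ r < 1 := by
    filter_upwards [self_mem_nhdsWithin, mem_nhdsWithin_of_mem_nhds (lt_mem_nhds one_pos)] with r h1 h0
    exact ⟨h0, h1⟩
  have hlim : Tendsto (fun r => ∫ θ in (0 : ℝ)..2 * Real.pi, G r θ) (𝓝[<] 1)
      (𝓝 (∫ _ in (0 : ℝ)..2 * Real.pi, M)) := by
    refine intervalIntegral.tendsto_integral_filter_of_dominated_convergence (fun _ => max R M) ?_ ?_
      intervalIntegrable_const ?_
    · filter_upwards [hev] with r hr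
      exact ((hcont r hr.1 hr.2).norm.max continuous_const).aestronglyMeasurable
    · filter_upwards [hev] with r hr
      refine ae_of_all _ fun θ _ => ?_
      rw [Real.norm_of_nonneg (le_max_of_le_right hM)]
      exact max_le_max_right _ (hR _ (hmem r hr.1 hr.2 θ))
    · rw [Set.uIoc_of_le (by positivity)]
      filter_upwards [(ae_restrict_iff' measurableSet_Ioc).1 hb] with θ h hθ
      obtain ⟨b, h1, h2⟩ := h hθ
      simpa [max_eq_right h2] using h1.norm.max (tendsto_const_nhds (x := M))
  have h1 : 2 * Real.pi * ‖g 0‖ ≤ ∫ _ in (0 : ℝ)..2 * Real.pi, M := by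
    refine ge_of_tendsto hlim ?_
    filter_upwards [hev] with r hr
    refine (norm_apply_zero_le_integral hg hr.1 hr.2).trans ?_
    refine intervalIntegral.integral_mono_on (by positivity)
      ((hcont r hr.1 hr.2).norm.intervalIntegrable _ _)
      (((hcont r hr.1 hr.2).norm.max continuous_const).intervalIntegrable _ _)
      fun θ _ => le_max_left _ _
  rw [intervalIntegral.integral_const, sub_zero, smul_eq_mul] at h1
  exact le_of_mul_le_mul_left h1 (by positivity)

/-- The four arcs cover the circle up to a null set. -/
lemma ae_of_ae_arcs {p : ℝ → Prop}
    (h : ∀ j : Fin 4, ∀ᵐ θ : ℝ ∂(volume.restrict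
      (Set.Ioo (((j : ℕ) : ℝ) * (Real.pi / 2)) ((((j : ℕ) : ℝ) + 1) * (Real.pi / 2)))), p θ) :
    ∀ᵐ θ : ℝ ∂volume.restrict (Set.Ioc 0 (2 * Real.pi)), p θ := by
  rw [ae_restrict_iff' measurableSet_Ioc]
  have h' := ae_all_iff.2 fun j => (ae_restrict_iff' measurableSet_Ioo).1 (h j)
  have hn : ∀ᵐ θ : ℝ, θ ∉ Set.range fun j : ℕ => (j : ℝ) * (Real.pi / 2) :=
    measure_eq_zero_iff_ae_notMem.1 ((Set.countable_range _).measure_zero _)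
  filter_upwards [h', hn] with θ h1 h2 hθ
  have hne : ∀ j : ℕ, θ ≠ (j : ℝ) * (Real.pi / 2) := fun j hj => h2 ⟨j, hj.symm⟩
  have n1 := hne 1
  have n2 := hne 2
  have n3 := hne 3
  have n4 := hne 4
  norm_num at n1 n2 n3 n4
  rcases lt_or_gt_of_ne n1 with k1 | k1
  · exact h1 0 ⟨by simpa using hθ.1, by norm_num; linarith⟩
  rcases lt_or_gt_of_ne n2 with k2 | k2
  · exact h1 1 ⟨by norm_num; linarith, by norm_num; linarith⟩
  rcases lt_or_gt_of_ne n3 with k3 | k3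
  · exact h1 2 ⟨by norm_num; linarith, by norm_num; linarith⟩
  · refine h1 3 ⟨by norm_num; linarith, lt_of_le_of_ne (hθ.2.trans_eq ?_) fun h => n4 ?_⟩
    · norm_num; ring
    · norm_num at h; linarith

lemma exists_L2_of_norm_sum_le {f : ℕ → ℂ} {M : ℝ} (hM : 0 ≤ M)
    (h : ∀ y : ℕ →₀ ℂ, ‖toL2 y‖ ≤ 1 → ‖∑ n ∈ y.support, f n * y n‖ ≤ M) :
    ∃ x : L2, f = x ∧ ‖x‖ ≤ M := by
  have key : ∀ s : Finset ℕ, ∑ n ∈ s, ‖f n‖ ^ 2 ≤ M ^ 2 := by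
    intro s
    set N := ∑ n ∈ s, ‖f n‖ ^ 2 with hN
    have hN0 : 0 ≤ N := Finset.sum_nonneg fun _ _ => by positivity
    rcases hN0.eq_or_lt with h0 | hpos
    · rw [← h0]; positivity
    set u := Real.sqrt N with hu
    have hu0 : 0 < u := Real.sqrt_pos.2 hpos
    have hu2 : u ^ 2 = N := Real.sq_sqrt hN0
    set y : ℕ →₀ ℂ := Finsupp.onFinset s (fun n => if n ∈ s then (starRingEnd ℂ) (f n) / u else 0)
      (fun n hn => by by_contra hc; simp [hc] at hn) with hy
    have hyn : ∀ n ∈ s, y n = (starRingEnd ℂ) (f n) / u := fun n hn => by simp [hy, hn]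
    have hsub : y.support ⊆ s := Finsupp.support_onFinset_subset
    have hy1 : ‖toL2 y‖ ^ 2 = 1 := by
      rw [norm_toL2_sq, Finset.sum_subset hsub fun n _ hn => by
        rw [Finsupp.notMem_support_iff.1 hn]; simp,
        Finset.sum_congr rfl fun n hn => by rw [hyn n hn, norm_div, Complex.norm_conj, div_pow],
        ← Finset.sum_div, ← hN, Complex.norm_real, Real.norm_of_nonneg hu0.le, hu2, div_self hpos.ne']
    have h1 := h y (by nlinarith [norm_nonneg (toL2 y)])
    rw [Finset.sum_subset hsub fun n _ hn => by
        rw [Finsupp.notMem_support_iff.1 hn, mul_zero],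
      Finset.sum_congr rfl fun n hn => by rw [hyn n hn, ← mul_div_assoc, Complex.mul_conj,
        Complex.normSq_eq_norm_sq], ← Finset.sum_div, ← Complex.ofReal_sum, ← hN, norm_div,
      Complex.norm_real, Complex.norm_real, Real.norm_of_nonneg hu0.le, Real.norm_of_nonneg hN0,
      ← hu2, pow_two, mul_div_assoc, div_self hu0.ne', mul_one] at h1
    rw [← hu2]
    exact pow_le_pow_left₀ hu0.le h1 2
  have hmem : Memℓp f 2 := memℓp_gen' (C := M ^ 2) fun s => by simpa using key s
  refine ⟨⟨f, hmem⟩, rfl, lp.norm_le_of_forall_sum_le (by norm_num) hM fun s => ?_⟩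
  simpa using key s

/-! ### The family of the four spaces -/

/-- The logarithm of the weight on the `j`-th arc. -/
def arcWeight (P Q : ℝ≥0 → ℝ) (j : Fin 4) (t : ℝ≥0) : ℝ := sgn₁ j * P t + sgn₂ j * Q t

/-- `P` and `Q` vanish at `0` and have Lipschitz constants with sum at most `1`. -/
structure IsAdmissible (P Q : ℝ≥0 → ℝ) : Prop where
  left_zero : P 0 = 0
  right_zero : Q 0 = 0
  dist_le : ∀ s t, |P s - P t| + |Q s - Q t| ≤ dist s t

variable {P Q : ℝ≥0 → ℝ}

lemma IsAdmissible.arcWeight_zero (h : IsAdmissible P Q) (j : Fin 4) : arcWeight P Q j 0 = 0 := by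
  simp [arcWeight, h.left_zero, h.right_zero]

lemma IsAdmissible.arcWeight_sub (h : IsAdmissible P Q) (j : Fin 4) (s t : ℝ≥0) :
    |arcWeight P Q j s - arcWeight P Q j t| ≤ dist s t := by
  refine le_trans ?_ (h.dist_le s t)
  have e : arcWeight P Q j s - arcWeight P Q j t = sgn₁ j * (P s - P t) + sgn₂ j * (Q s - Q t) := by
    unfold arcWeight; ring
  rw [e]
  refine (abs_add_le _ _).trans_eq ?_
  rw [abs_mul, abs_mul, abs_sgn₁, abs_sgn₂, one_mul, one_mul]

/-- The family of the four spaces. -/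
def IsAdmissible.family (h : IsAdmissible P Q) (j : Fin 4) : BanachSeqSpace :=
  weightSpace (arcWeight P Q j) (h.arcWeight_sub j) (h.arcWeight_zero j)

/-- `- log (|xₙ| / ‖x‖)`. -/
def logCoord (x : L2) (n : ℕ) : ℝ≥0 := Real.toNNReal (-Real.log (‖x n‖ / ‖x‖))

/-- The extremal function for `x`. -/
def extremal (P Q : ℝ≥0 → ℝ) (x : L2) (z : ℂ) (n : ℕ) : ℂ :=
  x n * expStrip (P (logCoord x n)) (Q (logCoord x n)) z

lemma extremal_zero (P Q : ℝ≥0 → ℝ) (x : L2) : extremal P Q x 0 = x := by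
  ext n; simp [extremal]

lemma IsAdmissible.memF_extremal (h : IsAdmissible P Q) (x : L2) :
    MemF h.family (extremal P Q x) (2 * ‖x‖) where
  analytic n := (differentiableOn_expStrip _ _).const_mul _
  bounded n := by
    refine ⟨‖x n‖ * Real.exp (|P (logCoord x n)| + |Q (logCoord x n)|), fun z hz => ?_⟩
    rw [extremal, norm_mul]
    exact mul_le_mul_of_nonneg_left (norm_expStrip_le _ _ (mem_ball_zero_iff.1 hz)) (norm_nonneg _)
  boundary j := by
    rw [ae_restrict_iff' measurableSet_Ioo]
    refine ae_of_all _ fun θ hθ => ⟨extremal P Q x (Complex.exp (θ * Complex.I)), ?_, ?_⟩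
    · exact tendsto_pi_nhds.2 fun n => (expStrip_boundary hθ _ _).1.const_mul _
    · refine testNorm_le_two_mul (h.arcWeight_sub j) x fun n => ?_
      rw [extremal, norm_mul, (expStrip_boundary hθ _ _).2, weight, Pi.neg_apply, neg_neg]
      rcases eq_or_ne x 0 with rfl | hx
      · simp
      · have : ‖x‖ ≠ 0 := norm_ne_zero_iff.2 hx
        rw [← mul_assoc, mul_div_cancel₀ _ this]
        rfl

/-- Pair `F` with the extremal function of opposite weights for a test vector `y`. On each arc the
modulus of the pairing is bounded by a test sum in the norm of that space, hence by `M`. The bound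
at `0` is duality with `ℓ₂`. -/
lemma IsAdmissible.exists_of_memF (h : IsAdmissible P Q) {F : ℂ → ℕ → ℂ} {M : ℝ} (hM : 0 ≤ M)
    (hF : MemF h.family F M) : ∃ x : L2, F 0 = x ∧ ‖x‖ ≤ M := by
  refine exists_L2_of_norm_sum_le hM fun y hy => ?_
  set t : ℕ → ℝ≥0 := fun n => Real.toNNReal (-Real.log ‖y n‖)
  set g : ℂ → ℂ := fun z => ∑ n ∈ y.support, F z n * (y n * expStrip (-P (t n)) (-Q (t n)) z) with hg
  have hg0 : g 0 = ∑ n ∈ y.support, F 0 n * y n := by simp [hg]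
  rw [← hg0]
  choose R hR using hF.bounded
  have hR0 : ∀ n, 0 ≤ R n := fun n => (norm_nonneg _).trans (hR n 0 (by simp))
  refine norm_apply_zero_le (R := ∑ n ∈ y.support, R n * (‖y n‖ * Real.exp (|-P (t n)| + |-Q (t n)|)))
    ?_ (fun z hz => ?_) hM (ae_of_ae_arcs fun j => ?_)
  · exact DifferentiableOn.fun_sum fun n _ =>
      (hF.analytic n).mul ((differentiableOn_expStrip _ _).const_mul _)
  · refine (norm_sum_le _ _).trans (Finset.sum_le_sum fun n _ => ?_)
    rw [norm_mul, norm_mul]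
    exact mul_le_mul (hR n z hz) (mul_le_mul_of_nonneg_left
      (norm_expStrip_le _ _ (mem_ball_zero_iff.1 hz)) (norm_nonneg _)) (by positivity) (hR0 n)
  · have hb := hF.boundary j
    rw [ae_restrict_iff' measurableSet_Ioo] at hb ⊢
    filter_upwards [hb] with θ hθ hθj
    obtain ⟨b, h1, h2⟩ := hθ hθj
    refine ⟨∑ n ∈ y.support, b n * (y n * expStrip (-P (t n)) (-Q (t n)) (Complex.exp (θ * Complex.I))),
      tendsto_finsetSum _ fun n _ => (tendsto_pi_nhds.1 h1 n).mul
        ((expStrip_boundary hθj _ _).1.const_mul _), ?_⟩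
    refine (norm_sum_le _ _).trans (le_trans (Finset.sum_le_sum fun n _ => le_of_eq ?_)
      (sum_norm_mul_weight_le hM h2 hy))
    rw [norm_mul, norm_mul, (expStrip_boundary hθj _ _).2, weight]
    congr 4
    simp only [arcWeight, t]
    ring

lemma IsAdmissible.interpolatesToL2 (h : IsAdmissible P Q) : InterpolatesToL2 h.family :=
  ⟨2, fun x => ⟨_, h.memF_extremal x, extremal_zero P Q x⟩, fun F M hM hF => by
    obtain ⟨x, h1, h2⟩ := h.exists_of_memF hM hF
    exact ⟨x, h1, h2.trans (by linarith)⟩⟩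

/-! ### The induced centralizer -/

/-- Dividing `F - G` by `z` does not change norms on the circle, and the value at `0` becomes the
difference of the derivatives. Applied to a selection and the extremal function, this shows that all
selections induce the same centralizer up to a bounded error. -/
lemma MemF.dslope_sub {X : Fin 4 → BanachSeqSpace} {F G : ℂ → ℕ → ℂ} {M N : ℝ} (hM : 0 ≤ M)
    (hN : 0 ≤ N) (hF : MemF X F M) (hG : MemF X G N) (h0 : F 0 = G 0) :
    MemF X (fun z n => dslope (fun z => F z n - G z n) 0 z) (M + N) where
  analytic n := (Complex.differentiableOn_dslope (Metric.ball_mem_nhds 0 one_pos)).2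
    ((hF.analytic n).sub (hG.analytic n))
  bounded n := by
    obtain ⟨R, hR⟩ := hF.bounded n
    obtain ⟨R', hR'⟩ := hG.bounded n
    refine ⟨(R + R') / 1, fun z hz => ?_⟩
    refine Complex.norm_dslope_le_div_of_mapsTo_ball ((hF.analytic n).sub (hG.analytic n))
      (fun w hw => ?_) hz
    rw [h0, sub_self, mem_closedBall_zero_iff]
    exact (norm_sub_le _ _).trans (add_le_add (hR w hw) (hR' w hw))
  boundary j := by
    filter_upwards [hF.boundary j, hG.boundary j] with θ ⟨b, h1, h2⟩ ⟨b', h1', h2'⟩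
    set w := Complex.exp (θ * Complex.I) with hw
    have hw1 : ‖w‖ = 1 := Complex.norm_exp_ofReal_mul_I θ
    have hw0 : w ≠ 0 := Complex.exp_ne_zero _
    refine ⟨w⁻¹ • (b + (-1 : ℂ) • b'), tendsto_pi_nhds.2 fun n => ?_, ?_⟩
    · have ht : Tendsto (fun r : ℝ => (r : ℂ) * w) (𝓝[<] 1) (𝓝 w) := by
        have : Continuous fun r : ℝ => (r : ℂ) * w := by fun_prop
        simpa using (this.tendsto 1).mono_left nhdsWithin_le_nhds
      have hlim := (ht.inv₀ hw0).mul ((tendsto_pi_nhds.1 h1 n).sub (tendsto_pi_nhds.1 h1' n))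
      have e : (w⁻¹ • (b + (-1 : ℂ) • b')) n = w⁻¹ * (b n - b' n) := by
        simp [sub_eq_add_neg]
      rw [e]
      refine hlim.congr' ?_
      filter_upwards [mem_nhdsWithin_of_mem_nhds (lt_mem_nhds one_pos)] with r hr
      have hr' : (0 : ℝ) < r := hr
      have hne : (r : ℂ) * w ≠ 0 := mul_ne_zero (by exact_mod_cast hr'.ne') hw0
      rw [dslope_of_ne _ hne, slope_def_field, h0, sub_self, sub_zero, sub_zero, div_eq_inv_mul]
    · rw [(X j).nrm_smul, enorm_inv hw0, ENNReal.ofReal_add hM hN]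
      have e1 : ‖w‖ₑ = 1 := by rw [← ofReal_norm, hw1, ENNReal.ofReal_one]
      rw [e1, inv_one, one_mul]
      refine ((X j).nrm_add_le _ _).trans (add_le_add h2 ?_)
      rw [(X j).nrm_smul]
      simpa using h2'

lemma MemF.mono {X : Fin 4 → BanachSeqSpace} {F : ℂ → ℕ → ℂ} {M N : ℝ} (hF : MemF X F M) (h : M ≤ N) :
    MemF X F N where
  analytic := hF.analytic
  bounded := hF.bounded
  boundary j := by
    filter_upwards [hF.boundary j] with θ ⟨b, h1, h2⟩
    exact ⟨b, h1, h2.trans (ENNReal.ofReal_le_ofReal h)⟩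

lemma arisesByInterpolation_of_isAdmissible {φ : LipZero} {P Q : ℝ≥0 → ℝ} (h : IsAdmissible P Q) {ε : ℝ}
    (hε : ε ≠ 0) (hφ : ∀ t, (P t : ℂ) - Q t * Complex.I = ε * (φ : ℝ≥0 → ℂ) t) :
    ArisesByInterpolation φ := by
  refine ⟨h.family, h.interpolatesToL2, -(4 * Complex.I / Real.pi) * ε, ?_, fun B hB => ?_⟩
  · have : (Real.pi : ℂ) ≠ 0 := by exact_mod_cast Real.pi_ne_zero
    have : (ε : ℂ) ≠ 0 := by exact_mod_cast hε
    simp [*]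
  obtain ⟨K, hK⟩ := hB.bounded
  refine ⟨|K| + 2, fun x => ?_⟩
  set X := toL2 x with hX
  have hB' : MemF h.family (B X) (|K| * ‖X‖) :=
    (hK X).mono (mul_le_mul_of_nonneg_right (le_abs_self K) (norm_nonneg _))
  have h0 : B X 0 = extremal P Q X 0 := by rw [hB.eval, extremal_zero]
  obtain ⟨w, hw, hw'⟩ := h.exists_of_memF (by positivity)
    (hB'.dslope_sub (by positivity) (by positivity) (h.memF_extremal X) h0)
  refine ⟨w, fun n => ?_, hw'.trans_eq (by ring)⟩
  rw [← hw]
  have hball : Metric.ball (0 : ℂ) 1 ∈ 𝓝 0 := Metric.ball_mem_nhds 0 one_pos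
  have hd := (hasDerivAt_expStrip (P (logCoord X n)) (Q (logCoord X n))).const_mul (X n)
  -- For the extremal functions the derivative is an exact multiple of `Ω_φ`, with no error term.
  have hd' : deriv (fun z => extremal P Q X z n) 0 = -(4 * Complex.I / Real.pi) * ε * Omega φ x n := by
    refine hd.deriv.trans ?_
    rw [hφ, Omega_apply, hX, toL2_apply, logCoord, toL2_apply]
    ring
  refine (dslope_same _ _).trans
    ((deriv_fun_sub ((hB'.analytic n).differentiableAt hball) hd.differentiableAt).trans ?_)
  exact congrArg (derivation B X n - ·) hd'

lemma arisesByInterpolation (φ : LipZero) : ArisesByInterpolation φ := by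
  obtain ⟨h0, K, hK⟩ := φ.2
  have hK1 : (0 : ℝ) < 2 * (K + 1) := by positivity
  -- The factor makes the two Lipschitz constants sum to at most `1`. The sign of `Q` matches the
  -- `-i` in the derivative.
  refine arisesByInterpolation_of_isAdmissible (ε := (2 * (K + 1))⁻¹)
    (P := fun t => (2 * (K + 1) : ℝ)⁻¹ * ((φ : ℝ≥0 → ℂ) t).re)
    (Q := fun t => -((2 * (K + 1) : ℝ)⁻¹ * ((φ : ℝ≥0 → ℂ) t).im)) ⟨by simp [h0], by simp [h0], ?_⟩
    (inv_ne_zero hK1.ne') fun t => ?_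
  · intro s t
    have h1 := hK.dist_le_mul s t
    rw [dist_eq_norm] at h1
    have h2 := (Complex.abs_re_le_norm _).trans h1
    have h3 := (Complex.abs_im_le_norm _).trans h1
    rw [Complex.sub_re] at h2
    rw [Complex.sub_im] at h3
    rw [← mul_sub, abs_mul, neg_sub_neg, ← mul_sub, abs_mul, abs_sub_comm (Complex.im _),
      abs_of_pos (inv_pos.2 hK1), ← mul_add, inv_mul_le_iff₀ hK1]
    have h4 : 0 ≤ dist s t := dist_nonneg
    linarith
  · conv_rhs => rw [← Complex.re_add_im ((φ : ℝ≥0 → ℂ) t)]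
    push_cast
    ring

end TwistedHilbert

end

/-! ### The main theorem -/

theorem mainTheorem1 :
    ∃ G : Set TwistedHilbert.LipZero, G.Infinite ∧ LinearIndepOn ℂ id G ∧
      (∀ ζ ∈ ConvexCone.hull ℝ G,
        TwistedHilbert.IsBiLipschitz (ζ : NNReal → ℂ) ∧
        TwistedHilbert.IsSingularTwistedHilbert (TwistedHilbert.incl ζ) (TwistedHilbert.quot ζ) ∧
        TwistedHilbert.IsoDual (TwistedHilbert.Z ζ) ∧
        ¬ TwistedHilbert.IsoConjDual (TwistedHilbert.Z ζ) ∧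
        TwistedHilbert.ArisesByInterpolation ζ) ∧
      (∀ ζ₁ ∈ ConvexCone.hull ℝ G, ∀ ζ₂ ∈ ConvexCone.hull ℝ G, (∀ c : ℂ, ζ₁ ≠ c • ζ₂) →
        TwistedHilbert.Incomparable (TwistedHilbert.Z ζ₁) (TwistedHilbert.Z ζ₂)) := by
  refine ⟨Set.range TwistedHilbert.generator,
    Set.infinite_range_of_injective TwistedHilbert.linearIndependent_generator.injective,
    TwistedHilbert.linearIndependent_generator.linearIndepOn_id, fun ζ hζ => ?_,
    fun ζ₁ h₁ ζ₂ h₂ h => ?_⟩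
  · obtain ⟨c, hc, hc0, h⟩ := TwistedHilbert.exists_hasCoeffs hζ
    have hb := h.isBiLipschitz hc hc0
    exact ⟨hb, ⟨TwistedHilbert.isBanachable_Z ζ, TwistedHilbert.isEmbedding_incl ζ,
      TwistedHilbert.range_incl ζ, TwistedHilbert.isQuotientMap_quot ζ,
      TwistedHilbert.isStrictlySingular_quot ζ hb⟩, TwistedHilbert.isoDual_Z ζ,
      TwistedHilbert.not_isoConjDual h hc hc0, TwistedHilbert.arisesByInterpolation ζ⟩
  · obtain ⟨c, hc, hc0, hc'⟩ := TwistedHilbert.exists_hasCoeffs h₁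
    obtain ⟨d, hd, hd0, hd'⟩ := TwistedHilbert.exists_hasCoeffs h₂
    exact TwistedHilbert.incomparable_of_hasCoeffs hc' hd' hc hd hc0 hd0 h
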